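/- Let $n\ge 0$ and let $\mathbb{T}^{(n)}=\mathbb{R}_{>0}^n\cup\{0\}$ be the idempotent semiring with componentwise multiplication, whose addition is the maximum for the lexicographical order (with $0$ as smallest element), endowed with the order topology. Let $k$ be a field, $v:k\to\mathbb{T}^{(n)}$ a valuation (multiplicative, $v(0)=0$, $v(1)=1$, $v(a+b)\le\max\{v(a),v(b)\}$), $R$ a $k$-algebra and $Y=\operatorname{Spec} R$. The Foster–Ranganathan analytification $\mathrm{An}_v^{FR}(Y)$ is the set of all valuations $w:R\to\mathbb{T}^{(n)}$ extending $v$, with the compact-open topology for discrete $R$. For an ordered blueprint $B$ over $k$ (a commutative monoid with zero $B^\bullet$ with a relation $\sum a_i\le\sum b_j$ between finite formal sums satisfying the axioms of a subaddition, together with a morphism from $k$), let $\mathrm{Bend}_v(B)$ be the ordered blueprint over $\mathbb{T}^{(n)}$ with underlying monoid the quotient of $B^\bullet\otimes_{k^\bullet}\mathbb{T}^{(n)}$ and subaddition generated by that of $\mathbb{T}^{(n)}$ and the relations $a\otimes1+\sum b_j\otimes1\equiv\sum b_j\otimes1$ whenever $a\le\sum b_j$ in $B$. For $X=\operatorname{Spec}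 B$ (prime $k$-ideals with the structure sheaf of ordered blueprints) let $\mathrm{Bend}_v(X)=\operatorname{Spec}\mathrm{Bend}_v(B)$, and let $\mathrm{Bend}_v(X)(\mathbb{T}^{(n)})$ be the set of morphisms $\operatorname{Spec}\mathbb{T}^{(n)}\to\mathrm{Bend}_v(X)$ of ordered blueprinted spaces over $\operatorname{Spec}\mathbb{T}^{(n)}$, with the fine topology: the finest topology for which every map $U(\mathbb{T}^{(n)})\to \mathrm{Bend}_v(X)(\mathbb{T}^{(n)})$ induced by a morphism from an affine ordered blue $\mathbb{T}^{(n)}$-scheme $U$ is continuous, where $U(\mathbb{T}^{(n)})=\operatorname{Hom}_{\mathbb{T}^{(n)}}(\Gamma U,\mathbb{T}^{(n)})$ has the topology of pointwise convergence. Then there is a homeomorphism $\mathrm{An}_v^{FR}(Y)\simeq\mathrm{Bend}_v(Y)(\mathbb{T}^{(n)})$ that sends $w$ to the point given by $b\otimes1\mapsto w(b)$. Let moreover $A$ be a finitely generated commutative monoid with zero, let $k[A]^+$ be the monoid algebra in which the zero of $A$ is identified with $0$, and let $\pi:k[A]^+\to R$ be a surjection of $k$-algebras, i.e. a closed immersion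 $\iota:Y\to\operatorname{Spec}k[A]^+$ (for instance into an affine toric variety). Let $\mathrm{trop}_{v,\iota}^{FR}:\mathrm{An}_v^{FR}(Y)\to\operatorname{Hom}(A,\mathbb{T}^{(n)})$ be the map that sends $w$ to the composition $A\to k[A]^+\to R\to\mathbb{T}^{(n)}$, where $\operatorname{Hom}(A,\mathbb{T}^{(n)})$ has the compact-open topology for discrete $A$, and let the Foster–Ranganathan tropicalization $\mathrm{Trop}_{v,\iota}^{FR}(Y)$ be its image with the subspace topology. Let $Z$ be the spectrum of the blueprint of monomials $ca$ ($c\in k$, $a\in A$) modulo all relations $\sum c_ia_i\equiv\sum d_jb_j$ with $\sum\pi(c_ia_i)=\sum\pi(d_jb_j)$ in $R$, and $\beta:Y\to Z$ the morphism induced by $ca\mapsto\pi(ca)$. Then there is a homeomorphism $\mathrm{Trop}_{v,\iota}^{FR}(Y)\simeq\mathrm{Bend}_v(Z)(\mathbb{T}^{(n)})$ that sends $y$ to the point given by $ca\otimes1\mapsto v(c)y(a)$, and the square formed by these two homeomorphisms, $\mathrm{trop}_{v,\iota}^{FR}$ and $\mathrm{Bend}_v(\beta)(\mathbb{T}^{(n)})$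 is a commutative square of continuous maps. -/

import Mathlib

open TopologicalSpace

universe u v w x

namespace BlueScheme

/-! ### Formal sums and subadditions

A finite formal sum `∑ aᵢ` of elements of a monoid with zero `A` is a multiset in `A`
(the zero of `A` is not identified with the empty sum). -/

/-- The product `∑ aᵢ cₖ` of the formal sums `∑ aᵢ` and `∑ cₖ`. -/
def sumMul {A : Type u} [Mul A] (s t : Multiset A) : Multiset A :=
  (s ×ˢ t).map fun p => p.1 * p.2

theorem sumMul_zero_left {A : Type u} [Mul A] (t : Multiset A) : sumMul 0 t = 0 := rfl

theorem sumMul_cons {A : Type u} [Mul A] (a : A) (s t : Multiset A) :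
    sumMul (a ::ₘ s) t = t.map (a * ·) + sumMul s t := by
  simp [sumMul, Multiset.map_map]

theorem sumMul_singleton {A : Type u} [Mul A] (a : A) (t : Multiset A) :
    sumMul {a} t = t.map (a * ·) := by
  have := sumMul_cons a 0 t
  rwa [sumMul_zero_left, add_zero] at this

theorem map_sumMul {A : Type u} {B : Type v} [Mul A] [Mul B] (f : A → B)
    (hf : ∀ x y, f (x * y) = f x * f y) (s t : Multiset A) :
    (sumMul s t).map f = sumMul (s.map f) (t.map f) := by
  induction s using Multiset.induction_on with
  | empty => simp [sumMul_zero_left]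
  | cons a s ih => simp [sumMul_cons, ih, Multiset.map_map, hf]

theorem sum_sumMul {R : Type u} [CommSemiring R] (s t : Multiset R) :
    (sumMul s t).sum = s.sum * t.sum := by
  induction s using Multiset.induction_on with
  | empty => simp [sumMul_zero_left]
  | cons a s ih =>
    have h : (t.map (a * ·)).sum = a * t.sum := by
      simpa using Multiset.sum_map_mul_left (s := t) (a := a) (f := fun x => x)
    rw [sumMul_cons, Multiset.sum_add, h, ih, Multiset.sum_cons, add_mul]

/-- A relation on formal sums that satisfies all axioms of a subaddition except possibly
the last one (properness). -/
structure Subaddition (A : Type u) [CommMonoidWithZero A] where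
  le : Multiset A → Multiset A → Prop
  refl : ∀ a, le {a} {a}
  trans : ∀ {s t r}, le s t → le t r → le s r
  add : ∀ {s t s' t'}, le s t → le s' t' → le (s + s') (t + t')
  mul : ∀ {s t s' t'}, le s t → le s' t' → le (sumMul s s') (sumMul t t')
  zero_le : le {0} 0
  le_zero : le 0 {0}

namespace Subaddition

variable {A : Type u} [CommMonoidWithZero A]

theorem refl_sum (P : Subaddition A) (s : Multiset A) : P.le s s := by
  induction s using Multiset.induction_on with
  | empty => exact P.trans P.le_zero P.zero_le
  | cons a s ih => exact P.add (P.refl a) ih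

theorem smul (P : Subaddition A) (c : A) {s t : Multiset A} (h : P.le s t) :
    P.le (s.map (c * ·)) (t.map (c * ·)) := by
  have := P.mul (P.refl c) h
  rwa [sumMul_singleton, sumMul_singleton] at this

/-- The congruence `a ≡ b`, i.e. `a ≤ b` and `b ≤ a`. -/
def con (P : Subaddition A) : Con A where
  r a b := P.le {a} {b} ∧ P.le {b} {a}
  iseqv :=
    ⟨fun a => ⟨P.refl a, P.refl a⟩, fun h => ⟨h.2, h.1⟩,
      fun h h' => ⟨P.trans h.1 h'.1, P.trans h'.2 h.2⟩⟩
  mul' := by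
    intro a b c d h h'
    have h1 := P.mul h.1 h'.1
    have h2 := P.mul h.2 h'.2
    simp only [sumMul_singleton, Multiset.map_singleton] at h1 h2
    exact ⟨h1, h2⟩

end Subaddition

/-- The quotient of a monoid with zero by a congruence is a monoid with zero. -/
instance conQuotientMonoidWithZero {A : Type u} [CommMonoidWithZero A] (c : Con A) :
    CommMonoidWithZero c.Quotient :=
  { (inferInstance : CommMonoid c.Quotient) with
    zero := ((0 : A) : c.Quotient)
    zero_mul := by
      intro x
      induction x using Con.induction_on with
      | H a => exact congrArg (fun y : A => (y : c.Quotient)) (zero_mul a)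
    mul_zero := by
      intro x
      induction x using Con.induction_on with
      | H a => exact congrArg (fun y : A => (y : c.Quotient)) (mul_zero a) }

/-- The quotient map as a morphism of monoids with zero. -/
def conMk {A : Type u} [CommMonoidWithZero A] (c : Con A) : A →*₀ c.Quotient where
  toFun a := (a : c.Quotient)
  map_zero' := rfl
  map_one' := rfl
  map_mul' _ _ := rfl

/-- An ordered blueprint: a commutative monoid with zero together with a proper subaddition. -/
structure OrderedBlueprint where
  carrier : Type u
  [monoid : CommMonoidWithZero carrier]
  sub : Subaddition carrier
  proper : ∀ a b, sub.le {a} {b} → sub.le {b} {a} → a = b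

instance : CoeSort OrderedBlueprint.{u} (Type u) := ⟨OrderedBlueprint.carrier⟩

instance (B : OrderedBlueprint.{u}) : CommMonoidWithZero B := B.monoid

/-- The relation `∑ aᵢ ≤ ∑ bⱼ` of an ordered blueprint. -/
abbrev OrderedBlueprint.le (B : OrderedBlueprint.{u}) : Multiset B → Multiset B → Prop := B.sub.le

/-- A morphism of ordered blueprints. -/
@[ext]
structure BPHom (B : OrderedBlueprint.{u}) (C : OrderedBlueprint.{v}) where
  hom : B →*₀ C
  map_le : ∀ {s t : Multiset B}, B.le s t → C.le (s.map hom) (t.map hom)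

instance (B : OrderedBlueprint.{u}) (C : OrderedBlueprint.{v}) :
    CoeFun (BPHom B C) (fun _ => B → C) := ⟨fun f => f.hom⟩

/-- The identity morphism of an ordered blueprint. -/
def BPHom.id (B : OrderedBlueprint.{u}) : BPHom B B where
  hom := MonoidWithZeroHom.id B
  map_le h := by simpa using h

/-- The composition `g ∘ f` of morphisms of ordered blueprints. -/
def BPHom.comp {B : OrderedBlueprint.{u}} {C : OrderedBlueprint.{v}} {D : OrderedBlueprint.{w}}
    (g : BPHom C D) (f : BPHom B C) : BPHom B D where
  hom := g.hom.comp f.hom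
  map_le h := by
    have := g.map_le (f.map_le h)
    simpa [Multiset.map_map, Function.comp_def] using this

theorem le_map_map (C : OrderedBlueprint.{u}) {α : Type v} {β : Type w} {f : α → β} {g : β → C}
    {h : α → C} (e : ∀ x, g (f x) = h x) {s t : Multiset α} :
    C.le ((s.map f).map g) ((t.map f).map g) ↔ C.le (s.map h) (t.map h) := by
  have : g ∘ f = h := funext e
  rw [Multiset.map_map, Multiset.map_map, this]

theorem le_of_le_map_map (C : OrderedBlueprint.{u}) {α : Type v} {β : Type w} {f : α → β} {g : β → C}
    {s t : Multiset α} (H : C.le ((s.map f).map g) ((t.map f).map g)) {h : α → C}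
    (e : ∀ x, g (f x) = h x) : C.le (s.map h) (t.map h) := (le_map_map C e).1 H

/-! ### Proper quotients and generated subadditions -/

section Proper

variable {A : Type u} [CommMonoidWithZero A]

theorem Subaddition.le_of_map_eq (P : Subaddition A) {s t : Multiset A}
    (h : s.map (conMk P.con) = t.map (conMk P.con)) : P.le s t := by
  rw [← Multiset.rel_eq, Multiset.rel_map] at h
  induction h with
  | zero => exact P.refl_sum 0
  | cons hab _ ih => exact P.add ((Con.eq P.con).1 hab).1 ih

/-- The proper quotient of a pair satisfying all axioms except properness: identify `a` and `b`
whenever `a ≡ b`; a relation holds between formal sums of classes if it holds for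
representatives. -/
def Subaddition.toProper (P : Subaddition A) : OrderedBlueprint.{u} where
  carrier := P.con.Quotient
  sub :=
    { le := fun s t => ∃ s' t' : Multiset A,
        s'.map (conMk P.con) = s ∧ t'.map (conMk P.con) = t ∧ P.le s' t'
      refl := by
        intro a
        induction a using Con.induction_on with
        | H a => exact ⟨{a}, {a}, rfl, rfl, P.refl a⟩
      trans := by
        rintro s t r ⟨s', t', rfl, ht, h⟩ ⟨t'', r', ht', rfl, h'⟩
        exact ⟨s', r', rfl, rfl,
          P.trans h (P.trans (P.le_of_map_eq (ht.trans ht'.symm)) h')⟩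
      add := by
        rintro _ _ _ _ ⟨s, t, rfl, rfl, h⟩ ⟨s', t', rfl, rfl, h'⟩
        exact ⟨s + s', t + t', Multiset.map_add _ _ _, Multiset.map_add _ _ _, P.add h h'⟩
      mul := by
        rintro _ _ _ _ ⟨s, t, rfl, rfl, h⟩ ⟨s', t', rfl, rfl, h'⟩
        exact ⟨sumMul s s', sumMul t t', map_sumMul _ (map_mul _) _ _,
          map_sumMul _ (map_mul _) _ _, P.mul h h'⟩
      zero_le := ⟨{0}, 0, rfl, rfl, P.zero_le⟩
      le_zero := ⟨0, {0}, rfl, rfl, P.le_zero⟩ }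
  proper := by
    intro a b
    induction a using Con.induction_on with
    | H a =>
      induction b using Con.induction_on with
      | H b =>
        rintro ⟨s, t, hs, ht, h⟩ ⟨t', s', ht', hs', h'⟩
        have ha : ∀ r : Multiset A, r.map (conMk P.con) = {(a : P.con.Quotient)} →
            r.map (conMk P.con) = Multiset.map (conMk P.con) {a} := fun r hr => hr
        have hb : ∀ r : Multiset A, r.map (conMk P.con) = {(b : P.con.Quotient)} →
            r.map (conMk P.con) = Multiset.map (conMk P.con) {b} := fun r hr => hr
        refine (Con.eq P.con).2 ⟨?_, ?_⟩
        · exact P.trans (P.le_of_map_eq (ha s hs).symm) (P.trans h (P.le_of_map_eq (hb t ht)))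
        · exact P.trans (P.le_of_map_eq (hb t' ht').symm)
            (P.trans h' (P.le_of_map_eq (ha s' hs')))

/-- The canonical map to the proper quotient. -/
def Subaddition.quot (P : Subaddition A) : A →*₀ P.toProper := conMk P.con

theorem Subaddition.quot_surjective (P : Subaddition A) : Function.Surjective P.quot := by
  intro x
  induction x using Con.induction_on with
  | H a => exact ⟨a, rfl⟩

theorem Subaddition.quot_le (P : Subaddition A) {s t : Multiset A} (h : P.le s t) :
    P.toProper.le (s.map P.quot) (t.map P.quot) := ⟨s, t, rfl, rfl, h⟩

/-- A relation preserving morphism of monoids into an ordered blueprint factors through the proper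
quotient. -/
def Subaddition.lift (P : Subaddition A) {C : OrderedBlueprint.{v}} (f : A →*₀ C)
    (hf : ∀ {s t : Multiset A}, P.le s t → C.le (s.map f) (t.map f)) : BPHom P.toProper C where
  hom :=
    { toFun := fun x => Con.liftOn x f fun a b h => C.proper _ _
        (by simpa using hf h.1) (by simpa using hf h.2)
      map_zero' := map_zero f
      map_one' := map_one f
      map_mul' := by
        intro x y
        induction x, y using Con.induction_on₂ with
        | H a b => exact map_mul f a b }
  map_le := by
    rintro _ _ ⟨s, t, rfl, rfl, h⟩
    exact (le_map_map C (fun _ => rfl)).2 (hf h)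

theorem Subaddition.lift_quot (P : Subaddition A) {C : OrderedBlueprint.{v}} (f : A →*₀ C)
    (hf : ∀ {s t : Multiset A}, P.le s t → C.le (s.map f) (t.map f)) (a : A) :
    P.lift f hf (P.quot a) = f a := rfl

/-- The closure of a set `S` of relations under all axioms of a subaddition except properness. -/
inductive GenLe (S : Multiset A → Multiset A → Prop) : Multiset A → Multiset A → Prop
  | of {s t} : S s t → GenLe S s t
  | refl (a) : GenLe S {a} {a}
  | trans {s t r} : GenLe S s t → GenLe S t r → GenLe S s r
  | add {s t s' t'} : GenLe S s t → GenLe S s' t' → GenLe S (s + s') (t + t')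
  | mul {s t s' t'} : GenLe S s t → GenLe S s' t' → GenLe S (sumMul s s') (sumMul t t')
  | zero_le : GenLe S {0} 0
  | le_zero : GenLe S 0 {0}

/-- The closure of a set of relations, as a subaddition. -/
def gen (S : Multiset A → Multiset A → Prop) : Subaddition A where
  le := GenLe S
  refl := GenLe.refl
  trans := GenLe.trans
  add := GenLe.add
  mul := GenLe.mul
  zero_le := GenLe.zero_le
  le_zero := GenLe.le_zero

theorem gen_map_le {S : Multiset A → Multiset A → Prop} {C : OrderedBlueprint.{v}} (f : A →*₀ C)
    (hf : ∀ s t, S s t → C.le (s.map f) (t.map f)) {s t : Multiset A} (h : (gen S).le s t) :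
    C.le (s.map f) (t.map f) := by
  induction h with
  | of h => exact hf _ _ h
  | refl a => exact C.sub.refl_sum _
  | trans _ _ h h' => exact C.sub.trans h h'
  | add _ _ h h' => rw [Multiset.map_add, Multiset.map_add]; exact C.sub.add h h'
  | mul _ _ h h' =>
    rw [map_sumMul _ (map_mul f), map_sumMul _ (map_mul f)]
    exact C.sub.mul h h'
  | zero_le => simpa using C.sub.zero_le
  | le_zero => simpa using C.sub.le_zero

end Proper

/-- Given a morphism `f` of monoids with zero into a semiring, the relations
`∑ aᵢ ≡ ∑ bⱼ` with `∑ f(aᵢ) = ∑ f(bⱼ)`. -/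
def Subaddition.ofHom {A : Type u} [CommMonoidWithZero A] {R : Type v} [CommSemiring R]
    (f : A →*₀ R) : Subaddition A where
  le s t := (s.map f).sum = (t.map f).sum
  refl _ := rfl
  trans h h' := h.trans h'
  add h h' := by simp only [Multiset.map_add, Multiset.sum_add, h, h']
  mul h h' := by simp only [map_sumMul _ (map_mul f), sum_sumMul, h, h']
  zero_le := by simp
  le_zero := by simp

/-- A semiring, considered as an (algebraic) blueprint. -/
abbrev ofSemiring (R : Type u) [CommSemiring R] : OrderedBlueprint.{u} where
  carrier := R
  sub := Subaddition.ofHom (MonoidWithZeroHom.id R)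
  proper a b h _ := by simpa [Subaddition.ofHom] using h

/-- A homomorphism of semirings, considered as a morphism of blueprints. -/
def ofRingHom {R : Type u} {S : Type v} [CommSemiring R] [CommSemiring S] (f : R →+* S) :
    BPHom (ofSemiring R) (ofSemiring S) where
  hom := (f.toMonoidWithZeroHom : R →*₀ S)
  map_le {s t} h := by
    have key : ∀ M : Multiset R, ((M.map f).map fun x : S => x).sum
        = f ((M.map fun x : R => x).sum) := by
      intro M
      rw [Multiset.map_id', Multiset.map_id', map_multiset_sum]
    exact (key s).trans ((congrArg f h).trans (key t).symm)

/-! ### Localizations -/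

section Localization

variable {A : Type u} [CommMonoidWithZero A] {S : Submonoid A}

theorem exists_common_factor {s s' : S} {M N : Multiset A}
    (h : M.map (fun a => Localization.mk a s) = N.map (fun a => Localization.mk a s')) :
    ∃ c : S, M.map (fun a => (c : A) * (s' * a)) = N.map (fun a => (c : A) * (s * a)) := by
  rw [← Multiset.rel_eq, Multiset.rel_map] at h
  induction h with
  | zero => exact ⟨1, rfl⟩
  | cons hab _ ih =>
    obtain ⟨c, hc⟩ := ih
    rw [Localization.mk_eq_mk_iff, Localization.r_iff_exists] at hab
    obtain ⟨d, hd⟩ := hab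
    refine ⟨c * d, ?_⟩
    have key := congrArg (Multiset.map (fun x => (d : A) * x)) hc
    rw [Multiset.map_map, Multiset.map_map] at key
    simp only [Multiset.map_cons, Submonoid.coe_mul]
    congr 1
    · simp only at hd
      rw [mul_assoc, mul_assoc, hd]
    · refine Eq.trans ?_ (key.trans ?_)
      · refine Multiset.map_congr rfl fun x _ => ?_
        rw [Function.comp_apply, mul_comm (c : A), mul_assoc]
      · refine Multiset.map_congr rfl fun x _ => ?_
        rw [Function.comp_apply, ← mul_assoc, mul_comm (d : A)]

theorem mk_mul_cancel (c s : S) (a : A) :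
    Localization.mk ((c : A) * a) (c * s) = Localization.mk a s := by
  rw [Localization.mk_eq_mk_iff, Localization.r_iff_exists]
  refine ⟨1, ?_⟩
  change ((1 : S) : A) * (s * (c * a)) = ((1 : S) : A) * (c * s * a)
  rw [mul_left_comm (s : A), mul_assoc]

/-- The subaddition on `S⁻¹A` generated by the relations `∑ aᵢ/1 ≤ ∑ bⱼ/1` for `∑ aᵢ ≤ ∑ bⱼ`,
written out explicitly with common denominators: its relations are the
`∑ aᵢ/s ≤ ∑ bⱼ/s` with `∑ aᵢ ≤ ∑ bⱼ` and `s ∈ S`. -/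
def Subaddition.localize (P : Subaddition A) (S : Submonoid A) : Subaddition (Localization S) where
  le M N := ∃ (s : S) (M' N' : Multiset A), M = M'.map (fun a => Localization.mk a s) ∧
    N = N'.map (fun a => Localization.mk a s) ∧ P.le M' N'
  refl x := by
    induction x using Localization.induction_on with
    | H y => exact ⟨y.2, {y.1}, {y.1}, rfl, rfl, P.refl _⟩
  trans := by
    rintro _ N _ ⟨s, M, N1, rfl, h1, h⟩ ⟨s', N2, R, h2, rfl, h'⟩
    obtain ⟨c, hc⟩ := exists_common_factor (h1.symm.trans h2)
    refine ⟨c * s' * s, M.map (((c * s' : S) : A) * ·), R.map (((c * s : S) : A) * ·), ?_, ?_, ?_⟩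
    · rw [Multiset.map_map]
      exact Multiset.map_congr rfl fun a _ => (mk_mul_cancel (c * s') s a).symm
    · rw [Multiset.map_map]
      refine Multiset.map_congr rfl fun a _ => ?_
      rw [Function.comp_apply, show c * s' * s = (c * s) * s' by ac_rfl, mk_mul_cancel]
    · refine P.trans (P.smul _ h) (P.trans ?_ (P.smul _ h'))
      have : N1.map (((c * s' : S) : A) * ·) = N2.map (((c * s : S) : A) * ·) := by
        simpa [mul_assoc] using hc
      rw [this]
      exact P.refl_sum _
  add := by
    rintro _ _ _ _ ⟨s, M, N, rfl, rfl, h⟩ ⟨s', M', N', rfl, rfl, h'⟩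
    have e : ∀ X : Multiset A, (X.map ((s' : A) * ·)).map (fun a => Localization.mk a (s' * s))
        = X.map (fun a => Localization.mk a s) := by
      intro X
      rw [Multiset.map_map]
      exact Multiset.map_congr rfl fun a _ => mk_mul_cancel s' s a
    have e' : ∀ X : Multiset A, (X.map ((s : A) * ·)).map (fun a => Localization.mk a (s' * s))
        = X.map (fun a => Localization.mk a s') := by
      intro X
      rw [Multiset.map_map]
      refine Multiset.map_congr rfl fun a _ => ?_
      rw [Function.comp_apply, mul_comm s' s, mk_mul_cancel]
    refine ⟨s' * s, M.map ((s' : A) * ·) + M'.map ((s : A) * ·),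
      N.map ((s' : A) * ·) + N'.map ((s : A) * ·), ?_, ?_, P.add (P.smul _ h) (P.smul _ h')⟩
    · rw [Multiset.map_add, e, e']
    · rw [Multiset.map_add, e, e']
  mul := by
    rintro _ _ _ _ ⟨s, M, N, rfl, rfl, h⟩ ⟨s', M', N', rfl, rfl, h'⟩
    have e : ∀ X Y : Multiset A,
        sumMul (X.map (fun a => Localization.mk a s)) (Y.map (fun a => Localization.mk a s'))
        = (sumMul X Y).map (fun a => Localization.mk a (s * s')) := by
      intro X Y
      induction X using Multiset.induction_on with
      | empty => simp [sumMul_zero_left]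
      | cons a X ih =>
        simp [sumMul_cons, ih, Multiset.map_map, Localization.mk_mul]
    exact ⟨s * s', _, _, e _ _, e _ _, P.mul h h'⟩
  zero_le := ⟨1, {0}, 0, by simp [Localization.mk_zero], rfl, P.zero_le⟩
  le_zero := ⟨1, 0, {0}, rfl, by simp [Localization.mk_zero], P.le_zero⟩

theorem Subaddition.localize_single (P : Subaddition A) {a b : A} {s t : S}
    (h : (P.localize S).le {Localization.mk a s} {Localization.mk b t}) :
    ∃ e : S, P.le {(e : A) * (t * a)} {(e : A) * (s * b)} := by
  obtain ⟨r, M, N, hM, hN, h⟩ := h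
  obtain ⟨c, hc⟩ := exists_common_factor (M := {a}) (s := s) (s' := r) (N := M) (by simpa using hM)
  obtain ⟨d, hd⟩ := exists_common_factor (M := {b}) (s := t) (s' := r) (N := N) (by simpa using hN)
  refine ⟨c * d * r, ?_⟩
  have e1 : M.map (((c * d * s * t : S) : A) * ·) = {((c * d * r : S) : A) * (t * a)} := by
    have := congrArg (Multiset.map (((d * t : S) : A) * ·)) hc
    rw [Multiset.map_map, Multiset.map_map, Multiset.map_singleton] at this
    refine Eq.trans ?_ (this.symm.trans ?_)
    · refine Multiset.map_congr rfl fun x _ => ?_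
      simp only [Function.comp_apply, Submonoid.coe_mul]; ac_rfl
    · congr 1
      simp only [Function.comp_apply, Submonoid.coe_mul]; ac_rfl
  have e2 : N.map (((c * d * s * t : S) : A) * ·) = {((c * d * r : S) : A) * (s * b)} := by
    have := congrArg (Multiset.map (((c * s : S) : A) * ·)) hd
    rw [Multiset.map_map, Multiset.map_map, Multiset.map_singleton] at this
    refine Eq.trans ?_ (this.symm.trans ?_)
    · refine Multiset.map_congr rfl fun x _ => ?_
      simp only [Function.comp_apply, Submonoid.coe_mul]; ac_rfl
    · congr 1
      simp only [Function.comp_apply, Submonoid.coe_mul]; ac_rfl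
  have := P.smul (((c * d * s * t : S) : A)) h
  rwa [e1, e2] at this

end Localization

/-- The localization `S⁻¹B` of an ordered blueprint. -/
def OrderedBlueprint.loc (B : OrderedBlueprint.{u}) (S : Submonoid B) : OrderedBlueprint.{u} :=
  (B.sub.localize S).toProper

/-- The fraction `a / s` in `S⁻¹B`. -/
def OrderedBlueprint.frac (B : OrderedBlueprint.{u}) {S : Submonoid B} (a : B) (s : S) : B.loc S :=
  (B.sub.localize S).quot (Localization.mk a s)

section Frac

variable {B : OrderedBlueprint.{u}} {S : Submonoid B}

theorem frac_surj (x : B.loc S) : ∃ (a : B) (s : S), B.frac a s = x := by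
  obtain ⟨y, rfl⟩ := (B.sub.localize S).quot_surjective x
  induction y using Localization.induction_on with
  | H y => exact ⟨y.1, y.2, rfl⟩

theorem frac_mul (a b : B) (s t : S) : B.frac a s * B.frac b t = B.frac (a * b) (s * t) := by
  unfold OrderedBlueprint.frac
  rw [← Localization.mk_mul]
  exact (map_mul _ _ _).symm

theorem frac_one : B.frac 1 (1 : S) = 1 := by
  unfold OrderedBlueprint.frac
  rw [Localization.mk_one]
  exact map_one _

theorem frac_zero (s : S) : B.frac 0 s = 0 := by
  unfold OrderedBlueprint.frac
  rw [Localization.mk_zero]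
  exact map_zero _

theorem frac_cancel (c s : S) (a : B) : B.frac ((c : B) * a) (c * s) = B.frac a s :=
  congrArg (B.sub.localize S).quot (mk_mul_cancel c s a)

theorem frac_self (s : S) : B.frac (s : B) s = 1 := by
  rw [← frac_one, ← frac_cancel s 1 1, mul_one, mul_one]

theorem frac_eq {a b : B} {s t : S} (h : B.frac a s = B.frac b t) :
    ∃ e e' : S, B.le {(e : B) * (t * a)} {(e : B) * (s * b)} ∧
      B.le {(e' : B) * (s * b)} {(e' : B) * (t * a)} := by
  have h' := (Con.eq (B.sub.localize S).con).1 h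
  obtain ⟨e, he⟩ := Subaddition.localize_single B.sub h'.1
  obtain ⟨e', he'⟩ := Subaddition.localize_single B.sub h'.2
  exact ⟨e, e', he, he'⟩

end Frac

/-- A morphism `f : B → C` with `f(S) ⊆ S'` induces `S⁻¹B → S'⁻¹C`, `a/s ↦ f(a)/f(s)`. -/
def locMap {B : OrderedBlueprint.{u}} {C : OrderedBlueprint.{v}} (f : BPHom B C)
    {S : Submonoid B} {S' : Submonoid C} (h : ∀ s ∈ S, f s ∈ S') : BPHom (B.loc S) (C.loc S') :=
  (B.sub.localize S).lift
    { toFun := fun x => Localization.liftOn x (fun a s => C.frac (f a) (⟨f s, h s s.2⟩ : S')) (by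
        intro a c b d hr
        rw [Localization.r_iff_exists] at hr
        obtain ⟨e, he⟩ := hr
        simp only at he
        refine congrArg (C.sub.localize S').quot ?_
        rw [Localization.mk_eq_mk_iff, Localization.r_iff_exists]
        refine ⟨⟨f e, h e e.2⟩, ?_⟩
        have := congrArg f.hom he
        simpa only [map_mul] using this)
      map_zero' := by
        rw [← Localization.mk_zero (1 : S), Localization.liftOn_mk, map_zero]
        exact frac_zero _
      map_one' := by
        rw [← Localization.mk_one, Localization.liftOn_mk, map_one]
        exact (congrArg (C.frac 1) (Subtype.ext (map_one f.hom) : _ = (1 : S'))).trans frac_one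
      map_mul' := by
        intro x y
        induction x, y using Localization.induction_on₂ with
        | H x y =>
          rw [Localization.mk_mul, Localization.liftOn_mk, Localization.liftOn_mk,
            Localization.liftOn_mk, frac_mul, map_mul]
          congr 1
          exact Subtype.ext (map_mul f.hom _ _) }
    (by
      rintro _ _ ⟨s, M, N, rfl, rfl, hMN⟩
      rw [Multiset.map_map, Multiset.map_map]
      refine ⟨(M.map f).map fun a => Localization.mk a (⟨f s, h s s.2⟩ : S'),
        (N.map f).map fun a => Localization.mk a (⟨f s, h s s.2⟩ : S'), ?_, ?_,
        ⟨⟨f s, h s s.2⟩, M.map f, N.map f, rfl, rfl, f.map_le hMN⟩⟩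
      · rw [Multiset.map_map, Multiset.map_map]; rfl
      · rw [Multiset.map_map, Multiset.map_map]; rfl)

theorem locMap_frac {B : OrderedBlueprint.{u}} {C : OrderedBlueprint.{v}} (f : BPHom B C)
    {S : Submonoid B} {S' : Submonoid C} (h : ∀ s ∈ S, f s ∈ S') (a : B) (s : S) :
    locMap f h (B.frac a s) = C.frac (f a) ⟨f s, h s s.2⟩ := rfl

/-! ### Ordered blueprinted spaces -/

/-- An ordered blueprinted space: a topological space with a sheaf in ordered blueprints. A limit of
ordered blueprints is formed on the underlying sets, with the relations that hold in all members of
the diagram; the sheaf axiom is written out accordingly. -/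
structure OBSpace where
  carrier : Type u
  [top : TopologicalSpace carrier]
  sec : Opens carrier → OrderedBlueprint.{u}
  res : ∀ {U V : Opens carrier}, U ≤ V → BPHom (sec V) (sec U)
  res_id : ∀ (U : Opens carrier) (s : sec U), res le_rfl s = s
  res_res : ∀ {U V W : Opens carrier} (h : U ≤ V) (h' : V ≤ W) (s : sec W),
    res h (res h' s) = res (h.trans h') s
  glue : ∀ {ι : Type u} (U : ι → Opens carrier) (s : ∀ i, sec (U i)),
    (∀ i j, res (inf_le_left : U i ⊓ U j ≤ U i) (s i) = res inf_le_right (s j)) →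
    ∃! t : sec (⨆ i, U i), ∀ i, res (le_iSup U i) t = s i
  le_of_local : ∀ {ι : Type u} (U : ι → Opens carrier) (s t : Multiset (sec (⨆ i, U i))),
    (∀ i, (sec (U i)).le (s.map (res (le_iSup U i))) (t.map (res (le_iSup U i)))) →
    (sec (⨆ i, U i)).le s t

instance (X : OBSpace.{u}) : TopologicalSpace X.carrier := X.top

/-- The preimage of an open set. -/
abbrev preim {X : Type u} {Y : Type v} [TopologicalSpace X] [TopologicalSpace Y] (f : C(X, Y))
    (V : Opens Y) : Opens X := ⟨f ⁻¹' V, V.isOpen.preimage f.continuous⟩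

/-- A morphism of ordered blueprinted spaces. Non-units in the stalk of the target are sent to
non-units; a germ is a unit if and only if it is represented by an invertible section on some
neighbourhood. -/
@[ext]
structure SpHom (X : OBSpace.{u}) (Y : OBSpace.{v}) where
  base : C(X.carrier, Y.carrier)
  app : ∀ V : Opens Y.carrier, BPHom (Y.sec V) (X.sec (preim base V))
  app_res : ∀ {U V : Opens Y.carrier} (h : U ≤ V) (s : Y.sec V),
    app U (Y.res h s) = X.res (U := preim base U) (V := preim base V) (fun _ hx => h hx) (app V s)
  isLocal : ∀ (V : Opens Y.carrier) (s : Y.sec V) (x : X.carrier), base x ∈ V →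
    (∃ (W : Opens X.carrier) (hW : W ≤ preim base V), x ∈ W ∧ IsUnit (X.res hW (app V s))) →
    ∃ (W : Opens Y.carrier) (hW : W ≤ V), base x ∈ W ∧ IsUnit (Y.res hW s)

/-- The identity morphism. -/
def SpHom.id (X : OBSpace.{u}) : SpHom X X where
  base := ContinuousMap.id _
  app _ := BPHom.id _
  app_res _ _ := rfl
  isLocal _ _ _ _ h := h

/-- The composition of morphisms of ordered blueprinted spaces. -/
def SpHom.comp {X : OBSpace.{u}} {Y : OBSpace.{v}} {Z : OBSpace.{w}} (g : SpHom Y Z)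
    (f : SpHom X Y) : SpHom X Z where
  base := g.base.comp f.base
  app V := (f.app (preim g.base V)).comp (g.app V)
  app_res {U V} h s := by
    change f.app (preim g.base U) (g.app U (Z.res h s)) = _
    rw [g.app_res h s]
    exact f.app_res (U := preim g.base U) (V := preim g.base V) (fun _ hx => h hx) (g.app V s)
  isLocal V s x hx h := by
    obtain ⟨W, hW, hxW, hu⟩ := f.isLocal (preim g.base V) (g.app V s) x hx h
    exact g.isLocal V s (f.base x) hx ⟨W, hW, hxW, hu⟩

/-- The morphism between the global sections. -/
def SpHom.global {X : OBSpace.{u}} {Y : OBSpace.{v}} (f : SpHom X Y) :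
    BPHom (Y.sec ⊤) (X.sec ⊤) := f.app ⊤

/-! ### The spectrum -/

/-- A prime `k`-ideal of an ordered blueprint. -/
@[ext]
structure PrimeKIdeal (B : OrderedBlueprint.{u}) where
  carrier : Set B
  zero_mem : (0 : B) ∈ carrier
  mul_mem : ∀ {a : B} (b : B), a ∈ carrier → a * b ∈ carrier
  sub_mem : ∀ {c : B} {s t : Multiset B}, (∀ a ∈ s, a ∈ carrier) → (∀ b ∈ t, b ∈ carrier) →
    B.le (c ::ₘ s) t → B.le t (c ::ₘ s) → c ∈ carrier
  one_notMem : (1 : B) ∉ carrier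
  mul_notMem : ∀ {a b : B}, a ∉ carrier → b ∉ carrier → a * b ∉ carrier

namespace PrimeKIdeal

variable {B : OrderedBlueprint.{u}}

/-- The complement of a prime `k`-ideal, a multiplicative subset. -/
def compl (p : PrimeKIdeal B) : Submonoid B where
  carrier := p.carrierᶜ
  one_mem' := p.one_notMem
  mul_mem' := p.mul_notMem

/-- The topology generated by the principal opens `{p | h ∉ p}`. -/
instance : TopologicalSpace (PrimeKIdeal B) :=
  generateFrom (Set.range fun h : B => {p : PrimeKIdeal B | h ∈ p.compl})

/-- The principal open `U_h`. -/
def principal (h : B) : Opens (PrimeKIdeal B) :=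
  ⟨{p | h ∈ p.compl}, isOpen_generateFrom_of_mem ⟨h, rfl⟩⟩

theorem left_of_mul {p : PrimeKIdeal B} {a b : B} (h : a * b ∈ p.compl) : a ∈ p.compl :=
  fun h' => h (p.mul_mem b h')

theorem right_of_mul {p : PrimeKIdeal B} {a b : B} (h : a * b ∈ p.compl) : b ∈ p.compl :=
  left_of_mul (mul_comm a b ▸ h)

/-- The local ordered blueprint `B_p`. -/
abbrev stalk (p : PrimeKIdeal B) : OrderedBlueprint.{u} := B.loc p.compl

theorem notMem_of_isUnit {p : PrimeKIdeal B} {a : B} {s : p.compl}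
    (h : IsUnit (B.frac a s : p.stalk)) : a ∈ p.compl := by
  obtain ⟨z, hz⟩ := h.exists_right_inv
  obtain ⟨b, t, rfl⟩ := frac_surj z
  rw [frac_mul, ← frac_one] at hz
  obtain ⟨e, e', h1, h2⟩ := frac_eq hz
  intro ha
  have h1' := B.sub.smul (e' : B) h1
  have h2' := B.sub.smul (e : B) h2
  simp only [Multiset.map_singleton] at h1' h2'
  rw [mul_left_comm (e : B) (e' : B)] at h2'
  have hu : (e' : B) * (e * (((s * t : p.compl) : B) * 1)) ∈ p.compl :=
    (e' * (e * ((s * t) * 1)) : p.compl).2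
  have hab : (e' : B) * (e * (((1 : p.compl) : B) * (a * b))) ∈ p.carrier := by
    rw [show (e' : B) * (e * (((1 : p.compl) : B) * (a * b)))
      = a * (e' * (e * (((1 : p.compl) : B) * b))) by ac_rfl]
    exact p.mul_mem _ ha
  rw [mul_left_comm (e : B) (e' : B)] at h2'
  exact hu (p.sub_mem (s := 0) (t := {(e' : B) * (e * (((1 : p.compl) : B) * (a * b)))})
    (by simp) (by simpa using hab) h2' h1')

/-- The preimage of a prime `k`-ideal under a morphism. -/
def comap {C : OrderedBlueprint.{v}} (f : BPHom B C) (q : PrimeKIdeal C) : PrimeKIdeal B where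
  carrier := f ⁻¹' q.carrier
  zero_mem := by
    change f.hom 0 ∈ q.carrier
    rw [map_zero]; exact q.zero_mem
  mul_mem {a} b ha := by
    change f.hom (a * b) ∈ q.carrier
    rw [map_mul]; exact q.mul_mem _ ha
  sub_mem {c s t} hs ht h h' := by
    have h1 := f.map_le h
    have h2 := f.map_le h'
    rw [Multiset.map_cons] at h1 h2
    refine q.sub_mem ?_ ?_ h1 h2
    · intro a ha
      obtain ⟨b, hb, rfl⟩ := Multiset.mem_map.1 ha
      exact hs b hb
    · intro a ha
      obtain ⟨b, hb, rfl⟩ := Multiset.mem_map.1 ha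
      exact ht b hb
  one_notMem := by
    change f.hom 1 ∉ q.carrier
    rw [map_one]; exact q.one_notMem
  mul_notMem {a b} ha hb := by
    change f.hom (a * b) ∉ q.carrier
    rw [map_mul]; exact q.mul_notMem ha hb

theorem continuous_comap {C : OrderedBlueprint.{v}} (f : BPHom B C) : Continuous (comap f) := by
  refine continuous_generateFrom_iff.2 ?_
  rintro _ ⟨h, rfl⟩
  exact (principal (f h)).isOpen

/-- A family of elements of the stalks `B_p`, `p ∈ U`, is a section if it is locally on principal
opens of the form `a / h`. -/
def IsSection (U : Opens (PrimeKIdeal B)) (s : ∀ p : U, (p.1 : PrimeKIdeal B).stalk) : Prop :=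
  ∀ p : U, ∃ a h : B, h ∈ p.1.compl ∧ ∀ (q : U) (hq : h ∈ q.1.compl), s q = B.frac a ⟨h, hq⟩

/-- The sections on `U`, with pointwise multiplication. -/
def sections (U : Opens (PrimeKIdeal B)) : Submonoid (∀ p : U, (p.1 : PrimeKIdeal B).stalk) where
  carrier := {s | IsSection U s}
  one_mem' p := ⟨1, 1, one_mem _, fun _ _ => frac_one.symm⟩
  mul_mem' := by
    intro s t hs ht p
    obtain ⟨a, h, hp, ha⟩ := hs p
    obtain ⟨b, g, gp, hb⟩ := ht p
    refine ⟨a * b, h * g, p.1.compl.mul_mem hp gp, fun q hq => ?_⟩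
    rw [Pi.mul_apply, ha q (left_of_mul hq), hb q (right_of_mul hq), frac_mul]
    rfl

instance (U : Opens (PrimeKIdeal B)) : CommMonoidWithZero (sections U) :=
  { (inferInstance : CommMonoid (sections U)) with
    zero := ⟨fun _ => 0, fun _ => ⟨0, 1, one_mem _, fun _ _ => (frac_zero _).symm⟩⟩
    zero_mul := fun _ => Subtype.ext (funext fun _ => zero_mul _)
    mul_zero := fun _ => Subtype.ext (funext fun _ => mul_zero _) }

/-- The value of a section at a point. -/
def evalAt {U : Opens (PrimeKIdeal B)} (p : U) : sections U →*₀ (p.1 : PrimeKIdeal B).stalk where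
  toFun s := s.1 p
  map_zero' := rfl
  map_one' := rfl
  map_mul' _ _ := rfl

/-- The ordered blueprint of sections on `U`: a relation holds if it holds in all stalks. -/
def sectionsBP (U : Opens (PrimeKIdeal B)) : OrderedBlueprint.{u} where
  carrier := sections U
  sub :=
    { le := fun s t => ∀ p : U, (p.1 : PrimeKIdeal B).stalk.le (s.map (evalAt p)) (t.map (evalAt p))
      refl := fun _ p => p.1.stalk.sub.refl_sum _
      trans := fun h h' p => p.1.stalk.sub.trans (h p) (h' p)
      add := fun h h' p => by
        rw [Multiset.map_add, Multiset.map_add]; exact p.1.stalk.sub.add (h p) (h' p)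
      mul := fun h h' p => by
        rw [map_sumMul _ (map_mul _), map_sumMul _ (map_mul _)]
        exact p.1.stalk.sub.mul (h p) (h' p)
      zero_le := fun p => p.1.stalk.sub.zero_le
      le_zero := fun p => p.1.stalk.sub.le_zero }
  proper _ _ h h' := Subtype.ext (funext fun p => p.1.stalk.proper _ _ (h p) (h' p))

/-- The restriction of sections. -/
def restrict {U V : Opens (PrimeKIdeal B)} (h : U ≤ V) :
    BPHom (sectionsBP V) (sectionsBP U) where
  hom :=
    { toFun := fun s => (⟨fun p => s.1 ⟨p.1, h p.2⟩, fun p => by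
        obtain ⟨a, g, hg, hs⟩ := s.2 ⟨p.1, h p.2⟩
        exact ⟨a, g, hg, fun q hq => hs ⟨q.1, h q.2⟩ hq⟩⟩ : sections U)
      map_zero' := rfl
      map_one' := rfl
      map_mul' := fun _ _ => rfl }
  map_le {s t} hst p := by
    exact (le_map_map p.1.stalk (fun _ => rfl)).2 (hst ⟨p.1, h p.2⟩)

end PrimeKIdeal

open PrimeKIdeal

/-- The spectrum of an ordered blueprint. -/
def Spec (B : OrderedBlueprint.{u}) : OBSpace.{u} where
  carrier := PrimeKIdeal B
  sec U := sectionsBP U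
  res h := restrict h
  res_id _ _ := rfl
  res_res _ _ _ := rfl
  glue := by
    intro ι U s hs
    have hs' : ∀ (i j : ι) (p : PrimeKIdeal B) (hi : p ∈ U i) (hj : p ∈ U j),
        (s i).1 ⟨p, hi⟩ = (s j).1 ⟨p, hj⟩ := fun i j p hi hj =>
      congrFun (congrArg Subtype.val (hs i j)) ⟨p, hi, hj⟩
    have hex : ∀ p : (⨆ i, U i : Opens (PrimeKIdeal B)), ∃ i, p.1 ∈ U i := fun p =>
      Opens.mem_iSup.1 p.2
    choose i hi using hex
    refine ⟨(⟨fun p => (s (i p)).1 ⟨p.1, hi p⟩, fun p => ?_⟩ : sections _), ?_, ?_⟩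
    · obtain ⟨a, h, hh, ha⟩ := (s (i p)).2 ⟨p.1, hi p⟩
      obtain ⟨W, ⟨g, rfl⟩, hpW, hWU⟩ : ∃ W ∈ Set.range (fun g : B =>
          {q : PrimeKIdeal B | g ∈ q.compl}), p.1 ∈ W ∧ W ⊆ (U (i p) : Set (PrimeKIdeal B)) := by
        refine (IsTopologicalBasis.mem_nhds_iff (s := (U (i p) : Set (PrimeKIdeal B)))
          (b := Set.range (fun g : B => {q : PrimeKIdeal B | g ∈ q.compl})) ?_).1
          ((U (i p)).isOpen.mem_nhds (hi p))
        refine ⟨?_, ?_, rfl⟩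
        · rintro _ ⟨g, rfl⟩ _ ⟨g', rfl⟩ q ⟨hq, hq'⟩
          exact ⟨_, ⟨g * g', rfl⟩, q.compl.mul_mem hq hq', fun r hr => ⟨left_of_mul hr, right_of_mul hr⟩⟩
        · exact Set.eq_univ_of_forall fun q => ⟨_, ⟨1, rfl⟩, one_mem q.compl⟩
      refine ⟨a * g, h * g, p.1.compl.mul_mem hh hpW, fun q hq => ?_⟩
      have hqU : q.1 ∈ U (i p) := hWU (right_of_mul hq)
      change (s (i q)).1 ⟨q.1, hi q⟩ = _
      rw [hs' (i q) (i p) q.1 (hi q) hqU, ha ⟨q.1, hqU⟩ (left_of_mul hq),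
        ← frac_cancel ⟨g, right_of_mul hq⟩ ⟨h, left_of_mul hq⟩ a, mul_comm g a]
      exact congrArg (B.frac (a * g)) (Subtype.ext (mul_comm g h))
    · intro j
      exact Subtype.ext (funext fun p => hs' _ _ _ _ _)
    · intro t ht
      refine Subtype.ext (funext fun p => ?_)
      exact congrFun (congrArg Subtype.val (ht (i p))) ⟨p.1, hi p⟩
  le_of_local := by
    intro ι U s t h p
    obtain ⟨i, hi⟩ := Opens.mem_iSup.1 p.2
    exact le_of_le_map_map p.1.stalk (h i ⟨p.1, hi⟩) (fun _ => rfl)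

/-- The global section of `Spec B` given by an element of `B`. -/
def toGlobal (B : OrderedBlueprint.{u}) (b : B) : (Spec B).sec ⊤ :=
  (⟨fun p => B.frac b (1 : p.1.compl), fun _ =>
    ⟨b, 1, one_mem _, fun _ _ => rfl⟩⟩ : sections (B := B) ⊤)

/-- The morphism of spectra induced by a morphism of ordered blueprints: inverse images of prime
`k`-ideals and pull back of sections. -/
def Spec.map {B : OrderedBlueprint.{u}} {C : OrderedBlueprint.{v}} (f : BPHom B C) :
    SpHom (Spec C) (Spec B) where
  base := ⟨comap f, continuous_comap f⟩
  app V :=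
    { hom :=
        { toFun := fun s => (⟨fun q => locMap f (S := (comap f q.1).compl) (S' := q.1.compl)
              (fun _ h => h) (s.1 ⟨comap f q.1, q.2⟩), fun q => by
            obtain ⟨a, h, hh, ha⟩ := s.2 ⟨comap f q.1, q.2⟩
            refine ⟨f a, f h, hh, fun r hr => ?_⟩
            exact congrArg (locMap f _) (ha ⟨comap f r.1, r.2⟩ hr)⟩ : sections _)
          map_zero' := Subtype.ext (funext fun _ => map_zero (locMap f _).hom)
          map_one' := Subtype.ext (funext fun _ => map_one (locMap f _).hom)
          map_mul' := fun _ _ => Subtype.ext (funext fun _ => map_mul (locMap f _).hom _ _) }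
      map_le := fun {s t} h q => by
        have := (locMap f (S := (comap f q.1).compl) (S' := q.1.compl)
          (fun _ h => h)).map_le (h ⟨comap f q.1, q.2⟩)
        refine (le_map_map q.1.stalk ?_).2 (le_of_le_map_map q.1.stalk this (fun _ => rfl))
        exact fun _ => rfl }
  app_res _ _ := rfl
  isLocal := by
    rintro V s x hx ⟨W, hW, hxW, hu⟩
    obtain ⟨a, h, hh, ha⟩ := s.2 ⟨comap f x, hx⟩
    have hu1 := hu.map (evalAt (B := C) (⟨x, hxW⟩ : W))
    have hu2 : IsUnit (C.frac (f a) (⟨f h, hh⟩ : x.compl) : x.stalk) := by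
      have e : locMap f (S := (comap f x).compl) (S' := x.compl) (fun _ h => h)
          (s.1 ⟨comap f x, hx⟩) = C.frac (f a) (⟨f h, hh⟩ : x.compl) := by
        rw [ha _ hh]; rfl
      rw [← e]
      exact hu1
    have hax' : f a ∈ PrimeKIdeal.compl (B := C) x := notMem_of_isUnit hu2
    have hax : a ∈ (comap f x).compl := hax'
    refine ⟨V ⊓ principal (h * a), inf_le_left,
      ⟨hx, Submonoid.mul_mem (PrimeKIdeal.compl (comap f x)) hh hax⟩, ?_⟩
    have hl : ∀ p : (V ⊓ principal (h * a) : Opens (PrimeKIdeal B)), h ∈ p.1.compl :=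
      fun p => left_of_mul p.2.2
    have hr : ∀ p : (V ⊓ principal (h * a) : Opens (PrimeKIdeal B)), a ∈ p.1.compl :=
      fun p => right_of_mul p.2.2
    refine IsUnit.of_mul_eq_one (⟨fun p => B.frac h ⟨a, hr p⟩, fun p =>
      ⟨h, a, hr p, fun _ _ => rfl⟩⟩ : sections (V ⊓ principal (h * a))) ?_
    refine Subtype.ext (funext fun p => ?_)
    change s.1 ⟨p.1, p.2.1⟩ * B.frac h ⟨a, hr p⟩ = 1
    rw [ha ⟨p.1, p.2.1⟩ (hl p), frac_mul]
    refine Eq.trans ?_ (frac_self (⟨h * a, p.2.2⟩ : p.1.compl))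
    rw [mul_comm a h]
    rfl

theorem Spec.map_comp {B : OrderedBlueprint.{u}} {C : OrderedBlueprint.{v}}
    {D : OrderedBlueprint.{w}} (g : BPHom C D) (f : BPHom B C) :
    (Spec.map f).comp (Spec.map g) = Spec.map (g.comp f) := by
  have h : ∀ V, ((Spec.map f).comp (Spec.map g)).app V = (Spec.map (g.comp f)).app V := by
    intro V
    refine BPHom.ext (MonoidWithZeroHom.ext fun s => Subtype.ext (funext fun q => ?_))
    change locMap g (S := (comap g q.1).compl) (S' := q.1.compl) (fun _ h => h)
      (locMap f (S := (comap f (comap g q.1)).compl) (S' := (comap g q.1).compl) (fun _ h => h)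
        (s.1 ⟨comap f (comap g q.1), q.2⟩)) =
      locMap (g.comp f) (S := (comap f (comap g q.1)).compl) (S' := q.1.compl) (fun _ h => h)
        (s.1 ⟨comap f (comap g q.1), q.2⟩)
    obtain ⟨a, t, ht⟩ := frac_surj (s.1 ⟨comap f (comap g q.1), q.2⟩)
    rw [← ht]
    rfl
  exact SpHom.ext rfl (heq_of_eq (funext h))

/-! ### Rational points and the fine topology -/

section RationalPoints

variable {T : OrderedBlueprint.{w}}

/-- The set `X(T)` of `T`-rational points of an ordered blue `T`-scheme `X → Spec T`. -/
def RatPt (X : OBSpace.{u}) (str : SpHom X (Spec T)) : Type (max u w) :=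
  {φ : SpHom (Spec T) X // str.comp φ = SpHom.id (Spec T)}

/-- A morphism `g : X → Y` over `Spec T` induces a map `X(T) → Y(T)`. -/
def RatPt.map {X : OBSpace.{u}} {Y : OBSpace.{v}} {strX : SpHom X (Spec T)}
    {strY : SpHom Y (Spec T)} (g : SpHom X Y) (hg : strY.comp g = strX) (φ : RatPt X strX) :
    RatPt Y strY :=
  ⟨g.comp φ.1, by
    have h : (strY.comp g).comp φ.1 = SpHom.id (Spec T) := by rw [hg]; exact φ.2
    exact h⟩

/-- The affine topology on `U(T)` for an affine `U`: the coarsest topology for which the evaluation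
maps `φ ↦ φ^#(a)` at the global sections `a` of `U` are continuous. Here `φ^#(a)` is a global section
of `Spec T`; for a global ordered blueprint `T` the map `T → Γ(Spec T)` is a bijection, along which
the topology of `T` is transported. -/
@[reducible] def affineTopology [TopologicalSpace T] (U : OBSpace.{u}) (str : SpHom U (Spec T)) :
    TopologicalSpace (RatPt U str) :=
  ⨅ a : U.sec ⊤, TopologicalSpace.induced (fun φ : RatPt U str => φ.1.global a)
    (TopologicalSpace.coinduced (toGlobal T) inferInstance)

/-- The fine topology on `X(T)`: the finest topology such that for every morphism `α : U → X` from an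
affine ordered blue `T`-scheme `U = Spec D`, the map `U(T) → X(T)` is continuous for the affine
topology on `U(T)`. (The structure morphism of `U` is necessarily the composite with `α`.) -/
instance fineTopology [TopologicalSpace T] (X : OBSpace.{u}) (str : SpHom X (Spec T)) :
    TopologicalSpace (RatPt X str) :=
  ⨆ (D : OrderedBlueprint.{u}) (α : SpHom (Spec D) X),
    TopologicalSpace.coinduced (RatPt.map (strX := str.comp α) α rfl)
      (affineTopology (Spec D) (str.comp α))

end RationalPoints

/-! ### The bend -/

section Bend

variable {K : OrderedBlueprint.{w}} {T : OrderedBlueprint.{v}} {B : OrderedBlueprint.{u}}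

/-- The tensor product `B• ⊗_{K•} T•` of monoids with zero along `i : K• → B•` and
`v : K• → T•`: the quotient of `B × T` by the relations `(i(d) b, t) = (b, v(d) t)`. -/
def tensorCon (v : K →*₀ T) (i : BPHom K B) : Con (B × T) :=
  conGen fun x y => ∃ (d : K) (b : B) (t : T), x = (i d * b, t) ∧ y = (b, v d * t)

/-- The underlying set of `B• ⊗_{K•} T•`. -/
abbrev BendMonoid (v : K →*₀ T) (i : BPHom K B) : Type (max u v) := (tensorCon v i).Quotient

/-- The element `b ⊗ t`. -/
def tens (v : K →*₀ T) (i : BPHom K B) (b : B) (t : T) : BendMonoid v i :=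
  conMk (tensorCon v i) (b, t)

theorem tens_mul (v : K →*₀ T) (i : BPHom K B) (b b' : B) (t t' : T) :
    tens v i b t * tens v i b' t' = tens v i (b * b') (t * t') := rfl

theorem tens_balanced (v : K →*₀ T) (i : BPHom K B) (d : K) (b : B) (t : T) :
    tens v i (i d * b) t = tens v i b (v d * t) :=
  (Con.eq _).2 (ConGen.Rel.of _ _ ⟨d, b, t, rfl, rfl⟩)

theorem tens_zero_left (v : K →*₀ T) (i : BPHom K B) (t : T) : tens v i 0 t = 0 := by
  have h := tens_balanced v i 0 0 t
  rw [mul_zero, map_zero v, zero_mul] at h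
  exact h

theorem tens_zero_right (v : K →*₀ T) (i : BPHom K B) (b : B) : tens v i b 0 = 0 := by
  have h := tens_balanced v i 0 b 0
  rw [show i 0 = 0 from map_zero i.hom, zero_mul, mul_zero] at h
  exact h.symm

/-- The generating relations of the bend: the relations of `T`, and
`a ⊗ 1 + ∑ bⱼ ⊗ 1 ≡ ∑ bⱼ ⊗ 1` for every relation `a ≤ ∑ bⱼ` of `B`. -/
inductive BendRel (v : K →*₀ T) (i : BPHom K B) :
    Multiset (BendMonoid v i) → Multiset (BendMonoid v i) → Prop
  | base {M N : Multiset T} : T.le M N →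
      BendRel v i (M.map fun t => tens v i 1 t) (N.map fun t => tens v i 1 t)
  | bend {a : B} {N : Multiset B} : B.le {a} N →
      BendRel v i ((a ::ₘ N).map fun b => tens v i b 1) (N.map fun b => tens v i b 1)
  | bend_symm {a : B} {N : Multiset B} : B.le {a} N →
      BendRel v i (N.map fun b => tens v i b 1) ((a ::ₘ N).map fun b => tens v i b 1)

/-- The bend `Bend_v(B)` of the ordered blue `K`-algebra `i : K → B` along `v : K → T`. -/
def bend (v : K →*₀ T) (i : BPHom K B) : OrderedBlueprint.{max u v} :=
  (gen (BendRel v i)).toProper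

/-- The class of `b ⊗ t` in the bend. -/
def bendMk (v : K →*₀ T) (i : BPHom K B) (b : B) (t : T) : bend v i :=
  (gen (BendRel v i)).quot (tens v i b t)

/-- The structure morphism `T → Bend_v(B)`, `t ↦ 1 ⊗ t`. -/
def bendStr (v : K →*₀ T) (i : BPHom K B) : BPHom T (bend v i) where
  hom :=
    { toFun := fun t => bendMk v i 1 t
      map_zero' := by
        unfold bendMk
        rw [tens_zero_right]
        exact map_zero _
      map_one' := rfl
      map_mul' := fun t t' => by
        unfold bendMk
        rw [← one_mul (1 : B), ← tens_mul, one_mul]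
        exact map_mul _ _ _ }
  map_le h := by
    have := (gen (BendRel v i)).quot_le (GenLe.of (BendRel.base (v := v) (i := i) h))
    rw [Multiset.map_map, Multiset.map_map] at this
    exact this

/-- The morphism `Bend_v(f) : Bend_v(B) → Bend_v(C)`, `b ⊗ t ↦ f(b) ⊗ t`, induced by a morphism
`f : B → C` of ordered blue `K`-algebras. -/
def bendMap (v : K →*₀ T) {C : OrderedBlueprint.{x}} {i : BPHom K B} {j : BPHom K C} (f : BPHom B C)
    (hf : f.comp i = j) : BPHom (bend v i) (bend v j) :=
  (gen (BendRel v i)).lift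
    { toFun := fun x => Con.lift (tensorCon v i)
        { toFun := fun p : B × T => bendMk v j (f p.1) p.2
          map_one' := congrArg (bendMk v j · 1) (map_one f.hom)
          map_mul' := fun p q => by
            refine Eq.trans (congrArg (bendMk v j · (p.2 * q.2)) (map_mul f.hom p.1 q.1)) ?_
            exact map_mul (gen (BendRel v j)).quot (tens v j (f p.1) p.2) (tens v j (f q.1) q.2) }
        (by
          refine Con.conGen_le.2 ?_
          rintro _ _ ⟨d, b, t, rfl, rfl⟩
          subst hf
          refine Eq.trans (congrArg (bendMk v _ · t) (map_mul f.hom (i d) b)) ?_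
          exact congrArg (gen (BendRel v (f.comp i))).quot (tens_balanced v (f.comp i) d (f b) t)) x
      map_zero' := by
        refine Eq.trans (congrArg (bendMk v j · 0) (map_zero f.hom)) ?_
        exact (congrArg (gen (BendRel v j)).quot (tens_zero_left v j 0)).trans (map_zero _)
      map_one' := map_one _
      map_mul' := map_mul _ }
    (fun {s t} h => by
      refine gen_map_le _ ?_ h
      have key : ∀ N : Multiset B, ((N.map f).map fun b => tens v j b 1).map (gen (BendRel v j)).quot
          = N.map fun b => bendMk v j (f b) 1 := by
        intro N
        rw [Multiset.map_map, Multiset.map_map]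
        rfl
      rintro _ _ (⟨h⟩ | ⟨h⟩ | ⟨h⟩)
      · have := (bendStr v j).map_le h
        refine (le_map_map _ ?_).2 this
        exact fun t => congrArg (bendMk v j · t) (map_one f.hom)
      · have := (gen (BendRel v j)).quot_le
          (GenLe.of (BendRel.bend (v := v) (i := j) (by simpa using f.map_le h)))
        rw [← Multiset.map_cons, key, key] at this
        rw [Multiset.map_map, Multiset.map_map]
        exact this
      · have := (gen (BendRel v j)).quot_le
          (GenLe.of (BendRel.bend_symm (v := v) (i := j) (by simpa using f.map_le h)))
        rw [← Multiset.map_cons, key, key] at this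
        rw [Multiset.map_map, Multiset.map_map]
        exact this)

theorem bendMap_comp_bendStr (v : K →*₀ T) {C : OrderedBlueprint.{x}} {i : BPHom K B}
    {j : BPHom K C} (f : BPHom B C) (hf : f.comp i = j) :
    (bendMap v f hf).comp (bendStr v i) = bendStr v j :=
  BPHom.ext (MonoidWithZeroHom.ext fun t => congrArg (bendMk v j · t) (map_one f.hom))

/-- The set `Bend_v(X)(T)` for `X = Spec B`, where `Bend_v(X) = Spec (Bend_v(B))`; it carries the
fine topology. -/
abbrev BendPt (v : K →*₀ T) (i : BPHom K B) : Type (max u v) :=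
  RatPt (Spec (bend v i)) (Spec.map (bendStr v i))

/-- The map `Bend_v(β)(T) : Bend_v(Y)(T) → Bend_v(Z)(T)` for the morphism `β : Y → Z` of affine
ordered blue `K`-schemes given by `f`. -/
def bendPtMap (v : K →*₀ T) {C : OrderedBlueprint.{x}} {i : BPHom K B} {j : BPHom K C}
    (f : BPHom B C) (hf : f.comp i = j) : BendPt v j → BendPt v i :=
  RatPt.map (Spec.map (bendMap v f hf)) (by rw [Spec.map_comp, bendMap_comp_bendStr])

end Bend

/-! ### The setting: higher rank valuations, analytification and tropicalization -/

/-- The set `𝕋^(n) = ℝ_{>0}^n ∪ {0}`, with componentwise multiplication and the lexicographical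
order, where `0` is the smallest element. -/
def TropN (n : ℕ) : Type := WithZero (Lex (Fin n → {x : ℝ // 0 < x}))

noncomputable section

instance (n : ℕ) : LinearOrderedCommGroupWithZero (TropN n) :=
  inferInstanceAs (LinearOrderedCommGroupWithZero (WithZero (Lex (Fin n → {x : ℝ // 0 < x}))))

/-- `𝕋^(n)` carries the order topology. -/
instance (n : ℕ) : TopologicalSpace (TropN n) := Preorder.topology (TropN n)

/-- The addition of `𝕋^(n)` is the maximum. -/
instance (n : ℕ) : Add (TropN n) := ⟨max⟩

/-- `𝕋^(n)` is a semiring. -/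
instance (n : ℕ) : CommSemiring (TropN n) :=
  { (inferInstance : CommMonoidWithZero (TropN n)) with
    add_assoc := max_assoc
    add_comm := max_comm
    zero_add := fun a => max_eq_right (zero_le (a := a))
    add_zero := fun a => max_eq_left (zero_le (a := a))
    nsmul := @nsmulRec _ ⟨0⟩ ⟨max⟩
    left_distrib := fun a b c => Monotone.map_max (f := fun x => a * x) fun _ _ h => mul_le_mul_right h a
    right_distrib := fun a b c => Monotone.map_max (f := fun x => x * c) fun _ _ h => mul_le_mul_left h c }

/-- The idempotent semiring `𝕋^(n)` as an (algebraic) blueprint. -/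
abbrev tropBP (n : ℕ) : OrderedBlueprint.{0} := ofSemiring (TropN n)

instance (n : ℕ) : TopologicalSpace (tropBP n) := inferInstanceAs (TopologicalSpace (TropN n))

section Setting

variable {k : Type w} [Field k] {n : ℕ}

/-- A valuation `v : k → 𝕋^(n)`, as a morphism of underlying monoids with zero. -/
def valHom (v : Valuation k (TropN n)) : ofSemiring k →*₀ tropBP n where
  toFun := v
  map_zero' := map_zero v
  map_one' := map_one v
  map_mul' := map_mul v

/-- A `k`-algebra `R`, as a morphism `k → R` of blueprints. -/
def algStr (k : Type w) [Field k] (R : Type u) [CommRing R] [Algebra k R] :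
    BPHom (ofSemiring k) (ofSemiring R) := ofRingHom (algebraMap k R)

/-- The Foster-Ranganathan analytification of `Spec R` along `v`: all valuations
`R → 𝕋^(n)` that extend `v`. -/
def FRAn (v : Valuation k (TropN n)) (R : Type u) [CommRing R] [Algebra k R] : Type u :=
  {w : Valuation R (TropN n) // ∀ c : k, w (algebraMap k R c) = v c}

/-- The compact-open topology for the discrete topology on `R`, i.e. the coarsest topology for which
all evaluation maps are continuous. -/
instance (v : Valuation k (TropN n)) (R : Type u) [CommRing R] [Algebra k R] :
    TopologicalSpace (FRAn v R) :=
  ⨅ a : R, TopologicalSpace.induced (fun x : FRAn v R => x.1 a) inferInstance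

/-- The compact-open topology on `Hom(A, 𝕋^(n))` for the discrete topology on `A`, i.e. the
coarsest topology for which all evaluation maps are continuous. -/
instance (A : Type v) [CommMonoidWithZero A] : TopologicalSpace (A →*₀ TropN n) :=
  ⨅ a : A, TopologicalSpace.induced (fun x : A →*₀ TropN n => x a) inferInstance

/-- The `k`-algebra `k[A]⁺`: the monoid algebra of `A` in which the zero of `A` is identified with
the zero of the algebra. -/
abbrev MonAlg (k : Type w) [Field k] (A : Type v) [CommMonoidWithZero A] : Type (max w v) :=
  MonoidAlgebra k A ⧸ Ideal.span {MonoidAlgebra.of k A 0}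

/-- The canonical map `A → k[A]⁺`. -/
def monAlgOf (k : Type w) [Field k] (A : Type v) [CommMonoidWithZero A] : A →*₀ MonAlg k A where
  toFun a := Ideal.Quotient.mk _ (MonoidAlgebra.of k A a)
  map_zero' := Ideal.Quotient.eq_zero_iff_mem.2 (Ideal.subset_span rfl)
  map_one' := by rw [map_one, map_one]
  map_mul' a b := by rw [map_mul, map_mul]

variable {R : Type u} [CommRing R] [Algebra k R] {A : Type v} [CommMonoidWithZero A]

/-- The composition `A → k[A]⁺ → R`. -/
def coord (π : MonAlg k A →ₐ[k] R) : A →*₀ R :=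
  (π : MonAlg k A →+* R).toMonoidWithZeroHom.comp (monAlgOf k A)

/-- The map `An_v(Spec R) → Hom(A, 𝕋^(n))` that sends `w : R → 𝕋^(n)` to the composition
`A → k[A]⁺ → R → 𝕋^(n)`. -/
def tropMap (v : Valuation k (TropN n)) (π : MonAlg k A →ₐ[k] R) (x : FRAn v R) : A →*₀ TropN n :=
  x.1.toMonoidWithZeroHom.comp (coord π)

/-- The Foster-Ranganathan tropicalization, with the subspace topology. -/
abbrev FRTrop (v : Valuation k (TropN n)) (π : MonAlg k A →ₐ[k] R) : Type v :=
  Set.range (tropMap v π)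

/-- The map onto the tropicalization. -/
def toFRTrop (v : Valuation k (TropN n)) (π : MonAlg k A →ₐ[k] R) (x : FRAn v R) : FRTrop v π :=
  ⟨tropMap v π x, x, rfl⟩

/-- The congruence on `k × A` that identifies all pairs `(c, 0)` and `(0, a)`. -/
def smashCon (k : Type w) [Field k] (A : Type v) [CommMonoidWithZero A] : Con (k × A) :=
  conGen fun x y => (x.1 = 0 ∨ x.2 = 0) ∧ (y.1 = 0 ∨ y.2 = 0)

/-- The underlying monoid `{0} ∪ {c · a | c ∈ k, a ∈ A}` of the free blueprint `k[A]`. -/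
abbrev FreeMon (k : Type w) [Field k] (A : Type v) [CommMonoidWithZero A] : Type (max w v) :=
  (smashCon k A).Quotient

/-- The element `c · a` of `k[A]`. -/
def freeMk (k : Type w) [Field k] {A : Type v} [CommMonoidWithZero A] (c : k) (a : A) :
    FreeMon k A := conMk (smashCon k A) (c, a)

/-- The restriction of `π` to the monomials, `c · a ↦ π(c · a)`. -/
def freeEval (π : MonAlg k A →ₐ[k] R) : FreeMon k A →*₀ R where
  toFun := (smashCon k A).lift
    { toFun := fun p => π (p.1 • monAlgOf k A p.2)
      map_one' := by simp
      map_mul' := fun p q => by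
        rw [← map_mul, Prod.fst_mul, Prod.snd_mul, map_mul, smul_mul_smul_comm] }
    (by
      have h : ∀ p : k × A, (p.1 = 0 ∨ p.2 = 0) → π (p.1 • monAlgOf k A p.2) = 0 := by
        rintro ⟨c, a⟩ (h | h) <;> simp only at h <;> simp [h]
      exact Con.conGen_le.2 fun p q hpq => (h p hpq.1).trans (h q hpq.2).symm)
  map_zero' := by
    change π ((0 : k) • monAlgOf k A 0) = 0
    rw [zero_smul, map_zero]
  map_one' := map_one _
  map_mul' := map_mul _

/-- The blueprint `k[A] ⫽ 𝓡` with `𝓡 = {∑ aᵢ ≡ ∑ bⱼ | ∑ π(aᵢ) = ∑ π(bⱼ)}`; its spectrum is the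
blue scheme `Z` associated with the closed immersion `Spec R → Spec k[A]⁺`. -/
def modelBP (π : MonAlg k A →ₐ[k] R) : OrderedBlueprint.{max w v} :=
  (Subaddition.ofHom (freeEval π)).toProper

/-- The class of `c · a`. -/
def modelMk (π : MonAlg k A →ₐ[k] R) (c : k) (a : A) : modelBP π :=
  (Subaddition.ofHom (freeEval π)).quot (freeMk k c a)

/-- The structure morphism `k → k[A] ⫽ 𝓡`, `c ↦ c · 1`. -/
def modelStr (π : MonAlg k A →ₐ[k] R) : BPHom (ofSemiring k) (modelBP π) where
  hom :=
    { toFun := fun c => modelMk π c 1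
      map_zero' := by
        refine (congrArg (Subaddition.ofHom (freeEval π)).quot ?_).trans (map_zero _)
        exact (Con.eq _).2 (ConGen.Rel.of _ _ ⟨Or.inl rfl, Or.inl rfl⟩)
      map_one' := rfl
      map_mul' := fun c d => by
        refine Eq.trans ?_ (map_mul (Subaddition.ofHom (freeEval π)).quot (freeMk k c 1)
          (freeMk k d 1))
        refine congrArg (Subaddition.ofHom (freeEval π)).quot ?_
        exact congrArg (conMk (smashCon k A)) (Prod.ext rfl (one_mul (1 : A)).symm) }
  map_le {s t} h := by
    have key : ∀ M : Multiset k, ((M.map fun c => freeMk k c (1 : A)).map (freeEval π)).sum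
        = algebraMap k R ((M.map fun c : k => c).sum) := by
      intro M
      rw [Multiset.map_id', map_multiset_sum, Multiset.map_map]
      refine congrArg Multiset.sum (Multiset.map_congr rfl fun c _ => ?_)
      change π (c • monAlgOf k A 1) = _
      rw [map_one, map_smul, map_one, Algebra.algebraMap_eq_smul_one]
    have h' : (Subaddition.ofHom (freeEval π)).le (s.map fun c => freeMk k c (1 : A))
        (t.map fun c => freeMk k c (1 : A)) :=
      (key s).trans ((congrArg (algebraMap k R) h).trans (key t).symm)
    exact le_of_le_map_map _ ((Subaddition.ofHom (freeEval π)).quot_le h') fun _ => rfl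

/-- The inclusion `k[A] ⫽ 𝓡 → R`, `c · a ↦ π(c · a)`; it induces `β : Spec R → Z`. -/
def modelIncl (π : MonAlg k A →ₐ[k] R) : BPHom (modelBP π) (ofSemiring R) :=
  (Subaddition.ofHom (freeEval π)).lift (C := ofSemiring R)
    (freeEval π : FreeMon k A →*₀ R) fun {s t} h => by
    change ((s.map (freeEval π)).map fun x : R => x).sum
      = ((t.map (freeEval π)).map fun x : R => x).sum
    rw [Multiset.map_id', Multiset.map_id']
    exact h

theorem modelIncl_comp_modelStr (π : MonAlg k A →ₐ[k] R) :
    (modelIncl π).comp (modelStr π) = algStr k R := by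
  refine BPHom.ext (MonoidWithZeroHom.ext fun c : k => ?_)
  change π (c • monAlgOf k A 1) = algebraMap k R c
  rw [map_one, map_smul, map_one, Algebra.algebraMap_eq_smul_one]

/-- `Bend_v(Y)(𝕋^(n))` for `Y = Spec R`. -/
abbrev BendY (v : Valuation k (TropN n)) (R : Type u) [CommRing R] [Algebra k R] : Type u :=
  BendPt (valHom v) (algStr k R)

/-- `Bend_v(Z)(𝕋^(n))` for the blue scheme `Z` associated with `π`. -/
abbrev BendZ (v : Valuation k (TropN n)) (π : MonAlg k A →ₐ[k] R) : Type (max w v) :=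
  BendPt (valHom v) (modelStr π)

/-- `Bend_v(β)(𝕋^(n)) : Bend_v(Y)(𝕋^(n)) → Bend_v(Z)(𝕋^(n))`. -/
def bendBeta (v : Valuation k (TropN n)) (π : MonAlg k A →ₐ[k] R) : BendY v R → BendZ v π :=
  bendPtMap (valHom v) (modelIncl π) (modelIncl_comp_modelStr π)

end Setting

end

end BlueScheme

/-!
Both homeomorphisms are obtained by embedding the two spaces into the same space of `𝕋^(n)`-valued
functions with the topology of pointwise convergence, and comparing images
(`exists_homeomorph_of_range_eq`).

**Points of the bend.** The spectrum of `𝕋^(n)` has a single point, with stalk `𝕋^(n)`. Therefore a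
morphism `Spec 𝕋^(n) → Spec D` is the same as a morphism `D → 𝕋^(n)` of ordered blueprints
(`SpHom.map_toHom`, `toHom_map`). On an affine scheme the fine topology is the affine topology
(`fineTopology_eq_affineTopology`), and since global sections are locally fractions, this is the
topology of pointwise convergence on `D` (`affineTopology_eq_induced_toHom`). For `D = Bend_v(B)` a
point is determined by its values on the elements `b ⊗ 1`, which gives the embedding
`isEmbedding_bendEval`. Its image consists of the multiplicative functions `g` on `B` that extend `v`
and satisfy `g a ≤ max g bⱼ` for all relations `a ≤ ∑ bⱼ` of `B`. For `B = R` these are exactly the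
valuations extending `v` (`range_frAn_eq`).

**Tropicalization.** For the blueprint of `Z`, such a `g` amounts to a function `y` on `A` that
satisfies the bend relations of all linear relations between the images of the monomials in `R`. It
has to be shown that `y` is the restriction of a valuation of `R`, without new values; this is the
fundamental theorem `exists_valuation_of_bend`, for a value group that is divisible but of arbitrary
rank, and for an arbitrary field `k`.

* Dividing out the monomials at which `y` vanishes, one may assume that `y` takes values in the units
  `Γˣ`. After a base change to `K = Frac k[Γˣ]` with the Gauss valuation, which is surjective onto `Γ`,
  the monomials can be twisted such that the required values become `1`.
* Let `O` be the valuation ring of `K` and `S` the `O`-algebra generated by the twisted monomials. The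
  bend relations say that no twisted monomial lies in `𝔪S` (`twist_ne_sum`). So the special fibre of `S`
  has an irreducible component, given by a minimal prime `q` over `𝔪S`, that meets the torus.
* Take a prime of `R ⊗ K` that meets `S` inside `q`, and a valuation of its residue field that dominates
  the localization at `q`. It is `1` on the twisted monomials. If `t` are lifts of a transcendence
  basis of the component, the valuation is the Gauss valuation on `O[t]`. By Zariski's main theorem
  `S` is algebraic over `O[t]` (`exists_isAlgebraic_of_mem_minimalPrimes`). As the value group is
  divisible, no new values occur (`exists_valuation_of_mem_minimalPrimes`), so that the valuation can be
  normalized to take values in `Γ`.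
-/

/-! ### Transcendence bases of components of the special fibre -/

/-- A prime `q` that is minimal in its fibre and has algebraic residue field extension is also maximal
in its fibre, hence an isolated point of it. -/
theorem quasiFiniteAt_of_isMin_of_algebraic {P S : Type*} [CommRing P] [CommRing S] [Algebra P S]
    [Algebra.FiniteType P S] (q : Ideal S) [q.IsPrime]
    (hmin : ∀ q' : Ideal S, q'.IsPrime → q' ≤ q → q'.under P = q.under P → q' = q)
    (halg : ∀ s : S, ∃ p : Polynomial P, p.map (Ideal.Quotient.mk (q.under P)) ≠ 0 ∧
      p.eval₂ (algebraMap P S) s ∈ q) :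
    Algebra.QuasiFiniteAt P q := by
  let e := PrimeSpectrum.primesOverOrderIsoFiber P S (q.under P)
  let x : (q.under P).primesOver S := ⟨q, ‹_›, ⟨rfl⟩⟩
  have : IsNoetherianRing ((q.under P).Fiber S) :=
    Algebra.FiniteType.isNoetherianRing (q.under P).ResidueField _
  have : IsJacobsonRing ((q.under P).Fiber S) :=
    isJacobsonRing_of_finiteType (A := (q.under P).ResidueField)
  have hx : IsMax x := by
    rintro ⟨q', hq', hov⟩ (hle : q ≤ q')
    change q' ≤ q
    by_contra hlt
    -- An element of `q' \ q` algebraic modulo `q` would give a nonzero element of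
    -- `(q' ∩ P) / (q ∩ P)`, but `q'` and `q` lie over the same prime.
    obtain ⟨s, hs, hsq⟩ := SetLike.not_le_iff_exists.1 hlt
    obtain ⟨p, hp0, hp⟩ := halg s
    have := Ideal.comap_lt_comap_of_root_mem_sdiff (I := q) hle ⟨hs, hsq⟩ hp0 hp
    exact this.ne hov.over
  have hx' : IsMin x := by
    rintro ⟨q', hq', hov⟩ (hle : q' ≤ q)
    exact (hmin q' hq' hle hov.over.symm).ge
  have hopen : IsOpen {e x} := by
    refine ((PrimeSpectrum.isOpen_singleton_tfae_of_isNoetherian_of_isJacobsonRing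
      (e x)).out 0 2).mpr ?_
    rw [PrimeSpectrum.isClosed_singleton_iff_isMaximal, ← PrimeSpectrum.isMax_iff,
      PrimeSpectrum.stableUnderGeneralization_singleton, ← PrimeSpectrum.isMin_iff]
    exact ⟨(e.isMax_apply).2 hx, (e.isMin_apply).2 hx'⟩
  have : Algebra.QuasiFiniteAt (q.under P).ResidueField (e x).asIdeal := .of_isOpen_singleton _ hopen
  exact Algebra.QuasiFiniteAt.of_quasiFiniteAt_residueField (q.under P) q (e x).asIdeal
    congr(($(e.symm_apply_apply x)).1)

/-- Let `q` lie over the maximal ideal of `O`, and let `κ` be the residue field of `O`. The `t` are lifts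
to `S` of a transcendence basis of `S ⧸ q` over `κ`: polynomials in `t` that land in `q` have all their
coefficients in the maximal ideal, and every element of `S` is algebraic over `O[t]` modulo `q`. -/
theorem exists_lift_transcendenceBasis {O : Type u} {S : Type v} [CommRing O] [IsLocalRing O]
    [CommRing S] [Algebra O S] (q : Ideal S) [q.IsPrime] (hq : q.under O = IsLocalRing.maximalIdeal O) :
    ∃ (ι : Type v) (t : ι → S),
      (∀ f : MvPolynomial ι O, MvPolynomial.aeval t f ∈ q →
        ∀ m, f.coeff m ∈ IsLocalRing.maximalIdeal O) ∧
      ∀ s : S, ∃ p : Polynomial (MvPolynomial ι O),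
        (∃ i m, (p.coeff i).coeff m ∉ IsLocalRing.maximalIdeal O) ∧
        p.eval₂ (MvPolynomial.aeval t).toRingHom s ∈ q := by
  have hlies : q.LiesOver (IsLocalRing.maximalIdeal O) := ⟨hq.symm⟩
  let κ := O ⧸ IsLocalRing.maximalIdeal O
  let : Field κ := Ideal.Quotient.field _
  let : Algebra κ (S ⧸ q) := Ideal.Quotient.algebraOfLiesOver q (IsLocalRing.maximalIdeal O)
  obtain ⟨B, hB⟩ := exists_isTranscendenceBasis κ (S ⧸ q)
  choose t ht using fun b : B => Ideal.Quotient.mk_surjective b.1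
  have key : ∀ f : MvPolynomial B O, Ideal.Quotient.mk q (MvPolynomial.aeval t f) =
      MvPolynomial.aeval (fun b : B => (b : S ⧸ q)) (f.map (algebraMap O κ)) := by
    intro f
    induction f using MvPolynomial.induction_on with
    | C a => simp; rfl
    | add f g hf hg => simp [hf, hg]
    | mul_X f i hf => simp [hf, ht]
  refine ⟨B, t, fun f hf m => ?_, fun s => ?_⟩
  · rw [← Ideal.Quotient.eq_zero_iff_mem, key] at hf
    have h0 := hB.1
    rw [AlgebraicIndependent, injective_iff_map_eq_zero] at h0
    have := congrArg (MvPolynomial.coeff m) (h0 _ hf)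
    rw [MvPolynomial.coeff_map] at this
    exact Ideal.Quotient.eq_zero_iff_mem.1 this
  · have halg := hB.isAlgebraic
    obtain ⟨p, hp0, hp⟩ := halg.isAlgebraic (Ideal.Quotient.mk q s)
    let ψ : MvPolynomial B O →+* Algebra.adjoin κ (Set.range ((↑) : B → S ⧸ q)) :=
      (((MvPolynomial.aeval (R := κ) (fun b : B => (b : S ⧸ q))).toRingHom.comp
        (MvPolynomial.map (algebraMap O κ))).codRestrict _ (fun f => by
          rw [Algebra.adjoin_range_eq_range_aeval]
          exact ⟨_, rfl⟩))
    have hψ : Function.Surjective ψ := by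
      rintro ⟨y, hy⟩
      rw [Algebra.adjoin_range_eq_range_aeval] at hy
      obtain ⟨g, rfl⟩ := hy
      obtain ⟨f, rfl⟩ := MvPolynomial.map_surjective (algebraMap O κ)
        Ideal.Quotient.mk_surjective g
      exact ⟨f, rfl⟩
    obtain ⟨P, rfl⟩ := Polynomial.map_surjective ψ hψ p
    refine ⟨P, ?_, ?_⟩
    · by_contra! hP
      refine hp0 (Polynomial.ext fun i => ?_)
      rw [Polynomial.coeff_map, Polynomial.coeff_zero]
      refine Subtype.ext ?_
      change MvPolynomial.aeval _ (MvPolynomial.map _ (P.coeff i)) = 0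
      have : MvPolynomial.map (algebraMap O κ) (P.coeff i) = 0 := by
        ext m
        rw [MvPolynomial.coeff_map]
        exact Ideal.Quotient.eq_zero_iff_mem.2 (hP i m)
      rw [this, map_zero]
    · rw [← Ideal.Quotient.eq_zero_iff_mem, Polynomial.hom_eval₂]
      rw [Polynomial.aeval_def, Polynomial.eval₂_map] at hp
      have e : (Ideal.Quotient.mk q).comp (MvPolynomial.aeval t).toRingHom =
          (algebraMap (Algebra.adjoin κ (Set.range ((↑) : B → S ⧸ q))) (S ⧸ q)).comp ψ :=
        RingHom.ext key
      rw [e]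
      exact hp

/-- If `q` is a minimal prime over the extension of the maximal ideal of `O`, then the lifts `t` of a
transcendence basis of `S ⧸ q` already make `S` algebraic over `O[t]`: by minimality `S` is
quasi-finite over `O[t]` at `q`, so that Zariski's main theorem applies. This takes the place of a
dimension count, which is not available because `O` need not be noetherian. -/
theorem exists_isAlgebraic_of_mem_minimalPrimes {O : Type u} {S : Type v} [CommRing O]
    [IsDomain O] [IsLocalRing O] [CommRing S] [IsDomain S] [Algebra O S] [Algebra.FiniteType O S]
    (q : Ideal S)
    (hq : q ∈ ((IsLocalRing.maximalIdeal O).map (algebraMap O S)).minimalPrimes) :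
    ∃ (ι : Type v) (t : ι → S),
      (∀ f : MvPolynomial ι O, MvPolynomial.aeval t f ∈ q →
        ∀ m, f.coeff m ∈ IsLocalRing.maximalIdeal O) ∧
      ∀ s : S, ∃ p : Polynomial (MvPolynomial ι O), p ≠ 0 ∧
        p.eval₂ (MvPolynomial.aeval t).toRingHom s = 0 := by
  have hqp : q.IsPrime := hq.1.1
  have hmq : (IsLocalRing.maximalIdeal O).map (algebraMap O S) ≤ q := hq.1.2
  have hunder : q.under O = IsLocalRing.maximalIdeal O :=
    ((IsLocalRing.maximalIdeal.isMaximal O).eq_of_le (hqp.under O).ne_top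
      (Ideal.map_le_iff_le_comap.1 hmq)).symm
  obtain ⟨ι, t, hind, halg⟩ := exists_lift_transcendenceBasis q hunder
  refine ⟨ι, t, hind, ?_⟩
  let : Algebra (MvPolynomial ι O) S := (MvPolynomial.aeval t).toRingHom.toAlgebra
  have htower : IsScalarTower O (MvPolynomial ι O) S := IsScalarTower.of_algebraMap_eq fun c => by
    exact (MvPolynomial.algHom_C (MvPolynomial.aeval t) c).symm
  have hft : Algebra.FiniteType (MvPolynomial ι O) S :=
    Algebra.FiniteType.of_restrictScalars_finiteType O _ _
  have hqf : Algebra.QuasiFiniteAt (MvPolynomial ι O) q := by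
    refine quasiFiniteAt_of_isMin_of_algebraic q (fun q' hq' hle he => ?_) fun s => ?_
    · refine le_antisymm hle (hq.2 ⟨hq', ?_⟩ hle)
      refine Ideal.map_le_iff_le_comap.2 fun c hc => ?_
      have h1 : MvPolynomial.C c ∈ q.under (MvPolynomial ι O) := by
        change MvPolynomial.aeval t (MvPolynomial.C c) ∈ q
        rw [MvPolynomial.algHom_C]
        exact hmq (Ideal.mem_map_of_mem _ hc)
      rw [← he] at h1
      change MvPolynomial.aeval t (MvPolynomial.C c) ∈ q' at h1
      rwa [MvPolynomial.algHom_C] at h1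
    · obtain ⟨p, ⟨i, m, hc⟩, hp⟩ := halg s
      refine ⟨p, fun h0 => hc ?_, hp⟩
      have := congrArg (Polynomial.coeff · i) h0
      simp only [Polynomial.coeff_map, Polynomial.coeff_zero] at this
      have h2 : p.coeff i ∈ q.under (MvPolynomial ι O) := Ideal.Quotient.eq_zero_iff_mem.1 this
      exact hind _ h2 m
  -- For some `r ∉ q` integral over `O[t]`, every `s` has a multiple `r ^ m * s` that is integral
  -- over `O[t]`; as `S` is a domain, `s` is algebraic.
  obtain ⟨r, hrq, hr, H⟩ := Algebra.zariskisMainProperty_iff.1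
    (Algebra.ZariskisMainProperty.of_finiteType (R := MvPolynomial ι O) q)
  have hr0 : r ≠ 0 := fun h => hrq (h ▸ q.zero_mem)
  intro s
  obtain ⟨m, hm⟩ := H s
  have := IsAlgebraic.of_mul (mem_nonZeroDivisors_of_ne_zero (pow_ne_zero m hr0))
    (hr.pow m).isAlgebraic hm.isAlgebraic
  exact this

/-! ### Values of algebraic elements -/

/-- A root of a polynomial forces the maximum of the values of its terms to be attained twice. -/
theorem exists_valuation_tie {F Γ : Type*} [Field F] [LinearOrderedCommGroupWithZero Γ]
    (w : Valuation F Γ) {p : Polynomial F} (hp : p ≠ 0) {x : F} (hx : x ≠ 0)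
    (hroot : p.eval x = 0) :
    ∃ i j, i < j ∧ p.coeff i ≠ 0 ∧ p.coeff j ≠ 0 ∧
      w (p.coeff i) * w x ^ i = w (p.coeff j) * w x ^ j := by
  classical
  -- If the maximum were attained only once, the terms could not sum to `0`.
  obtain ⟨i, hi, hmax⟩ := p.support.exists_max_image (fun i => w (p.coeff i) * w x ^ i)
    (Polynomial.support_nonempty.2 hp)
  have hi0 : p.coeff i ≠ 0 := Polynomial.mem_support_iff.1 hi
  have hex : ∃ j ∈ p.support, j ≠ i ∧ w (p.coeff j) * w x ^ j = w (p.coeff i) * w x ^ i := by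
    by_contra! hne
    rw [Polynomial.eval_eq_sum, Polynomial.sum, ← Finset.add_sum_erase _ _ hi] at hroot
    have hpos : w (p.coeff i * x ^ i) ≠ 0 := by
      rw [Valuation.ne_zero_iff]
      exact mul_ne_zero hi0 (pow_ne_zero _ hx)
    have hlt : w (∑ j ∈ p.support.erase i, p.coeff j * x ^ j) < w (p.coeff i * x ^ i) := by
      refine w.map_sum_lt hpos fun j hj => ?_
      obtain ⟨hji, hj⟩ := Finset.mem_erase.1 hj
      rw [map_mul, map_pow, map_mul, map_pow]
      exact lt_of_le_of_ne (hmax j hj) (hne j hj hji)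
    have := w.map_add_eq_of_lt_left hlt
    rw [hroot, map_zero] at this
    exact hpos this.symm
  obtain ⟨j, hj, hji, h⟩ := hex
  have hj0 : p.coeff j ≠ 0 := Polynomial.mem_support_iff.1 hj
  rcases lt_or_gt_of_ne hji with hlt | hlt
  · exact ⟨j, i, hlt, hj0, hi0, h⟩
  · exact ⟨i, j, hlt, hi0, hj0, h.symm⟩

/-- If the values of the coefficients of a polynomial come from `K`, so do the values of its roots,
provided that the value group of `K` is divisible. -/
theorem exists_valuation_eq_of_tie {K F Γ Γ' : Type*} [Field K] [Field F] [Algebra K F]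
    [LinearOrderedCommGroupWithZero Γ] [LinearOrderedCommGroupWithZero Γ']
    (v : Valuation K Γ) (w : Valuation F Γ') (hw : (w.comap (algebraMap K F)).IsEquiv v)
    (hv : Function.Surjective v) (hroot : ∀ (γ : Γ) (N : ℕ), N ≠ 0 → ∃ δ, δ ^ N = γ)
    {p : Polynomial F} (hp : p ≠ 0) (hcoeff : ∀ i, ∃ c : K, w (p.coeff i) = w (algebraMap K F c))
    {x : F} (hx : p.eval x = 0) : ∃ d : K, w x = w (algebraMap K F d) := by
  rcases eq_or_ne x 0 with rfl | hx0
  · exact ⟨0, by simp⟩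
  obtain ⟨i, j, hij, hi, hj, h⟩ := exists_valuation_tie w hp hx0 hx
  obtain ⟨a, ha⟩ := hcoeff i
  obtain ⟨b, hb⟩ := hcoeff j
  -- The tie gives `w x ^ (j - i) = w (a / b)`; the root `δ` is the value of an element of `K`.
  obtain ⟨δ, hδ⟩ := hroot (v (a / b)) (j - i) (Nat.sub_ne_zero_of_lt hij)
  obtain ⟨d, rfl⟩ := hv δ
  refine ⟨d, ?_⟩
  have h1 : w (algebraMap K F d) ^ (j - i) = w (algebraMap K F (a / b)) := by
    rw [← map_pow, ← map_pow]
    rw [← map_pow] at hδ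
    exact hw.eq_iff.2 hδ
  have h2 : w x ^ (j - i) = w (algebraMap K F (a / b)) := by
    have hwx : w x ^ i ≠ 0 := pow_ne_zero _ ((w.ne_zero_iff).2 hx0)
    rw [map_div₀, map_div₀, ← ha, ← hb, eq_div_iff ((w.ne_zero_iff).2 hj)]
    refine mul_right_cancel₀ hwx ?_
    rw [h, mul_assoc, mul_left_comm, ← pow_add, Nat.sub_add_cancel hij.le]
  exact (pow_left_inj₀ zero_le zero_le (Nat.sub_ne_zero_of_lt hij)).1 (h2.trans h1.symm)

/-- A valuation on `F` without new values compared to `K` can be normalized to extend `v` itself,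
rather than a valuation equivalent to `v`. -/
theorem exists_valuation_of_value_eq {K F Γ Γ' : Type*} [Field K] [Field F] [Algebra K F]
    [LinearOrderedCommGroupWithZero Γ] [LinearOrderedCommGroupWithZero Γ']
    (v : Valuation K Γ) (w : Valuation F Γ') (hw : (w.comap (algebraMap K F)).IsEquiv v)
    (hval : ∀ x : F, ∃ d : K, w x = w (algebraMap K F d)) :
    ∃ w' : Valuation F Γ, (∀ c, w' (algebraMap K F c) = v c) ∧ w'.IsEquiv w := by
  choose d hd using hval
  have key : ∀ x c, w x = w (algebraMap K F c) → v (d x) = v c := fun x c h =>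
    hw.eq_iff.1 ((hd x).symm.trans h)
  have mono : ∀ x y, v (d x) ≤ v (d y) ↔ w x ≤ w y := fun x y => by
    rw [hd x, hd y]
    exact (hw _ _).symm
  let w' : Valuation F Γ :=
    { toFun := fun x => v (d x)
      map_zero' := by rw [key 0 0 (by simp), map_zero]
      map_one' := by rw [key 1 1 (by simp), map_one]
      map_mul' := fun x y => by
        rw [← map_mul]
        refine key _ _ ?_
        rw [map_mul, map_mul, map_mul, ← hd, ← hd]
      map_add_le_max' := fun x y => by
        rcases le_total (w x) (w y) with h | h
        · refine le_max_of_le_right ((mono _ _).2 ((w.map_add x y).trans (max_le h le_rfl)))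
        · refine le_max_of_le_left ((mono _ _).2 ((w.map_add x y).trans (max_le le_rfl h))) }
  exact ⟨w', fun c => key _ _ rfl, fun x y => mono x y⟩

/-! ### Valuations dominating a component of the special fibre -/

/-- A valuation ring of `F` that dominates the localization of `S` at `q`. -/
theorem exists_valuationSubring_dominating {F : Type*} [Field F] {S : Type*} [CommRing S]
    (f : S →+* F) (hf : Function.Injective f) (q : Ideal S) [q.IsPrime] :
    ∃ V : ValuationSubring F, (∀ s, V.valuation (f s) ≤ 1) ∧
      ∀ s, s ∈ q ↔ V.valuation (f s) < 1 := by
  have : IsDomain S := hf.isDomain f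
  have hu : ∀ y : q.primeCompl, IsUnit (f y) := fun y =>
    isUnit_iff_ne_zero.2 fun h => y.2 (by rw [(map_eq_zero_iff f hf).1 h]; exact q.zero_mem)
  obtain ⟨V, hV, hloc⟩ := IsLocalRing.exists_factor_valuationRing
    (IsLocalization.lift (S := Localization.AtPrime q) hu)
  have hmem : ∀ s, f s ∈ V := fun s => by
    have := hV (algebraMap _ _ s)
    rwa [IsLocalization.lift_eq] at this
  refine ⟨V, fun s => (V.valuation_le_one_iff _).2 (hmem s), fun s => ?_⟩
  have h1 : V.valuation (f s) < 1 ↔ ¬ IsUnit (⟨f s, hmem s⟩ : V) :=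
    (V.valuation_lt_one_iff ⟨f s, hmem s⟩).symm.trans (IsLocalRing.mem_maximalIdeal _)
  have h2 := IsLocalization.AtPrime.isUnit_to_map_iff (Localization.AtPrime q) q s
  rw [h1, ← not_iff_not, not_not, ← Ideal.mem_primeCompl_iff, ← h2]
  have e : (⟨f s, hmem s⟩ : V) = (IsLocalization.lift (S := Localization.AtPrime q) hu).codRestrict
      V.toSubring hV (algebraMap _ _ s) := Subtype.ext (IsLocalization.lift_eq hu s).symm
  rw [e]
  exact (isUnit_map_iff _ _).symm

/-- Over a valuation ring, a coefficient of maximal value can be factored out of a polynomial. -/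
theorem MvPolynomial.exists_eq_C_mul_of_valuationRing {O ι : Type*} [CommRing O] [IsDomain O]
    [ValuationRing O] {f : MvPolynomial ι O} (hf : f ≠ 0) :
    ∃ (c : O) (g : MvPolynomial ι O) (m : ι →₀ ℕ), c ≠ 0 ∧ f = MvPolynomial.C c * g ∧
      g.coeff m = 1 := by
  classical
  have key : ∀ s : Finset (ι →₀ ℕ), s.Nonempty → ∃ m ∈ s, ∀ m' ∈ s, f.coeff m ∣ f.coeff m' := by
    intro s hs
    induction hs using Finset.Nonempty.cons_induction with
    | singleton a => exact ⟨a, by simp, by simp⟩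
    | cons a s ha hs ih =>
      obtain ⟨m, hm, h⟩ := ih
      rcases ValuationRing.dvd_total (f.coeff m) (f.coeff a) with h' | h'
      · exact ⟨m, by simp [hm], by simpa using ⟨h', h⟩⟩
      · exact ⟨a, by simp, by simpa using fun m' hm' => h'.trans (h m' hm')⟩
  obtain ⟨m, hm, h⟩ := key f.support (MvPolynomial.support_nonempty.2 hf)
  have hm0 : f.coeff m ≠ 0 := MvPolynomial.mem_support_iff.1 hm
  have hdvd : MvPolynomial.C (f.coeff m) ∣ f := by
    rw [MvPolynomial.C_dvd_iff_dvd_coeff]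
    intro m'
    by_cases hm' : m' ∈ f.support
    · exact h m' hm'
    · rw [MvPolynomial.notMem_support_iff.1 hm']
      exact dvd_zero _
  obtain ⟨g, hg⟩ := hdvd
  refine ⟨f.coeff m, g, m, hm0, hg, ?_⟩
  have := congrArg (MvPolynomial.coeff m) hg
  rw [MvPolynomial.coeff_C_mul] at this
  exact mul_left_cancel₀ hm0 (this.symm.trans (mul_one _).symm)

/-- A valuation of `F = Frac S` dominating a minimal prime `q` of the special fibre of `S` takes its
values in the value group of `K`: on `O[t]` it is the Gauss valuation, because the `t` are
independent modulo `q`, and `S` is algebraic over `O[t]`. -/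
theorem exists_valuation_of_mem_minimalPrimes {K F : Type*} {Γ : Type*} [Field K] [Field F]
    [Algebra K F] [LinearOrderedCommGroupWithZero Γ] (v : Valuation K Γ)
    (hv : Function.Surjective v) (hroot : ∀ (γ : Γ) (N : ℕ), N ≠ 0 → ∃ δ, δ ^ N = γ)
    (S : Subalgebra v.valuationSubring F) [Algebra.FiniteType v.valuationSubring S]
    (hfrac : ∀ x : F, ∃ a b : S, (b : F) ≠ 0 ∧ x * b = a) (q : Ideal S)
    (hq : q ∈ ((IsLocalRing.maximalIdeal v.valuationSubring).map
      (algebraMap v.valuationSubring S)).minimalPrimes) :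
    ∃ w : Valuation F Γ, (∀ c, w (algebraMap K F c) = v c) ∧ (∀ s : S, w s ≤ 1) ∧
      ∀ s : S, s ∉ q → w s = 1 := by
  let O : ValuationSubring K := v.valuationSubring
  have hqp : q.IsPrime := hq.1.1
  have hmq : (IsLocalRing.maximalIdeal O).map (algebraMap O S) ≤ q := hq.1.2
  obtain ⟨ι, t, hind, halg⟩ := exists_isAlgebraic_of_mem_minimalPrimes q hq
  obtain ⟨V, hV1, hVq⟩ := exists_valuationSubring_dominating S.val.toRingHom
    Subtype.val_injective q
  have hO1 : ∀ c : O, V.valuation (algebraMap K F c) ≤ 1 := fun c => hV1 (algebraMap O S c)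
  have hO2 : ∀ c ∈ IsLocalRing.maximalIdeal O, V.valuation (algebraMap K F c) < 1 := fun c hc =>
    (hVq (algebraMap O S c)).1 (hmq (Ideal.mem_map_of_mem _ hc))
  have hequiv : (V.valuation.comap (algebraMap K F)).IsEquiv v := by
    refine Valuation.isEquiv_iff_val_le_one.2 fun {c} => ⟨fun h => ?_, fun h => hO1 ⟨c, h⟩⟩
    by_contra! hc
    have hc0 : c ≠ 0 := by rintro rfl; simp at hc
    have hlt : v c⁻¹ < 1 := by
      rw [map_inv₀]
      exact inv_lt_one_of_one_lt₀ hc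
    have := hO2 ⟨c⁻¹, hlt.le⟩ ?_
    · rw [map_inv₀, map_inv₀] at this
      rw [Valuation.comap_apply] at h
      have hne : V.valuation (algebraMap K F c) ≠ 0 := by simpa using hc0
      exact absurd this (not_lt.2 ((one_le_inv₀ (zero_lt_iff.2 hne)).2 h))
    · exact (Valuation.mem_maximalIdeal_iff _ _).2 hlt
  -- The valuation is the Gauss valuation on `O[t]`: a polynomial with a coefficient `1` does not
  -- land in `q`, so that it has value `1`.
  have hgauss : ∀ f : MvPolynomial ι O, f ≠ 0 → ∃ c : O, c ≠ 0 ∧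
      V.valuation (MvPolynomial.aeval t f : S) = V.valuation (algebraMap K F c) := by
    intro f hf
    obtain ⟨c, g, m, hc, rfl, hg⟩ := MvPolynomial.exists_eq_C_mul_of_valuationRing hf
    refine ⟨c, hc, ?_⟩
    have hgq : MvPolynomial.aeval t g ∉ q := fun h => by
      have := hind g h m
      rw [hg] at this
      exact (IsLocalRing.mem_maximalIdeal _).1 this isUnit_one
    have h1 : V.valuation (MvPolynomial.aeval t g : S) = 1 :=
      le_antisymm (hV1 _) (not_lt.1 fun h => hgq ((hVq _).2 h))
    rw [map_mul, MvPolynomial.algHom_C, Subalgebra.coe_mul, map_mul, h1, mul_one]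
    rfl
  let ψ : MvPolynomial ι O →+* F := S.val.toRingHom.comp (MvPolynomial.aeval t).toRingHom
  have hψ : Function.Injective ψ := by
    refine (injective_iff_map_eq_zero ψ).2 fun f hf => ?_
    by_contra hf0
    obtain ⟨c, hc, h⟩ := hgauss f hf0
    have : V.valuation (ψ f) = V.valuation (algebraMap K F c) := h
    rw [hf, map_zero] at this
    have h2 : algebraMap K F c = 0 := (Valuation.zero_iff _).1 this.symm
    exact hc (Subtype.ext ((map_eq_zero _).1 h2))
  have hvalS : ∀ s : S, ∃ d : K, V.valuation (s : F) = V.valuation (algebraMap K F d) := by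
    intro s
    obtain ⟨p, hp0, hp⟩ := halg s
    refine exists_valuation_eq_of_tie v V.valuation hequiv hv hroot (p := p.map ψ)
      ((Polynomial.map_ne_zero_iff hψ).2 hp0) (fun i => ?_) ?_
    · rw [Polynomial.coeff_map]
      rcases eq_or_ne (p.coeff i) 0 with h0 | h0
      · exact ⟨0, by simp [h0]⟩
      · obtain ⟨c, -, hc⟩ := hgauss _ h0
        exact ⟨c, hc⟩
    · rw [Polynomial.eval_map]
      have := congrArg S.val.toRingHom hp
      rwa [Polynomial.hom_eval₂, map_zero] at this
  have hval : ∀ x : F, ∃ d : K, V.valuation x = V.valuation (algebraMap K F d) := by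
    intro x
    obtain ⟨a, b, hb, h⟩ := hfrac x
    obtain ⟨d, hd⟩ := hvalS a
    obtain ⟨e, he⟩ := hvalS b
    refine ⟨d / e, ?_⟩
    rw [map_div₀, map_div₀, ← hd, ← he, ← h, map_mul,
      mul_div_cancel_right₀ _ ((Valuation.ne_zero_iff _).2 hb)]
  obtain ⟨w, hw, hwV⟩ := exists_valuation_of_value_eq v V.valuation hequiv hval
  refine ⟨w, hw, fun s => hwV.le_one_iff_le_one.2 (hV1 s), fun s hs => ?_⟩
  refine hwV.eq_one_iff_eq_one.2 (le_antisymm (hV1 s) (not_lt.1 fun h => hs ((hVq s).2 h)))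

/-- Denominators of elements of `K[X]` can be cleared to land in `O[X]`. -/
theorem exists_smul_mem_adjoin {K Γ R : Type*} [Field K] [LinearOrderedCommGroupWithZero Γ]
    (v : Valuation K Γ) [CommRing R] [Algebra K R] (X : Set R) {r : R}
    (hr : r ∈ Algebra.adjoin K X) :
    ∃ c : v.valuationSubring, c ≠ 0 ∧ c • r ∈ Algebra.adjoin v.valuationSubring X := by
  induction hr using Algebra.adjoin_induction with
  | mem x hx => exact ⟨1, one_ne_zero, by simpa using Algebra.subset_adjoin hx⟩
  | algebraMap k =>
    rcases v.valuationSubring.mem_or_inv_mem k with hk | hk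
    · refine ⟨1, one_ne_zero, ?_⟩
      rw [one_smul]
      exact Subalgebra.algebraMap_mem _ (⟨k, hk⟩ : v.valuationSubring)
    · rcases eq_or_ne k 0 with rfl | hk0
      · exact ⟨1, one_ne_zero, by simp⟩
      · refine ⟨⟨k⁻¹, hk⟩, fun h => inv_ne_zero hk0 (congrArg Subtype.val h), ?_⟩
        have : (⟨k⁻¹, hk⟩ : v.valuationSubring) • algebraMap K R k = 1 := by
          change k⁻¹ • algebraMap K R k = 1
          rw [Algebra.smul_def, ← map_mul, inv_mul_cancel₀ hk0, map_one]
        rw [this]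
        exact one_mem _
  | add x y _ _ hx hy =>
    obtain ⟨c, hc, hx⟩ := hx
    obtain ⟨d, hd, hy⟩ := hy
    refine ⟨c * d, mul_ne_zero hc hd, ?_⟩
    rw [smul_add, mul_comm c d, mul_smul, mul_comm d c, mul_smul]
    exact add_mem (Subalgebra.smul_mem _ hx d) (Subalgebra.smul_mem _ hy c)
  | mul x y _ _ hx hy =>
    obtain ⟨c, hc, hx⟩ := hx
    obtain ⟨d, hd, hy⟩ := hy
    refine ⟨c * d, mul_ne_zero hc hd, ?_⟩
    rw [← smul_mul_smul_comm]
    exact mul_mem hx hy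

/-- The variant of `exists_valuation_of_mem_minimalPrimes` for `S = O[X] ⊆ R` and a point
`φ : R → F` whose kernel meets `S` inside `q`. -/
theorem exists_valuation_of_algHom {K Γ R F : Type*} [Field K] [LinearOrderedCommGroupWithZero Γ]
    (v : Valuation K Γ) (hv : Function.Surjective v)
    (hroot : ∀ (γ : Γ) (N : ℕ), N ≠ 0 → ∃ δ, δ ^ N = γ) [CommRing R] [Algebra K R] [Field F]
    [Algebra K F] (φ : R →ₐ[K] F) (hφ : ∀ x : F, ∃ r r', φ r' ≠ 0 ∧ x * φ r' = φ r)
    (X : Finset R) (hX : Algebra.adjoin K (X : Set R) = ⊤)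
    (q : Ideal (Algebra.adjoin v.valuationSubring (X : Set R)))
    (hq : q ∈ ((IsLocalRing.maximalIdeal v.valuationSubring).map (algebraMap v.valuationSubring
        (Algebra.adjoin v.valuationSubring (X : Set R)))).minimalPrimes)
    (hker : ∀ s : Algebra.adjoin v.valuationSubring (X : Set R), φ s = 0 → s ∈ q) :
    ∃ w : Valuation F Γ, (∀ c, w (algebraMap K F c) = v c) ∧
      (∀ s : Algebra.adjoin v.valuationSubring (X : Set R), w (φ s) ≤ 1) ∧
      ∀ s : Algebra.adjoin v.valuationSubring (X : Set R), s ∉ q → w (φ s) = 1 := by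
  let O : ValuationSubring K := v.valuationSubring
  let S : Subalgebra O R := Algebra.adjoin O (X : Set R)
  let I : Ideal S := (IsLocalRing.maximalIdeal O).map (algebraMap O S)
  have hqp : q.IsPrime := hq.1.1
  let S' : Subalgebra O F := S.map (φ.restrictScalars O)
  have hft : Algebra.FiniteType O S' :=
    S'.fg_iff_finiteType.1 (((Subalgebra.fg_adjoin_finset X)).map _)
  let θ' : S →ₐ[O] S' := ((φ.restrictScalars O).comp S.val).codRestrict S' fun s => ⟨s, s.2, rfl⟩
  let θ : S →+* S' := θ'.toRingHom
  have hθ : Function.Surjective θ := by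
    rintro ⟨_, s, hs, rfl⟩
    exact ⟨⟨s, hs⟩, rfl⟩
  have hker' : RingHom.ker θ ≤ q := fun s hs => hker s (congrArg Subtype.val hs)
  have hcomap : (q.map θ).comap θ = q := by
    rw [Ideal.comap_map_of_surjective' _ hθ]
    exact sup_eq_left.2 hker'
  have hq'p : (q.map θ).IsPrime := Ideal.map_isPrime_of_surjective hθ hker'
  have hmap : (IsLocalRing.maximalIdeal O).map (algebraMap O S') = I.map θ := by
    have : algebraMap O S' = θ.comp (algebraMap O S) := θ'.comp_algebraMap.symm
    rw [this]
    exact (Ideal.map_map _ _).symm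
  have hq' : q.map θ ∈ ((IsLocalRing.maximalIdeal O).map (algebraMap O S')).minimalPrimes := by
    rw [hmap]
    refine ⟨⟨hq'p, Ideal.map_mono hq.1.2⟩, fun q₁ ⟨hq₁, h1⟩ h2 => ?_⟩
    rw [Ideal.map_le_iff_le_comap] at h1 ⊢
    exact hq.2 ⟨hq₁.comap θ, h1⟩ ((Ideal.comap_mono h2).trans hcomap.le)
  have hsmul : ∀ (c : O) (r : R), φ (c • r) = algebraMap K F c * φ r := fun c r => by
    rw [← Algebra.smul_def]
    exact map_smul φ (c : K) r
  have hfrac : ∀ x : F, ∃ a b : S', (b : F) ≠ 0 ∧ x * b = a := by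
    intro x
    obtain ⟨r, r', hb0, hx⟩ := hφ x
    obtain ⟨c, hc, hcr⟩ := exists_smul_mem_adjoin v (X : Set R) (r := r) (hX ▸ trivial)
    obtain ⟨d, hd, hdr⟩ := exists_smul_mem_adjoin v (X : Set R) (r := r') (hX ▸ trivial)
    have hne : ∀ e : O, e ≠ 0 → algebraMap K F e ≠ 0 := fun e he =>
      (map_ne_zero _).2 fun h => he (Subtype.ext h)
    refine ⟨⟨_, d • c • r, S.smul_mem hcr d, rfl⟩, ⟨_, c • d • r', S.smul_mem hdr c, rfl⟩, ?_, ?_⟩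
    · change φ (c • d • r') ≠ 0
      rw [hsmul, hsmul]
      exact mul_ne_zero (hne c hc) (mul_ne_zero (hne d hd) hb0)
    · change x * φ (c • d • r') = φ (d • c • r)
      rw [hsmul, hsmul, hsmul, hsmul, ← hx]
      ring
  obtain ⟨w, hw, hw1, hwq⟩ := exists_valuation_of_mem_minimalPrimes v hv hroot S' hfrac _ hq'
  exact ⟨w, hw, fun s => hw1 (θ s), fun s hs => hwq (θ s) fun h => hs (hcomap.le h)⟩

/-- Let `S = O[X]`. If no power of the product of the generators `X` lies in `𝔪S`, i.e. if the special
fibre of `S` has a point in the torus, then some valuation of `R` extending `v` takes the value `1`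
on all of `X`. -/
theorem exists_valuation_eq_one_of_pow_notMem {K Γ R : Type*} [Field K]
    [LinearOrderedCommGroupWithZero Γ] (v : Valuation K Γ) (hv : Function.Surjective v)
    (hroot : ∀ (γ : Γ) (N : ℕ), N ≠ 0 → ∃ δ, δ ^ N = γ) [CommRing R] [Algebra K R]
    (X : Finset R) (hX : Algebra.adjoin K (X : Set R) = ⊤)
    (hpow : ∀ (N : ℕ) (s : Algebra.adjoin v.valuationSubring (X : Set R)),
      (s : R) = (∏ x ∈ X, x) ^ N →
      s ∉ (IsLocalRing.maximalIdeal v.valuationSubring).map (algebraMap v.valuationSubring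
        (Algebra.adjoin v.valuationSubring (X : Set R)))) :
    ∃ w : Valuation R Γ, (∀ c, w (algebraMap K R c) = v c) ∧ ∀ x ∈ X, w x = 1 := by
  classical
  let O : ValuationSubring K := v.valuationSubring
  let S : Subalgebra O R := Algebra.adjoin O (X : Set R)
  have hXS : ∀ x ∈ X, x ∈ S := fun x hx => Algebra.subset_adjoin hx
  let g : S := ⟨∏ x ∈ X, x, prod_mem hXS⟩
  let I : Ideal S := (IsLocalRing.maximalIdeal O).map (algebraMap O S)
  -- The radical is the intersection of the minimal primes, so some minimal prime avoids the product
  -- of the generators.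
  obtain ⟨q, hq, hgq⟩ : ∃ q ∈ I.minimalPrimes, g ∉ q := by
    by_contra! h
    have : g ∈ I.radical := by
      rw [← Ideal.sInf_minimalPrimes]
      exact Ideal.mem_sInf.2 fun {q} hq => h q hq
    obtain ⟨N, hN⟩ := this
    exact hpow N (g ^ N) rfl hN
  have hqp : q.IsPrime := hq.1.1
  -- A prime of `R` that meets `S` inside `q`; it replaces `R` by a domain.
  obtain ⟨P, hP, -, hPdisj⟩ := Ideal.exists_le_prime_disjoint (⊥ : Ideal R)
    (q.primeCompl.map S.val) (by
      rw [Set.disjoint_left]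
      rintro _ h ⟨s, hs, rfl⟩
      have h0 : s = 0 := Subtype.ext (Ideal.mem_bot.1 h)
      exact hs (h0 ▸ q.zero_mem))
  let F := FractionRing (R ⧸ P)
  let φ : R →ₐ[K] F := (IsScalarTower.toAlgHom K (R ⧸ P) F).comp (Ideal.Quotient.mkₐ K P)
  have hφ0 : ∀ r, φ r = 0 ↔ r ∈ P := fun r => by
    rw [← Ideal.Quotient.eq_zero_iff_mem]
    exact map_eq_zero_iff _ (IsFractionRing.injective (R ⧸ P) F)
  have hφ : ∀ x : F, ∃ r r', φ r' ≠ 0 ∧ x * φ r' = φ r := by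
    intro x
    obtain ⟨a, b, hb, rfl⟩ := IsFractionRing.div_surjective (A := R ⧸ P) x
    obtain ⟨r, rfl⟩ := Ideal.Quotient.mk_surjective a
    obtain ⟨r', rfl⟩ := Ideal.Quotient.mk_surjective b
    have hb0 : φ r' ≠ 0 := fun h => nonZeroDivisors.ne_zero hb
      (Ideal.Quotient.eq_zero_iff_mem.2 ((hφ0 _).1 h))
    exact ⟨r, r', hb0, div_mul_cancel₀ _ hb0⟩
  obtain ⟨w, hw, hw1, hwq⟩ := exists_valuation_of_algHom v hv hroot φ hφ X hX q hq fun s h0 => by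
    by_contra hsq
    exact Set.disjoint_left.1 hPdisj ((hφ0 _).1 h0) ⟨s, hsq, rfl⟩
  refine ⟨w.comap φ.toRingHom, fun c => ?_, fun x hx => ?_⟩
  · rw [← hw c]
    exact congrArg w (φ.commutes c)
  -- All the generators have value at most `1`, and their product has value `1`.
  · have hle : ∀ y ∈ X, w (φ y) ≤ 1 := fun y hy => hw1 ⟨y, hXS y hy⟩
    have hg : w (φ (∏ x ∈ X, x)) = 1 := hwq g hgq
    refine le_antisymm (hle x hx) ?_
    change 1 ≤ w (φ x)
    rw [← hg, ← Finset.mul_prod_erase _ _ hx, map_mul, map_mul, map_prod, map_prod]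
    exact mul_le_of_le_one_right'
      (Finset.prod_le_one' fun y hy => hle y (Finset.mem_of_mem_erase hy))

/-! ### The Gauss valuation on the group algebra of the value group -/

section Gauss

variable {Γ k : Type*} [LinearOrderedCommGroupWithZero Γ] [Field k] (v : Valuation k Γ)

/-- The Gauss norm `max_γ v(f_γ) γ` of an element `∑ f_γ t^γ` of the group algebra of the value group:
it extends `v` such that the monomial `t^γ` has value `γ`. -/
noncomputable def gaussNorm (f : MonoidAlgebra k Γˣ) : Γ :=
  f.coeff.support.sup fun γ => v (f.coeff γ) * γ

theorem le_gaussNorm (f : MonoidAlgebra k Γˣ) (γ : Γˣ) : v (f.coeff γ) * γ ≤ gaussNorm v f := by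
  by_cases h : γ ∈ f.coeff.support
  · exact Finset.le_sup (f := fun γ : Γˣ => v (f.coeff γ) * (γ : Γ)) h
  · rw [Finsupp.notMem_support_iff.1 h, map_zero, zero_mul]
    exact zero_le

theorem gaussNorm_le {f : MonoidAlgebra k Γˣ} {b : Γ} (h : ∀ γ : Γˣ, v (f.coeff γ) * γ ≤ b) :
    gaussNorm v f ≤ b := Finset.sup_le fun γ _ => h γ

/-- The Gauss norm is attained, and `γ` is the largest exponent at which it is attained. In a
product of two elements, the product of these two terms dominates its coefficient, so that it cannot
cancel. -/
theorem exists_gaussNorm_eq {f : MonoidAlgebra k Γˣ} (hf : f ≠ 0) :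
    ∃ γ : Γˣ, f.coeff γ ≠ 0 ∧ v (f.coeff γ) * γ = gaussNorm v f ∧
      ∀ δ : Γˣ, γ < δ → v (f.coeff δ) * δ < gaussNorm v f := by
  classical
  have hs : f.coeff.support.Nonempty := Finsupp.support_nonempty_iff.2 (by simpa using hf)
  let s := f.coeff.support.filter fun γ => v (f.coeff γ) * γ = gaussNorm v f
  have hs' : s.Nonempty := by
    obtain ⟨γ, hγ, h⟩ := Finset.exists_mem_eq_sup _ hs fun γ : Γˣ => v (f.coeff γ) * (γ : Γ)
    exact ⟨γ, Finset.mem_filter.2 ⟨hγ, h.symm⟩⟩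
  obtain ⟨h1, h2⟩ := Finset.mem_filter.1 (s.max'_mem hs')
  refine ⟨s.max' hs', Finsupp.mem_support_iff.1 h1, h2, fun δ hδ => ?_⟩
  refine lt_of_le_of_ne (le_gaussNorm v f δ) fun h => ?_
  have hmem : δ ∈ s := by
    refine Finset.mem_filter.2 ⟨Finsupp.mem_support_iff.2 fun h0 => ?_, h⟩
    rw [h0, map_zero, zero_mul, ← h2] at h
    exact mul_ne_zero ((v.ne_zero_iff).2 (Finsupp.mem_support_iff.1 h1)) (Units.ne_zero _) h.symm
  exact absurd (s.le_max' δ hmem) (not_le.2 hδ)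

theorem gaussNorm_ne_zero {f : MonoidAlgebra k Γˣ} (hf : f ≠ 0) : gaussNorm v f ≠ 0 := by
  obtain ⟨γ, h0, h, -⟩ := exists_gaussNorm_eq v hf
  rw [← h]
  exact mul_ne_zero ((v.ne_zero_iff).2 h0) (Units.ne_zero _)

theorem gaussNorm_mul (f g : MonoidAlgebra k Γˣ) :
    gaussNorm v (f * g) = gaussNorm v f * gaussNorm v g := by
  classical
  have hz : gaussNorm v (0 : MonoidAlgebra k Γˣ) = 0 :=
    le_antisymm (gaussNorm_le v (by simp)) zero_le
  rcases eq_or_ne f 0 with rfl | hf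
  · rw [zero_mul, hz, zero_mul]
  rcases eq_or_ne g 0 with rfl | hg
  · rw [mul_zero, hz, mul_zero]
  have split : ∀ γ h : Γˣ, v (f.coeff h * g.coeff (h⁻¹ * γ)) * γ =
      (v (f.coeff h) * h) * (v (g.coeff (h⁻¹ * γ)) * (h⁻¹ * γ : Γˣ)) := fun γ h => by
    have : (γ : Γ) = h * (h⁻¹ * γ : Γˣ) := by rw [← Units.val_mul, mul_inv_cancel_left]
    rw [map_mul, mul_mul_mul_comm, ← this]
  refine le_antisymm (gaussNorm_le v fun γ => ?_) ?_
  · rw [MonoidAlgebra.coeff_mul_apply_left]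
    refine (le_mul_inv_iff₀ (zero_lt_iff.2 γ.ne_zero)).1 (v.map_sum_le fun h _ => ?_)
    rw [le_mul_inv_iff₀ (zero_lt_iff.2 γ.ne_zero), split]
    exact mul_le_mul' (le_gaussNorm v f h) (le_gaussNorm v g _)
  · obtain ⟨γ, hγ0, hγ, hγmax⟩ := exists_gaussNorm_eq v hf
    obtain ⟨δ, hδ0, hδ, hδmax⟩ := exists_gaussNorm_eq v hg
    have hpos : v (f.coeff γ * g.coeff δ) ≠ 0 := v.ne_zero_iff.2 (mul_ne_zero hγ0 hδ0)
    have hcoeff : v ((f * g).coeff (γ * δ)) = v (f.coeff γ * g.coeff δ) := by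
      rw [MonoidAlgebra.coeff_mul_apply_left, Finsupp.sum,
        ← Finset.add_sum_erase _ _ (Finsupp.mem_support_iff.2 hγ0), inv_mul_cancel_left]
      refine v.map_add_eq_of_lt_left (v.map_sum_lt hpos fun h hh => ?_)
      have hne := (Finset.mem_erase.1 hh).1
      have hval : v (f.coeff γ * g.coeff δ) * (γ * δ : Γˣ) = gaussNorm v f * gaussNorm v g := by
        rw [← hγ, ← hδ, map_mul, Units.val_mul]
        exact mul_mul_mul_comm _ _ _ _
      refine (mul_lt_mul_iff_left₀ (zero_lt_iff.2 (γ * δ).ne_zero)).1 ?_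
      rw [hval, split]
      -- If `h < γ` then the other exponent exceeds `δ`, and if `γ < h` then `h` exceeds `γ`; either way
      -- one of the two factors is strictly smaller than the norm.
      rcases lt_or_gt_of_ne hne with hlt | hlt
      · refine mul_lt_mul_of_le_of_lt_of_nonneg_of_pos (le_gaussNorm v f h) (hδmax _ ?_) zero_le
          (zero_lt_iff.2 (gaussNorm_ne_zero v hf))
        rw [lt_inv_mul_iff_mul_lt]
        exact mul_lt_mul_left hlt δ
      · exact mul_lt_mul_of_lt_of_le_of_nonneg_of_pos (hγmax h hlt) (le_gaussNorm v g _) zero_le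
          (zero_lt_iff.2 (gaussNorm_ne_zero v hg))
    have := le_gaussNorm v (f * g) (γ * δ)
    rw [hcoeff, map_mul, Units.val_mul, mul_mul_mul_comm, hγ, hδ] at this
    exact this

/-- The Gauss norm as a valuation. -/
noncomputable def gaussValuation : Valuation (MonoidAlgebra k Γˣ) Γ where
  toFun := gaussNorm v
  map_zero' := le_antisymm (gaussNorm_le v (by simp)) zero_le
  map_one' := by
    refine le_antisymm (gaussNorm_le v fun γ => ?_) ?_
    · rw [MonoidAlgebra.one_def, MonoidAlgebra.coeff_single, Finsupp.single_apply]
      split_ifs with h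
      · rw [← h]; simp
      · simp
    · simpa using le_gaussNorm v 1 1
  map_mul' := gaussNorm_mul v
  map_add_le_max' f g := gaussNorm_le v fun γ => by
    rw [MonoidAlgebra.coeff_add, Finsupp.add_apply]
    refine (mul_le_mul_left (v.map_add _ _) _).trans ?_
    rcases le_total (v (f.coeff γ)) (v (g.coeff γ)) with h | h
    · rw [max_eq_right h]
      exact le_max_of_le_right (le_gaussNorm v g γ)
    · rw [max_eq_left h]
      exact le_max_of_le_left (le_gaussNorm v f γ)

theorem gaussValuation_single (c : k) (γ : Γˣ) :
    gaussValuation v (MonoidAlgebra.single γ c) = v c * γ := by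
  refine le_antisymm (gaussNorm_le v fun δ => ?_) ?_
  · rw [MonoidAlgebra.coeff_single, Finsupp.single_apply]
    split_ifs with h
    · rw [h]
    · simp
  · change v c * γ ≤ gaussNorm v (MonoidAlgebra.single γ c)
    simpa using le_gaussNorm v (MonoidAlgebra.single γ c) γ

theorem nonZeroDivisors_le_gaussValuation :
    nonZeroDivisors (MonoidAlgebra k Γˣ) ≤ (gaussValuation v).supp.primeCompl := fun _ hf h =>
  gaussNorm_ne_zero v (nonZeroDivisors.ne_zero hf) h

/-- The extension of the Gauss valuation to the field of fractions of the group algebra. Its values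
exhaust all of `Γ`, even if those of `v` do not. -/
noncomputable def fractionGaussValuation : Valuation (FractionRing (MonoidAlgebra k Γˣ)) Γ :=
  (gaussValuation v).extendToLocalization (nonZeroDivisors_le_gaussValuation v) _

theorem fractionGaussValuation_algebraMap (f : MonoidAlgebra k Γˣ) :
    fractionGaussValuation v (algebraMap _ _ f) = gaussNorm v f :=
  (gaussValuation v).extendToLocalization_apply_map_apply _ _ f

theorem fractionGaussValuation_surjective : Function.Surjective (fractionGaussValuation v) := by
  intro γ
  rcases eq_or_ne γ 0 with rfl | hγ
  · exact ⟨0, map_zero _⟩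
  · refine ⟨algebraMap _ _ (MonoidAlgebra.single (Units.mk0 γ hγ) (1 : k)), ?_⟩
    rw [fractionGaussValuation_algebraMap]
    refine (gaussValuation_single v 1 (Units.mk0 γ hγ)).trans ?_
    simp

end Gauss

/-! ### Extending a function on monomials to a valuation -/

section Twist

open TensorProduct

variable {Γ k : Type*} [LinearOrderedCommGroupWithZero Γ] [Field k] (v : Valuation k Γ)
  {R M : Type*} [CommRing R] [Algebra k R] [CommMonoid M]

/-- The coefficient map `f ⊗ r ↦ f_δ r` on `k[Γˣ] ⊗ R`. -/
noncomputable def coeffTensor (R : Type*) [CommRing R] [Algebra k R] (δ : Γˣ) :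
    MonoidAlgebra k Γˣ ⊗[k] R →ₗ[k] R :=
  TensorProduct.lift
    { toFun := fun f => f.coeff δ • LinearMap.id
      map_add' := fun f g => by rw [MonoidAlgebra.coeff_add, Finsupp.add_apply, add_smul]
      map_smul' := fun c f => by
        rw [MonoidAlgebra.coeff_smul_apply, smul_eq_mul, mul_smul, RingHom.id_apply] }

theorem coeffTensor_tmul (δ : Γˣ) (f : MonoidAlgebra k Γˣ) (r : R) :
    coeffTensor R δ (f ⊗ₜ[k] r) = f.coeff δ • r := rfl

theorem tmul_algebraMap_injective :
    Function.Injective (LinearMap.rTensor R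
      (IsScalarTower.toAlgHom k (MonoidAlgebra k Γˣ)
        (FractionRing (MonoidAlgebra k Γˣ))).toLinearMap) :=
  Module.Flat.rTensor_preserves_injective_linearMap _
    (IsFractionRing.injective (MonoidAlgebra k Γˣ) _)

/-- The twisted monomials `t^{-y(a)} ⊗ ρ(a)`. A valuation that extends the Gauss valuation takes the
value `y(a)` on `ρ(a)` if and only if it takes the value `1` on the twisted monomial. -/
noncomputable def twist (ρ : M →* R) (y : M →* Γˣ) :
    M →* FractionRing (MonoidAlgebra k Γˣ) ⊗[k] R where
  toFun a := algebraMap _ _ (MonoidAlgebra.single (y a)⁻¹ (1 : k)) ⊗ₜ ρ a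
  map_one' := by
    rw [map_one, map_one, inv_one, ← MonoidAlgebra.one_def, map_one,
      Algebra.TensorProduct.one_def]
  map_mul' a b := by
    rw [Algebra.TensorProduct.tmul_mul_tmul, ← map_mul, ← map_mul, MonoidAlgebra.single_mul_single,
      map_mul, mul_inv, mul_one]

theorem algebraMap_smul_twist (ρ : M →* R) (y : M →* Γˣ) (f : MonoidAlgebra k Γˣ) (a : M) :
    algebraMap _ (FractionRing (MonoidAlgebra k Γˣ)) f • twist (k := k) ρ y a =
      LinearMap.rTensor R (IsScalarTower.toAlgHom k (MonoidAlgebra k Γˣ)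
        (FractionRing (MonoidAlgebra k Γˣ))).toLinearMap
        ((f * MonoidAlgebra.single (y a)⁻¹ 1) ⊗ₜ ρ a) := by
  refine (TensorProduct.smul_tmul' _ _ _).trans ?_
  rw [smul_eq_mul, ← map_mul]
  rfl

/-- The bend relations, seen after the base change: no twisted monomial is a combination of twisted
monomials with coefficients of value less than `1`. -/
theorem twist_ne_sum {ρ : M →* R} {y : M →* Γˣ}
    (hbend : ∀ (a₀ : M) (c₀ : k) (s : Finset M) (c : M → k), c₀ ≠ 0 →
      c₀ • ρ a₀ = ∑ a ∈ s, c a • ρ a → ∃ a ∈ s, v c₀ * y a₀ ≤ v (c a) * y a)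
    (a₀ : M) (s : Finset M) (d : M → FractionRing (MonoidAlgebra k Γˣ))
    (hd : ∀ a, fractionGaussValuation v (d a) < 1) :
    twist (k := k) ρ y a₀ ≠ ∑ a ∈ s, d a • twist ρ y a := by
  intro h
  -- Write `d a = f a / g` with a common denominator `g`.
  obtain ⟨⟨g, hg⟩, hint⟩ := IsLocalization.exist_integer_multiples
    (nonZeroDivisors (MonoidAlgebra k Γˣ)) s d
  have hg0 : g ≠ 0 := nonZeroDivisors.ne_zero hg
  have hex : ∀ a, ∃ f : MonoidAlgebra k Γˣ, a ∈ s →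
      algebraMap _ (FractionRing (MonoidAlgebra k Γˣ)) f = algebraMap _ _ g * d a := fun a => by
    by_cases ha : a ∈ s
    · obtain ⟨f, hf⟩ := hint a ha
      exact ⟨f, fun _ => hf.trans (Algebra.smul_def _ _)⟩
    · exact ⟨0, fun h => absurd h ha⟩
  choose f hf using hex
  have h1 := congrArg (algebraMap _ (FractionRing (MonoidAlgebra k Γˣ)) g • ·) h
  simp only [Finset.smul_sum, smul_smul] at h1
  rw [Finset.sum_congr rfl fun a ha => by rw [← hf a ha, algebraMap_smul_twist],
    algebraMap_smul_twist, ← map_sum] at h1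
  have h2 := tmul_algebraMap_injective h1
  -- Comparing the coefficients at `δ * (y a₀)⁻¹`, where `δ` is an exponent at which the Gauss norm
  -- of `g` is attained, gives a relation over `k` between the `ρ a`. Its bend relation shows that
  -- the norm of some `f a` is at least that of `g`.
  obtain ⟨δ, hδ0, hδ, -⟩ := exists_gaussNorm_eq v hg0
  have h3 := congrArg (coeffTensor R (δ * (y a₀)⁻¹)) h2
  rw [map_sum] at h3
  simp only [coeffTensor_tmul, MonoidAlgebra.coeff_mul_single_apply, mul_one, inv_inv,
    inv_mul_cancel_right] at h3
  obtain ⟨a, ha, hle⟩ := hbend a₀ _ s (fun a => (f a).coeff (δ * (y a₀)⁻¹ * y a)) hδ0 h3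
  have hlt : gaussNorm v (f a) < gaussNorm v g := by
    rw [← fractionGaussValuation_algebraMap, hf a ha, map_mul, fractionGaussValuation_algebraMap]
    exact mul_lt_of_lt_one_right (zero_lt_iff.2 (gaussNorm_ne_zero v hg0)) (hd a)
  have hle' := (le_gaussNorm v (f a) (δ * (y a₀)⁻¹ * y a)).trans_lt hlt
  rw [← hδ] at hle'
  refine absurd hle' (not_lt.2 ?_)
  have := mul_le_mul_left hle ((δ * (y a₀)⁻¹ : Γˣ) : Γ)
  refine le_trans (le_of_eq ?_) (this.trans (le_of_eq ?_))
  · rw [mul_assoc, ← Units.val_mul, mul_comm (y a₀), inv_mul_cancel_right]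
  · rw [mul_assoc, ← Units.val_mul, mul_comm (y a)]

/-- If `X` consists of values of a multiplicative map `e`, the ideal `I · O[X]` consists of
`I`-combinations of values of `e`. -/
theorem mem_smul_span_of_mem_map {O R : Type*} [CommRing O] [CommRing R] [Algebra O R] (I : Ideal O)
    (e : M →* R) (X : Set R) (hX : X ⊆ Set.range e) {s : Algebra.adjoin O X}
    (hs : s ∈ I.map (algebraMap O (Algebra.adjoin O X))) :
    (s : R) ∈ I • Submodule.span O (Set.range e) := by
  have hstep : ∀ r ∈ Algebra.adjoin O X, ∀ x ∈ I • Submodule.span O (Set.range e),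
      r * x ∈ I • Submodule.span O (Set.range e) := by
    intro r hr
    induction hr using Algebra.adjoin_induction with
    | mem g hg =>
      obtain ⟨b, rfl⟩ := hX hg
      intro x hx
      have : (I • Submodule.span O (Set.range e)).map (LinearMap.mulLeft O (e b)) ≤
          I • Submodule.span O (Set.range e) := by
        rw [Submodule.map_smul'', Submodule.map_span]
        refine Submodule.smul_mono le_rfl (Submodule.span_le.2 ?_)
        rintro _ ⟨_, ⟨a, rfl⟩, rfl⟩
        exact Submodule.subset_span ⟨b * a, map_mul e b a⟩
      exact this ⟨x, hx, rfl⟩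
    | algebraMap c =>
      intro x hx
      rw [← Algebra.smul_def]
      exact Submodule.smul_mem _ c hx
    | add a b _ _ ha hb =>
      intro x hx
      rw [add_mul]
      exact add_mem (ha x hx) (hb x hx)
    | mul a b _ _ ha hb =>
      intro x hx
      rw [mul_assoc]
      exact ha _ (hb x hx)
  change s ∈ Submodule.span _ _ at hs
  induction hs using Submodule.span_induction with
  | mem _ h =>
    obtain ⟨c, hc, rfl⟩ := h
    have := Submodule.smul_mem_smul hc
      (Submodule.subset_span (R := O) (s := Set.range e) ⟨1, map_one e⟩)
    rw [← Algebra.algebraMap_eq_smul_one] at this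
    exact this
  | zero => exact zero_mem _
  | add a b _ _ ha hb => exact add_mem ha hb
  | smul a b _ hb => exact hstep a a.2 b hb

/-- The fundamental theorem for points `y` of the torus: a function `y` on the monomials that
satisfies the bend relations is the restriction of a valuation. -/
theorem exists_valuation_of_monomials
    (hroot : ∀ (γ : Γ) (N : ℕ), N ≠ 0 → ∃ δ, δ ^ N = γ) (ρ : M →* R) (y : M →* Γˣ)
    (hspan : Submodule.span k (Set.range ρ) = ⊤) (G : Finset M)
    (hG : Submonoid.closure (G : Set M) = ⊤)
    (hbend : ∀ (a₀ : M) (c₀ : k) (s : Finset M) (c : M → k), c₀ ≠ 0 →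
      c₀ • ρ a₀ = ∑ a ∈ s, c a • ρ a → ∃ a ∈ s, v c₀ * y a₀ ≤ v (c a) * y a) :
    ∃ w : Valuation R Γ, (∀ c, w (algebraMap k R c) = v c) ∧ ∀ a, w (ρ a) = y a := by
  classical
  let K := FractionRing (MonoidAlgebra k Γˣ)
  let e : M →* K ⊗[k] R := twist ρ y
  let X : Finset (K ⊗[k] R) := G.image e
  have hunit : ∀ a, algebraMap _ K (MonoidAlgebra.single (y a) (1 : k)) • e a = 1 ⊗ₜ ρ a := by
    intro a
    change _ • (_ ⊗ₜ _) = _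
    rw [TensorProduct.smul_tmul', smul_eq_mul, ← map_mul, MonoidAlgebra.single_mul_single,
      mul_inv_cancel, mul_one, ← MonoidAlgebra.one_def, map_one]
  have hXtop : Algebra.adjoin K (X : Set (K ⊗[k] R)) = ⊤ := by
    have he : ∀ a, e a ∈ Algebra.adjoin K (X : Set (K ⊗[k] R)) := fun a => by
      have ha : a ∈ Submonoid.closure (G : Set M) := hG ▸ trivial
      induction ha using Submonoid.closure_induction with
      | mem a ha => exact Algebra.subset_adjoin (Finset.mem_image_of_mem e ha)
      | one => rw [map_one]; exact one_mem _
      | mul a b _ _ ha hb => rw [map_mul]; exact mul_mem ha hb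
    have hr : ∀ r : R, (1 : K) ⊗ₜ r ∈ Algebra.adjoin K (X : Set (K ⊗[k] R)) := fun r => by
      have hr : r ∈ Submodule.span k (Set.range ρ) := hspan ▸ trivial
      induction hr using Submodule.span_induction with
      | mem _ h =>
        obtain ⟨a, rfl⟩ := h
        rw [← hunit]
        exact Subalgebra.smul_mem _ (he a) _
      | zero => rw [TensorProduct.tmul_zero]; exact zero_mem _
      | add a b _ _ ha hb => rw [TensorProduct.tmul_add]; exact add_mem ha hb
      | smul c a _ ha =>
        rw [TensorProduct.tmul_smul, ← algebraMap_smul K c]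
        exact Subalgebra.smul_mem _ ha _
    refine Algebra.eq_top_iff.2 fun z => ?_
    induction z using TensorProduct.induction_on with
    | zero => exact zero_mem _
    | add a b ha hb => exact add_mem ha hb
    | tmul c r =>
      have : c ⊗ₜ[k] r = c • ((1 : K) ⊗ₜ[k] r) := by
        rw [TensorProduct.smul_tmul', smul_eq_mul, mul_one]
      rw [this]
      exact Subalgebra.smul_mem _ (hr r) _
  -- A power of the product of the generators is itself a twisted monomial, so `twist_ne_sum` keeps
  -- it out of `𝔪S`.
  obtain ⟨w, hw, hw1⟩ := exists_valuation_eq_one_of_pow_notMem (fractionGaussValuation v)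
    (fractionGaussValuation_surjective v) hroot X hXtop fun N s hs hmem => by
      obtain ⟨a₀, ha₀⟩ : (∏ x ∈ X, x) ^ N ∈ MonoidHom.mrange e :=
        pow_mem (prod_mem fun x hx => by
          obtain ⟨a, -, rfl⟩ := Finset.mem_image.1 hx
          exact ⟨a, rfl⟩) N
      have hsub : (X : Set (K ⊗[k] R)) ⊆ Set.range e := fun x hx => by
        obtain ⟨a, -, rfl⟩ := Finset.mem_image.1 hx
        exact ⟨a, rfl⟩
      have h1 := mem_smul_span_of_mem_map _ e _ hsub hmem
      rw [hs, ← ha₀, Submodule.mem_ideal_smul_span_iff_exists_sum] at h1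
      obtain ⟨d, hd, hsum⟩ := h1
      exact twist_ne_sum v hbend a₀ d.support (fun a => (d a : K))
        (fun a => (Valuation.mem_maximalIdeal_iff _ _).1 (hd a)) hsum.symm
  have hwe : ∀ a, w (e a) = 1 := fun a => by
    have ha : a ∈ Submonoid.closure (G : Set M) := hG ▸ trivial
    induction ha using Submonoid.closure_induction with
    | mem a ha => exact hw1 _ (Finset.mem_image_of_mem e ha)
    | one => rw [map_one, map_one]
    | mul a b _ _ ha hb => rw [map_mul, map_mul, ha, hb, mul_one]
  have hwK : ∀ (f : MonoidAlgebra k Γˣ), w (algebraMap K _ (algebraMap _ K f)) = gaussNorm v f :=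
    fun f => (hw _).trans (fractionGaussValuation_algebraMap v f)
  refine ⟨w.comap (Algebra.TensorProduct.includeRight : R →ₐ[k] K ⊗[k] R).toRingHom,
    fun c => ?_, fun a => ?_⟩
  · have h1 : (1 : K) ⊗ₜ[k] algebraMap k R c =
        algebraMap K (K ⊗[k] R) (algebraMap _ K (MonoidAlgebra.single (1 : Γˣ) c)) := by
      rw [Algebra.TensorProduct.algebraMap_apply, Algebra.algebraMap_self_apply,
        Algebra.algebraMap_eq_smul_one, TensorProduct.tmul_smul, TensorProduct.smul_tmul',
        ← algebraMap_smul (MonoidAlgebra k Γˣ) c (1 : K), Algebra.smul_def, mul_one]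
      rfl
    change w ((1 : K) ⊗ₜ[k] algebraMap k R c) = v c
    rw [h1, hwK]
    exact (gaussValuation_single v c 1).trans (by simp)
  · change w ((1 : K) ⊗ₜ[k] ρ a) = y a
    rw [← hunit]
    refine (congrArg w (Algebra.smul_def _ _)).trans ?_
    rw [map_mul, hwe, mul_one, hwK]
    exact (gaussValuation_single v 1 _).trans (by simp)
end Twist

/-- The fundamental theorem of tropical geometry over a totally ordered divisible value group: a
function `y` on the monomials that satisfies the bend relations of all linear relations between
them is the restriction of a valuation on the algebra. -/
theorem exists_valuation_of_bend {Γ k R A : Type*} [LinearOrderedCommGroupWithZero Γ] [Field k]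
    (v : Valuation k Γ) (hroot : ∀ (γ : Γ) (N : ℕ), N ≠ 0 → ∃ δ, δ ^ N = γ) [CommRing R]
    [Algebra k R] [CommMonoidWithZero A] [Monoid.FG A] (π : A →*₀ R) (y : A →*₀ Γ)
    (hspan : Submodule.span k (Set.range π) = ⊤)
    (hbend : ∀ (a₀ : A) (c₀ : k) (N : Multiset (k × A)), c₀ ≠ 0 → y a₀ ≠ 0 →
      c₀ • π a₀ = (N.map fun p => p.1 • π p.2).sum → ∃ p ∈ N, v c₀ * y a₀ ≤ v p.1 * y p.2) :
    ∃ w : Valuation R Γ, (∀ c, w (algebraMap k R c) = v c) ∧ ∀ a, w (π a) = y a := by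
  classical
  let Z : Set A := {a | y a = 0}
  -- Dividing out the monomials with `y a = 0` reduces to a point of the torus. The bend relations
  -- persist: a term `π a` with `y a = 0` has value `0`, so it never attains the maximum.
  let J : Ideal R := Ideal.span (π '' Z)
  have hJ : ∀ r ∈ J, r ∈ Submodule.span k (π '' Z) := by
    intro r hr
    change r ∈ Submodule.span R _ at hr
    induction hr using Submodule.span_induction with
    | mem _ h => exact Submodule.subset_span h
    | zero => exact zero_mem _
    | add a b _ _ ha hb => exact add_mem ha hb
    | smul r x _ hx =>
      have hr : r ∈ Submodule.span k (Set.range π) := hspan ▸ trivial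
      have : Submodule.span k (Set.range π) * Submodule.span k (π '' Z) ≤
          Submodule.span k (π '' Z) := by
        rw [Submodule.span_mul_span, Submodule.span_le]
        rintro _ ⟨_, ⟨a, rfl⟩, _, ⟨b, hb, rfl⟩, rfl⟩
        refine Submodule.subset_span ⟨a * b, ?_, map_mul π a b⟩
        change y (a * b) = 0
        rw [map_mul, show y b = 0 from hb, mul_zero]
      exact this (Submodule.mul_mem_mul hr hx)
  let M : Submonoid A :=
    { carrier := {a | y a ≠ 0}
      one_mem' := by simp
      mul_mem' := fun {a b} ha hb => by
        change y (a * b) ≠ 0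
        rw [map_mul]
        exact mul_ne_zero ha hb }
  let ρ : M →* R ⧸ J := ((Ideal.Quotient.mk J : R →* R ⧸ J).comp (π : A →* R)).comp M.subtype
  let yM : M →* Γˣ :=
    { toFun := fun a => Units.mk0 (y (a : A)) a.2
      map_one' := Units.ext (map_one y)
      map_mul' := fun a b => Units.ext (map_mul y (a : A) b) }
  obtain ⟨S, hS⟩ := (Monoid.fg_def.1 ‹Monoid.FG A›)
  let G : Finset M := S.subtype (· ∈ M)
  have hG : Submonoid.closure (G : Set M) = ⊤ := by
    have key : ∀ a : A, ∀ ha : a ∈ M, (⟨a, ha⟩ : M) ∈ Submonoid.closure (G : Set M) := by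
      intro a
      have ha : a ∈ Submonoid.closure (S : Set A) := hS ▸ trivial
      induction ha using Submonoid.closure_induction with
      | mem a h => exact fun ha => Submonoid.subset_closure (Finset.mem_subtype.2 h)
      | one => exact fun ha => one_mem _
      | mul a b _ _ iha ihb =>
        intro hab
        have hab' : y a * y b ≠ 0 := by
          rw [← map_mul]
          exact hab
        exact mul_mem (iha (left_ne_zero_of_mul hab')) (ihb (right_ne_zero_of_mul hab'))
    exact (Submonoid.eq_top_iff' _).2 fun a => key a.1 a.2
  have hmk : ∀ a (ha : a ∈ M), ρ ⟨a, ha⟩ = Ideal.Quotient.mk J (π a) := fun a ha => rfl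
  have hJZ : ∀ a, a ∉ M → Ideal.Quotient.mk J (π a) = 0 := fun a ha =>
    Ideal.Quotient.eq_zero_iff_mem.2 (Ideal.subset_span ⟨a, not_not.1 ha, rfl⟩)
  have hspan' : Submodule.span k (Set.range ρ) = ⊤ := by
    refine (Submodule.eq_top_iff'.2 fun x => ?_)
    obtain ⟨r, rfl⟩ := Ideal.Quotient.mk_surjective x
    have hr : r ∈ Submodule.span k (Set.range π) := hspan ▸ trivial
    induction hr using Submodule.span_induction with
    | mem _ h =>
      obtain ⟨a, rfl⟩ := h
      by_cases ha : a ∈ M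
      · exact Submodule.subset_span ⟨⟨a, ha⟩, rfl⟩
      · rw [hJZ a ha]
        exact zero_mem _
    | zero => exact zero_mem _
    | add a b _ _ ha hb => exact add_mem ha hb
    | smul c a _ ha => exact Submodule.smul_mem _ c ha
  obtain ⟨w, hw, hwy⟩ := exists_valuation_of_monomials v hroot ρ yM hspan' G hG
    fun a₀ c₀ s c hc₀ h => by
      have hmem : c₀ • π a₀ - ∑ a ∈ s, c a • π a ∈ J := by
        rw [← Ideal.Quotient.eq_zero_iff_mem, map_sub, sub_eq_zero, map_sum]
        exact h
      obtain ⟨l, hl, hsum⟩ := (Finsupp.mem_span_image_iff_linearCombination k).1 (hJ _ hmem)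
      obtain ⟨⟨d, a⟩, hp, hle⟩ := hbend a₀ c₀
        (s.val.map (fun a => (c a, (a : A))) + l.support.val.map fun a => (l a, a)) hc₀ a₀.2 (by
          rw [Multiset.map_add, Multiset.sum_add, Multiset.map_map, Multiset.map_map]
          rw [Finsupp.linearCombination_apply] at hsum
          have := sub_eq_iff_eq_add'.1 hsum.symm
          exact this)
      have hpos : v c₀ * y a₀ ≠ 0 := mul_ne_zero (v.ne_zero_iff.2 hc₀) a₀.2
      rcases Multiset.mem_add.1 hp with hp | hp
      · obtain ⟨a', ha', h'⟩ := Multiset.mem_map.1 hp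
        obtain ⟨rfl, rfl⟩ := Prod.ext_iff.1 h'
        exact ⟨a', ha', hle⟩
      · obtain ⟨a', ha', h'⟩ := Multiset.mem_map.1 hp
        obtain ⟨rfl, rfl⟩ := Prod.ext_iff.1 h'
        have hz : y a' = 0 := (Finsupp.mem_supported k l).1 hl ha'
        rw [hz, mul_zero] at hle
        exact absurd (le_antisymm hle zero_le) hpos
  refine ⟨w.comap (Ideal.Quotient.mk J), hw, fun a => ?_⟩
  by_cases ha : a ∈ M
  · exact hwy ⟨a, ha⟩
  · change w (Ideal.Quotient.mk J (π a)) = _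
    rw [hJZ a ha, map_zero]
    exact (not_not.1 ha).symm

/-! ### The semiring `𝕋^(n)` -/

namespace BlueScheme

theorem continuous_mul_const {Γ : Type*} [LinearOrderedCommGroupWithZero Γ] [TopologicalSpace Γ]
    [OrderTopology Γ] (c : Γ) : Continuous fun x : Γ => x * c := by
  rcases eq_or_ne c 0 with rfl | hc
  · simpa using continuous_const
  · exact (OrderIso.mulRight₀ c (zero_lt_iff.2 hc)).continuous

theorem continuousAt_div {Γ : Type*} [LinearOrderedCommGroupWithZero Γ] [TopologicalSpace Γ]
    [OrderTopology Γ] {p : Γ × Γ} (hp : p.2 ≠ 0) :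
    ContinuousAt (fun p : Γ × Γ => p.1 / p.2) p := by
  have hne : ∀ᶠ q : Γ × Γ in nhds p, 0 < q.2 :=
    (isOpen_lt continuous_const continuous_snd).mem_nhds (zero_lt_iff.2 hp)
  refine tendsto_order.2 ⟨fun a ha => ?_, fun b hb => ?_⟩
  · rw [lt_div_iff₀ (zero_lt_iff.2 hp), mul_comm] at ha
    filter_upwards [hne, (isOpen_lt ((continuous_mul_const a).comp continuous_snd)
      continuous_fst).mem_nhds ha] with q hq hlt
    rw [lt_div_iff₀ hq, mul_comm]
    exact hlt
  · change p.1 / p.2 < b at hb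
    rw [div_lt_iff₀ (zero_lt_iff.2 hp), mul_comm] at hb
    filter_upwards [hne, (isOpen_lt continuous_fst
      ((continuous_mul_const b).comp continuous_snd)).mem_nhds hb] with q hq hlt
    rw [div_lt_iff₀ hq, mul_comm]
    exact hlt

instance (n : ℕ) : OrderTopology (TropN n) := ⟨rfl⟩

theorem TropN.exists_pow_eq {n : ℕ} (γ : TropN n) (N : ℕ) (hN : N ≠ 0) : ∃ δ, δ ^ N = γ := by
  obtain rfl | ⟨g, rfl⟩ : γ = 0 ∨ ∃ g : Lex (Fin n → {x : ℝ // 0 < x}), γ = WithZero.coe g := by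
    induction γ using WithZero.recZeroCoe with
    | zero => exact Or.inl rfl
    | coe g => exact Or.inr ⟨g, rfl⟩
  · exact ⟨0, zero_pow hN⟩
  · let d : Lex (Fin n → {x : ℝ // 0 < x}) :=
      toLex fun i => ⟨(ofLex g i : ℝ) ^ ((N : ℝ)⁻¹), Real.rpow_pos_of_pos (ofLex g i).2 _⟩
    have hd : d ^ N = g := by
      refine congrArg toLex (funext fun i => Subtype.ext ?_)
      exact Real.rpow_inv_natCast_pow (ofLex g i).2.le hN
    refine ⟨WithZero.coe d, ?_⟩
    exact (WithZero.coe_pow d N).symm.trans (congrArg WithZero.coe hd)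

theorem TropN.add_eq_right_iff {n : ℕ} {a b : TropN n} : a + b = b ↔ a ≤ b := max_eq_right_iff

theorem TropN.sum_le {n : ℕ} {N : Multiset (TropN n)} {b : TropN n} (h : ∀ a ∈ N, a ≤ b) :
    N.sum ≤ b := by
  induction N using Multiset.induction_on with
  | empty => exact zero_le
  | cons a N ih =>
    rw [Multiset.sum_cons]
    exact max_le (h a (by simp)) (ih fun c hc => h c (by simp [hc]))

theorem TropN.exists_mem_le_of_le_sum {n : ℕ} {N : Multiset (TropN n)} {a : TropN n} (ha : a ≠ 0)
    (h : a ≤ N.sum) : ∃ b ∈ N, a ≤ b := by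
  by_contra! hlt
  induction N using Multiset.induction_on with
  | empty => exact ha (le_antisymm h zero_le)
  | cons b N ih =>
    rw [Multiset.sum_cons] at h
    rcases le_max_iff.1 h with h | h
    · exact absurd h (not_le.2 (hlt b (by simp)))
    · exact ih h fun c hc => hlt c (by simp [hc])

theorem ofSemiring_le_iff {R : Type u} [CommSemiring R] {s t : Multiset R} :
    (ofSemiring R).le s t ↔ s.sum = t.sum := by
  change ((s.map fun x : R => x).sum = (t.map fun x : R => x).sum) ↔ _
  rw [Multiset.map_id', Multiset.map_id']

/-! ### The spectrum of `𝕋^(n)` -/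

/-- `toGlobal` as a morphism of ordered blueprints. -/
def toGlobalHom (B : OrderedBlueprint.{u}) : BPHom B ((Spec B).sec ⊤) where
  hom :=
    { toFun := toGlobal B
      map_zero' := Subtype.ext (funext fun _ => frac_zero _)
      map_one' := Subtype.ext (funext fun _ => frac_one)
      map_mul' := fun a b => Subtype.ext (funext fun p => by
        change B.frac (a * b) (1 : p.1.compl) = B.frac a 1 * B.frac b 1
        rw [frac_mul, mul_one]) }
  map_le {s t} h p := by
    have h' : p.1.stalk.le (s.map fun a => B.frac a (1 : p.1.compl))
        (t.map fun a => B.frac a (1 : p.1.compl)) := by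
      refine ⟨(s.map fun a => Localization.mk a (1 : p.1.compl)),
        (t.map fun a => Localization.mk a (1 : p.1.compl)), ?_, ?_, ⟨1, s, t, rfl, rfl, h⟩⟩
      · rw [Multiset.map_map]; rfl
      · rw [Multiset.map_map]; rfl
    exact (le_map_map p.1.stalk fun _ => rfl).2 h'

section Trop

variable {n : ℕ}

/-- The zero ideal, which is the only point of `Spec 𝕋^(n)`. -/
def tropPoint (n : ℕ) : PrimeKIdeal (tropBP n) where
  carrier := {0}
  zero_mem := rfl
  mul_mem := by
    rintro _ b rfl
    exact zero_mul b
  sub_mem := by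
    intro c s t _ ht h _
    have h1 := ofSemiring_le_iff.1 h
    rw [Multiset.sum_cons] at h1
    have h2 : t.sum ≤ (0 : TropN n) := TropN.sum_le fun a ha => (ht a ha).le
    have h3 : c ≤ t.sum := h1 ▸ le_max_left _ _
    exact le_antisymm (h3.trans h2) zero_le
  one_notMem := one_ne_zero (α := TropN n)
  mul_notMem := fun ha hb => mul_ne_zero (M₀ := TropN n) ha hb

theorem eq_tropPoint (p : PrimeKIdeal (tropBP n)) : p = tropPoint n := by
  refine PrimeKIdeal.ext (Set.eq_of_subset_of_subset (fun a ha => ?_) fun a ha => ?_)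
  · by_contra h
    have ha0 : (a : TropN n) ≠ 0 := h
    refine p.one_notMem ?_
    have := p.mul_mem ((a : TropN n)⁻¹ : TropN n) ha
    rwa [show (a * ((a : TropN n)⁻¹ : TropN n) : TropN n) = 1 from mul_inv_cancel₀ ha0] at this
  · rw [show a = 0 from ha]
    exact p.zero_mem

theorem tropPoint_ne_zero (s : (tropPoint n).compl) : ((s : tropBP n) : TropN n) ≠ 0 := s.2

/-- The stalk of `Spec 𝕋^(n)` at its only point is `𝕋^(n)`, by dividing out the denominator. -/
noncomputable def stalkEval (n : ℕ) : BPHom (tropPoint n).stalk (tropBP n) :=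
  ((tropBP n).sub.localize (tropPoint n).compl).lift
    { toFun := fun x => Localization.liftOn x
        (fun (a : TropN n) (s : (tropPoint n).compl) => (a / (s : TropN n) : TropN n)) (by
          intro a c b d hr
          rw [Localization.r_iff_exists] at hr
          obtain ⟨e, he⟩ := hr
          have he' := mul_left_cancel₀ (tropPoint_ne_zero e) he
          refine (div_eq_div_iff (tropPoint_ne_zero b) (tropPoint_ne_zero d)).2 ?_
          rw [mul_comm]
          refine he'.trans (mul_comm _ _))
      map_zero' := by
        rw [← Localization.mk_zero (1 : (tropPoint n).compl), Localization.liftOn_mk]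
        exact zero_div _
      map_one' := by
        rw [← Localization.mk_one, Localization.liftOn_mk]
        exact div_one (1 : TropN n)
      map_mul' := by
        intro x y
        induction x, y using Localization.induction_on₂ with
        | H x y =>
          rw [Localization.mk_mul, Localization.liftOn_mk, Localization.liftOn_mk,
            Localization.liftOn_mk]
          exact mul_div_mul_comm (α := TropN n) _ _ _ _ }
    (by
      rintro _ _ ⟨s, M, N, rfl, rfl, hMN⟩
      have := (tropBP n).sub.smul ((s : TropN n)⁻¹ : TropN n) hMN
      exact (le_map_map (tropBP n) fun a => div_eq_inv_mul (a : TropN n) _).2 this)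

theorem stalkEval_frac (a : tropBP n) (s : (tropPoint n).compl) :
    stalkEval n ((tropBP n).frac a s) = ((a : TropN n) / (s : TropN n) : TropN n) := rfl

theorem frac_stalkEval (x : (tropPoint n).stalk) :
    (tropBP n).frac (stalkEval n x) (1 : (tropPoint n).compl) = x := by
  obtain ⟨a, s, rfl⟩ := frac_surj x
  rw [stalkEval_frac, ← frac_cancel s 1, mul_one]
  congr 1
  exact mul_div_cancel₀ (G₀ := TropN n) _ (tropPoint_ne_zero s)

/-- The inverse `Γ(Spec 𝕋^(n)) → 𝕋^(n)` of `toGlobal`. -/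
noncomputable def globalEval (n : ℕ) : BPHom ((Spec (tropBP n)).sec ⊤) (tropBP n) where
  hom := (stalkEval n).hom.comp
    (PrimeKIdeal.evalAt (B := tropBP n) (U := ⊤) ⟨tropPoint n, trivial⟩)
  map_le {s t} h := by
    have := (stalkEval n).map_le (h ⟨tropPoint n, trivial⟩)
    exact le_of_le_map_map _ this fun _ => rfl

theorem globalEval_toGlobal (a : tropBP n) : globalEval n (toGlobal (tropBP n) a) = a :=
  div_one (a : TropN n)

theorem toGlobal_globalEval (s : (Spec (tropBP n)).sec ⊤) :
    toGlobal (tropBP n) (globalEval n s) = s := by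
  refine Subtype.ext (funext fun ⟨p, hp⟩ => ?_)
  obtain rfl := eq_tropPoint p
  exact frac_stalkEval _

end Trop
open PrimeKIdeal
/-! ### Morphisms from `Spec 𝕋^(n)` to an affine scheme -/

section Points

variable {n : ℕ} {D : OrderedBlueprint.{u}}

/-- The morphism `D → 𝕋^(n)` of ordered blueprints associated with a morphism
`Spec 𝕋^(n) → Spec D`, by taking global sections. -/
noncomputable def SpHom.toHom (φ : SpHom (Spec (tropBP n)) (Spec D)) : BPHom D (tropBP n) :=
  (globalEval n).comp (φ.global.comp (toGlobalHom D))

theorem SpHom.toGlobal_toHom (φ : SpHom (Spec (tropBP n)) (Spec D)) (d : D) :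
    toGlobal (tropBP n) (φ.toHom d) = φ.global (toGlobal D d) := toGlobal_globalEval _

theorem isUnit_res_toGlobal (d : D) (W : Opens (PrimeKIdeal D)) (hW : ∀ p ∈ W, d ∈ p.compl) :
    IsUnit ((Spec D).res (le_top : W ≤ ⊤) (toGlobal D d)) := by
  refine IsUnit.of_mul_eq_one (M := sections W) (⟨fun p => D.frac 1 ⟨d, hW p.1 p.2⟩, fun p =>
    ⟨1, d, hW p.1 p.2, fun _ _ => rfl⟩⟩ : sections W) ?_
  refine Subtype.ext (funext fun p => ?_)
  change D.frac d 1 * D.frac 1 ⟨d, hW p.1 p.2⟩ = 1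
  rw [frac_mul, mul_one, one_mul]
  exact frac_self (⟨d, hW p.1 p.2⟩ : p.1.compl)

/-- The image point of `φ` is the kernel of `φ.toHom`; this is where the locality of `φ` enters. -/
theorem SpHom.mem_compl_base_iff (φ : SpHom (Spec (tropBP n)) (Spec D)) (d : D) :
    d ∈ PrimeKIdeal.compl (B := D) (φ.base (tropPoint n)) ↔ (φ.toHom d : TropN n) ≠ 0 := by
  constructor
  · intro hd
    have h1 := (isUnit_res_toGlobal d (principal d) fun _ h => h).map (φ.app (principal d)).hom
    have e := φ.app_res (U := principal d) (V := ⊤) le_top (toGlobal D d)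
    change IsUnit (φ.app (principal d) ((Spec D).res le_top (toGlobal D d))) at h1
    rw [e] at h1
    have h2 := (h1.map (evalAt (B := tropBP n) (U := preim φ.base (principal d))
      ⟨tropPoint n, hd⟩)).map (stalkEval n).hom
    exact h2.ne_zero
  · intro hd
    have h1 : IsUnit (φ.toHom d) := isUnit_iff_ne_zero.2 hd
    have h2 := h1.map (toGlobalHom (tropBP n)).hom
    change IsUnit (toGlobal (tropBP n) (φ.toHom d)) at h2
    rw [φ.toGlobal_toHom] at h2
    obtain ⟨W, hW, hpW, hu⟩ := φ.isLocal ⊤ (toGlobal D d) (tropPoint n) trivial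
      ⟨⊤, le_top, trivial, h2⟩
    exact notMem_of_isUnit (hu.map (evalAt (B := D) (U := W) ⟨φ.base (tropPoint n), hpW⟩))

/-- A morphism acts on a section that equals `a / h` around the image point by
`φ.toHom a / φ.toHom h`; thus `φ.toHom` determines `φ`. -/
theorem SpHom.stalkEval_app (φ : SpHom (Spec (tropBP n)) (Spec D)) (V : Opens (PrimeKIdeal D))
    (s : sections V) (hV : φ.base (tropPoint n) ∈ V) {a h : D}
    (hh : h ∈ PrimeKIdeal.compl (B := D) (φ.base (tropPoint n)))
    (hs : ∀ (q : V) (hq : h ∈ q.1.compl), s.1 q = D.frac a ⟨h, hq⟩) :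
    stalkEval n ((φ.app V s).1 ⟨tropPoint n, hV⟩) =
      ((φ.toHom a : TropN n) / (φ.toHom h : TropN n) : TropN n) := by
  -- Around the image point, `s` times the section `h` is the section `a`.
  let W : Opens (PrimeKIdeal D) := V ⊓ principal h
  have hmul : (Spec D).res (inf_le_left : W ≤ V) s * (Spec D).res (le_top : W ≤ ⊤) (toGlobal D h) =
      (Spec D).res (le_top : W ≤ ⊤) (toGlobal D a) := by
    refine Subtype.ext (funext fun p => ?_)
    change s.1 ⟨p.1, p.2.1⟩ * D.frac h 1 = D.frac a 1
    rw [hs ⟨p.1, p.2.1⟩ p.2.2, frac_mul, mul_one, mul_comm a]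
    have := frac_cancel (⟨h, p.2.2⟩ : p.1.compl) 1 a
    rwa [mul_one] at this
  have h1 := congrArg (φ.app W).hom hmul
  rw [map_mul] at h1
  have e1 := φ.app_res (U := W) (V := V) inf_le_left s
  have e2 := φ.app_res (U := W) (V := ⊤) le_top (toGlobal D h)
  have e3 := φ.app_res (U := W) (V := ⊤) le_top (toGlobal D a)
  have h2 := (congrArg₂ (· * ·) e1 e2).symm.trans (h1.trans e3)
  have h3 := congrArg (fun z : sections (preim φ.base W) =>
    stalkEval n (z.1 ⟨tropPoint n, hV, hh⟩)) h2
  rw [eq_div_iff ((φ.mem_compl_base_iff h).1 hh)]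
  refine Eq.trans ?_ h3
  exact (map_mul (stalkEval n).hom _ _).symm

theorem SpHom.eq_of_toHom_eq {φ ψ : SpHom (Spec (tropBP n)) (Spec D)}
    (H : ∀ d, φ.toHom d = ψ.toHom d) : φ = ψ := by
  have hbase : φ.base = ψ.base := by
    refine ContinuousMap.ext fun p => ?_
    obtain rfl := eq_tropPoint p
    refine PrimeKIdeal.ext (Set.ext fun d => ?_)
    have e : (φ.toHom d : TropN n) ≠ 0 ↔ (ψ.toHom d : TropN n) ≠ 0 := by rw [H d]
    have := (φ.mem_compl_base_iff d).trans (e.trans (ψ.mem_compl_base_iff d).symm)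
    exact not_iff_not.1 this
  have key : ∀ (V : Opens (PrimeKIdeal D)) (s : sections V) (h1 : φ.base (tropPoint n) ∈ V)
      (h2 : ψ.base (tropPoint n) ∈ V),
      (φ.app V s).1 ⟨tropPoint n, h1⟩ = (ψ.app V s).1 ⟨tropPoint n, h2⟩ := by
    intro V s h1 h2
    obtain ⟨a, h, hh, hs⟩ := s.2 ⟨_, h1⟩
    rw [← frac_stalkEval ((φ.app V s).1 ⟨tropPoint n, h1⟩),
      ← frac_stalkEval ((ψ.app V s).1 ⟨tropPoint n, h2⟩), φ.stalkEval_app V s h1 hh hs,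
      ψ.stalkEval_app V s h2 (hbase ▸ hh) hs, H, H]
  obtain ⟨b, f, _, _⟩ := φ
  obtain ⟨b', f', _, _⟩ := ψ
  obtain rfl : b = b' := hbase
  obtain rfl : f = f' := by
    refine funext fun V => BPHom.ext (MonoidWithZeroHom.ext fun s => Subtype.ext (funext ?_))
    rintro ⟨p, hp⟩
    obtain rfl := eq_tropPoint p
    exact key V s hp hp
  rfl

theorem toHom_map (f : BPHom D (tropBP n)) (d : D) : (Spec.map f).toHom d = f d := by
  change ((f d : TropN n) / (f (1 : D) : TropN n) : TropN n) = f d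
  rw [show f (1 : D) = 1 from map_one f.hom]
  exact div_one (f d : TropN n)

theorem SpHom.map_toHom (φ : SpHom (Spec (tropBP n)) (Spec D)) : Spec.map φ.toHom = φ :=
  SpHom.eq_of_toHom_eq fun d => toHom_map _ d

end Points
/-! ### The fine topology on an affine scheme -/

section Topology

variable {n : ℕ} {D : OrderedBlueprint.{u}}

theorem coinduced_toGlobal (n : ℕ) :
    TopologicalSpace.coinduced (toGlobal (tropBP n)) inferInstance =
      TopologicalSpace.induced (globalEval n) inferInstance := by
  refine TopologicalSpace.ext_iff.2 fun U => ?_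
  rw [isOpen_coinduced, isOpen_induced_iff]
  constructor
  · exact fun h => ⟨_, h, Set.ext fun s => by
      rw [Set.mem_preimage, Set.mem_preimage, toGlobal_globalEval]⟩
  · rintro ⟨W, hW, rfl⟩
    rw [show toGlobal (tropBP n) ⁻¹' (globalEval n ⁻¹' W) = W from Set.ext fun a => by
      rw [Set.mem_preimage, Set.mem_preimage, globalEval_toGlobal]]
    exact hW

theorem affineTopology_eq_iInf_induced {X : OBSpace.{u}} (str : SpHom X (Spec (tropBP n))) :
    affineTopology X str = ⨅ a : X.sec ⊤,
      TopologicalSpace.induced (fun φ : RatPt X str => globalEval n (φ.1.global a)) inferInstance := by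
  refine iInf_congr fun a => ?_
  rw [coinduced_toGlobal, induced_compose]
  rfl

/-- On an affine scheme the fine topology is the affine one, since the identity is among the morphisms
from affine schemes that define it. -/
theorem fineTopology_eq_affineTopology (str : SpHom (Spec D) (Spec (tropBP n))) :
    fineTopology (Spec D) str = affineTopology (Spec D) str := by
  refine le_antisymm (iSup₂_le fun D' α => ?_) ?_
  · rw [← continuous_iff_coinduced_le, affineTopology_eq_iInf_induced str,
      affineTopology_eq_iInf_induced (str.comp α)]
    refine continuous_iInf_rng.2 fun a => continuous_induced_rng.2 ?_
    exact continuous_iInf_dom (i := α.global a) continuous_induced_dom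
  · refine le_trans ?_ (le_iSup₂ (f := fun (D : OrderedBlueprint.{u}) (α : SpHom (Spec D) (Spec _)) =>
      TopologicalSpace.coinduced (RatPt.map (strX := str.comp α) α rfl)
      (affineTopology (Spec D) (str.comp α))) D (SpHom.id (Spec D)))
    exact (coinduced_id (t := affineTopology (Spec D) str)).ge

/-- It is enough to evaluate at elements of `D`: an arbitrary global section of `Spec D` is locally a
fraction, and division is continuous where the denominator does not vanish. -/
theorem affineTopology_eq_induced_toHom (str : SpHom (Spec D) (Spec (tropBP n))) :
    affineTopology (Spec D) str =
      TopologicalSpace.induced (fun (φ : RatPt (Spec D) str) (d : D) => φ.1.toHom d)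
        Pi.topologicalSpace := by
  rw [affineTopology_eq_iInf_induced]
  refine le_antisymm ?_ (le_iInf fun a => ?_)
  · rw [← continuous_iff_le_induced]
    refine @continuous_pi _ _ _ (_) _ _ fun d => ?_
    exact continuous_iInf_dom (i := toGlobal D d) continuous_induced_dom
  · rw [← continuous_iff_le_induced]
    let _ := TopologicalSpace.induced (fun (φ : RatPt (Spec D) str) (d : D) => φ.1.toHom d)
        Pi.topologicalSpace
    have hev : ∀ d : D, Continuous fun φ : RatPt (Spec D) str => (φ.1.toHom d : TropN n) := fun d =>
      (continuous_apply d).comp continuous_induced_dom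
    refine continuous_iff_continuousAt.2 fun φ => ?_
    -- Near `φ`, evaluation at the section `a` is `ψ ↦ ψ b / ψ h`.
    obtain ⟨b, h, hh, hs⟩ := a.2 ⟨φ.1.base (tropPoint n), trivial⟩
    have h0 : (φ.1.toHom h : TropN n) ≠ 0 := (φ.1.mem_compl_base_iff h).1 hh
    have hcont : ContinuousAt (fun ψ : RatPt (Spec D) str =>
        ((ψ.1.toHom b : TropN n) / (ψ.1.toHom h : TropN n) : TropN n)) φ :=
      ContinuousAt.comp (f := fun ψ : RatPt (Spec D) str =>
        ((ψ.1.toHom b : TropN n), (ψ.1.toHom h : TropN n))) (continuousAt_div h0)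
        ((hev b).prodMk (hev h)).continuousAt
    refine hcont.congr ?_
    have hopen : IsOpen {ψ : RatPt (Spec D) str | (ψ.1.toHom h : TropN n) ≠ 0} :=
      isOpen_ne.preimage (hev h)
    filter_upwards [hopen.mem_nhds h0] with ψ hψ
    exact (ψ.1.stalkEval_app ⊤ a trivial ((ψ.1.mem_compl_base_iff h).2 hψ) hs).symm

end Topology
/-! ### Points of the bend -/

section BendPoints

variable {n : ℕ}

theorem toHom_id (t : tropBP n) : (SpHom.id (Spec (tropBP n))).toHom t = t :=
  globalEval_toGlobal t

theorem toHom_map_comp {B : OrderedBlueprint.{u}} {C : OrderedBlueprint.{v}} (f : BPHom B C)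
    (φ : SpHom (Spec (tropBP n)) (Spec C)) (b : B) :
    ((Spec.map f).comp φ).toHom b = φ.toHom (f b) := by
  conv_lhs => rw [← φ.map_toHom, Spec.map_comp, toHom_map]
  rfl

variable {K : OrderedBlueprint.{w}} {B : OrderedBlueprint.{u}} (v : K →*₀ tropBP n)
  (i : BPHom K B)

theorem bendMk_mul_bendMk (b c : B) (s t : tropBP n) :
    bendMk v i b s * bendMk v i c t = bendMk v i (b * c) (s * t) := rfl

theorem bendMk_mul_bendStr (b : B) (t : tropBP n) :
    bendMk v i b 1 * bendStr v i t = bendMk v i b t := by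
  change bendMk v i (b * 1) (1 * t) = _
  rw [mul_one, one_mul]

theorem exists_bendMk (x : bend v i) : ∃ b t, bendMk v i b t = x := by
  obtain ⟨y, rfl⟩ := (gen (BendRel v i)).quot_surjective x
  induction y using Con.induction_on with
  | H p => exact ⟨p.1, p.2, rfl⟩

variable {v i}

theorem toHom_bendStr (φ : BendPt v i) (t : tropBP n) : φ.1.toHom (bendStr v i t) = t := by
  rw [← toHom_map_comp, φ.2, toHom_id]

/-- The function `b ↦ φ(b ⊗ 1)` on `B` given by a `𝕋^(n)`-point `φ` of the bend of `Spec B`. -/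
noncomputable def bendEval (φ : BendPt v i) (b : B) : TropN n := φ.1.toHom (bendMk v i b 1)

theorem toHom_bendMk (φ : BendPt v i) (b : B) (t : tropBP n) :
    φ.1.toHom (bendMk v i b t) = (bendEval φ b * t : TropN n) := by
  rw [← bendMk_mul_bendStr]
  refine (map_mul φ.1.toHom.hom _ _).trans ?_
  rw [toHom_bendStr]
  rfl

theorem induced_pi_le {X : Type*} {I : Type*} {J : Type*} {Y : Type*} [TopologicalSpace Y]
    {F : X → I → Y} {G : X → J → Y}
    (h : ∀ j, ∃ i, ∃ c : Y → Y, Continuous c ∧ ∀ x, G x j = c (F x i)) :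
    TopologicalSpace.induced F Pi.topologicalSpace ≤
      TopologicalSpace.induced G Pi.topologicalSpace := by
  let _ := TopologicalSpace.induced F Pi.topologicalSpace
  refine continuous_iff_le_induced.1 (continuous_pi fun j => ?_)
  obtain ⟨i, c, hc, h⟩ := h j
  simp only [h]
  exact hc.comp ((continuous_apply i).comp continuous_induced_dom)

/-- The elements `b ⊗ t` generate the bend and `φ(b ⊗ t) = φ(b ⊗ 1) t`, so a point is determined by its
values on the `b ⊗ 1`, and so is the topology. -/
theorem isEmbedding_bendEval :
    Topology.IsEmbedding (bendEval : BendPt v i → B → TropN n) where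
  eq_induced := by
    rw [fineTopology_eq_affineTopology, affineTopology_eq_induced_toHom]
    refine le_antisymm (induced_pi_le fun b => ⟨bendMk v i b 1, _, continuous_id, fun _ => rfl⟩)
      (induced_pi_le fun d => ?_)
    obtain ⟨b, t, rfl⟩ := exists_bendMk v i d
    exact ⟨b, _, continuous_mul_const (t : TropN n), fun φ => toHom_bendMk φ b t⟩
  injective φ ψ h := Subtype.ext <| SpHom.eq_of_toHom_eq fun d => by
    obtain ⟨b, t, rfl⟩ := exists_bendMk v i d
    rw [toHom_bendMk, toHom_bendMk, h]

theorem bendEval_one (φ : BendPt v i) : bendEval φ 1 = 1 := map_one φ.1.toHom.hom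

theorem bendEval_mul (φ : BendPt v i) (b c : B) :
    bendEval φ (b * c) = bendEval φ b * bendEval φ c := by
  refine (congrArg φ.1.toHom ?_).trans (map_mul φ.1.toHom.hom (bendMk v i b 1) (bendMk v i c 1))
  rw [bendMk_mul_bendMk, mul_one]

theorem bendEval_str (φ : BendPt v i) (d : K) : bendEval φ (i d) = v d := by
  refine Eq.trans (congrArg φ.1.toHom ?_) (toHom_bendStr φ (v d))
  have := congrArg (gen (BendRel v i)).quot (tens_balanced v i d 1 1)
  rwa [mul_one, mul_one] at this

theorem bendEval_zero (φ : BendPt v i) : bendEval φ 0 = 0 := by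
  have := bendEval_str φ 0
  rwa [show i 0 = 0 from map_zero i.hom, map_zero] at this

/-- The bend relation `a + ∑ bⱼ ≡ ∑ bⱼ` says in the idempotent semiring `𝕋^(n)` that the value of `a`
is at most the maximum of the values of the `bⱼ`. -/
theorem bendEval_le (φ : BendPt v i) {a : B} {N : Multiset B} (h : B.le {a} N) :
    bendEval φ a ≤ (N.map (bendEval φ)).sum := by
  have h1 := φ.1.toHom.map_le ((gen (BendRel v i)).quot_le (GenLe.of (BendRel.bend h)))
  have h2 := le_of_le_map_map _ (le_of_le_map_map _ h1 (h := fun x => φ.1.toHom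
    ((gen (BendRel v i)).quot x)) fun _ => rfl) (h := bendEval φ) fun _ => rfl
  rw [ofSemiring_le_iff, Multiset.map_cons, Multiset.sum_cons] at h2
  exact TropN.add_eq_right_iff.1 h2

/-- The morphism `b ⊗ t ↦ f(b) t` from the bend to `𝕋^(n)`. -/
noncomputable def bendLift (f : B →*₀ TropN n) (hi : ∀ d, f (i d) = v d)
    (hle : ∀ (a : B) (N : Multiset B), B.le {a} N → f a ≤ (N.map f).sum) :
    BPHom (bend v i) (tropBP n) :=
  (gen (BendRel v i)).lift
    { toFun := fun x => Con.lift (tensorCon v i)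
        { toFun := fun p : B × tropBP n => (f p.1 * p.2 : TropN n)
          map_one' := (mul_one (f 1)).trans (map_one f)
          map_mul' := fun p q => by
            refine (congrArg (· * (p.2 * q.2 : TropN n)) (map_mul f p.1 q.1)).trans ?_
            exact mul_mul_mul_comm (G := TropN n) _ _ _ _ }
        (by
          refine Con.conGen_le.2 ?_
          rintro _ _ ⟨d, b, t, rfl, rfl⟩
          change (f (i d * b) * t : TropN n) = (f b * (v d * t : TropN n) : TropN n)
          rw [map_mul, hi, mul_comm (v d : TropN n) (f b), mul_assoc]) x
      map_zero' := by
        change (f 0 * (0 : TropN n) : TropN n) = 0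
        exact mul_zero _
      map_one' := map_one _
      map_mul' := map_mul _ }
    (fun {s t} h => by
      refine gen_map_le _ ?_ h
      have key : ∀ a : B, ((f a * (1 : TropN n) : TropN n)) = f a := fun a => mul_one _
      have hbend : ∀ (a : B) (N : Multiset B), B.le {a} N →
          ((a ::ₘ N).map f).sum = (N.map f).sum := fun a N h => by
        rw [Multiset.map_cons, Multiset.sum_cons]
        exact TropN.add_eq_right_iff.2 (hle a N h)
      rintro _ _ (@⟨M, N, h⟩ | @⟨a, N, h⟩ | @⟨a, N, h⟩)
      · refine (le_map_map _ (h := fun t => t) fun t => ?_).2 ?_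
        · change (f 1 * t : TropN n) = t
          rw [map_one, one_mul]
        · rwa [Multiset.map_id', Multiset.map_id']
      · exact (le_map_map _ key).2 (ofSemiring_le_iff.2 (hbend a N h))
      · exact (le_map_map _ key).2 (ofSemiring_le_iff.2 (hbend a N h).symm))

theorem bendLift_bendMk (f : B →*₀ TropN n) (hi : ∀ d, f (i d) = v d)
    (hle : ∀ (a : B) (N : Multiset B), B.le {a} N → f a ≤ (N.map f).sum) (b : B) (t : tropBP n) :
    bendLift f hi hle (bendMk v i b t) = (f b * t : TropN n) := rfl

/-- The `𝕋^(n)`-point of the bend given by `b ⊗ t ↦ f(b) t`. -/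
noncomputable def bendPtOfHom (f : B →*₀ TropN n) (hi : ∀ d, f (i d) = v d)
    (hle : ∀ (a : B) (N : Multiset B), B.le {a} N → f a ≤ (N.map f).sum) : BendPt v i :=
  ⟨Spec.map (bendLift f hi hle), SpHom.eq_of_toHom_eq fun t => by
    rw [Spec.map_comp, toHom_map, toHom_id]
    change bendLift f hi hle (bendMk v i 1 t) = t
    rw [bendLift_bendMk, map_one]
    exact one_mul (t : TropN n)⟩

theorem bendEval_bendPtOfHom (f : B →*₀ TropN n) (hi : ∀ d, f (i d) = v d)
    (hle : ∀ (a : B) (N : Multiset B), B.le {a} N → f a ≤ (N.map f).sum) (b : B) :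
    bendEval (bendPtOfHom f hi hle) b = f b := by
  refine (toHom_map _ _).trans ((bendLift_bendMk f hi hle b 1).trans ?_)
  exact mul_one (f b)

theorem toGlobal_bendEval (φ : BendPt v i) (b : B) :
    φ.1.global (toGlobal _ (bendMk v i b 1)) = toGlobal (tropBP n) (bendEval φ b) :=
  (φ.1.toGlobal_toHom _).symm

theorem bendEval_bendPtMap {C : OrderedBlueprint.{x}} {j : BPHom K C} (f : BPHom B C)
    (hf : f.comp i = j) (φ : BendPt v j) (b : B) :
    bendEval (bendPtMap v f hf φ) b = bendEval φ (f b) :=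
  toHom_map_comp _ _ _

theorem continuous_bendPtMap {C : OrderedBlueprint.{x}} {j : BPHom K C} (f : BPHom B C)
    (hf : f.comp i = j) : Continuous (bendPtMap v f hf) := by
  refine isEmbedding_bendEval.continuous_iff.2 (continuous_pi fun b => ?_)
  have := (continuous_apply (f b)).comp
    (isEmbedding_bendEval : Topology.IsEmbedding (bendEval : BendPt v j → C → TropN n)).continuous
  convert this using 2 with φ
  exact bendEval_bendPtMap f hf φ b

end BendPoints

/-! ### Analytification and tropicalization as points of the bend -/

theorem exists_homeomorph_of_range_eq {X Y Z : Type*} [TopologicalSpace X] [TopologicalSpace Y]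
    [TopologicalSpace Z] {F : X → Z} {G : Y → Z} (hF : Topology.IsEmbedding F)
    (hG : Topology.IsEmbedding G) (h : Set.range F = Set.range G) :
    ∃ e : X ≃ₜ Y, ∀ x, G (e x) = F x := by
  refine ⟨hF.toHomeomorph.trans ((Homeomorph.setCongr h).trans hG.toHomeomorph.symm), fun x => ?_⟩
  exact congrArg Subtype.val
    (hG.toHomeomorph.apply_symm_apply ((Homeomorph.setCongr h) (hF.toHomeomorph x)))

section Comparison

variable {k : Type w} [Field k] {n : ℕ} (v : Valuation k (TropN n))
  {R : Type u} [CommRing R] [Algebra k R]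

theorem isEmbedding_frAn :
    Topology.IsEmbedding (fun (x : FRAn v R) (a : R) => x.1 a) where
  eq_induced := (induced_to_pi _).symm
  injective _ _ h := Subtype.ext (Valuation.ext fun a => congrFun h a)

variable {v}

theorem ofSemiring_singleton_le_iff {a : R} {N : Multiset R} : (ofSemiring R).le {a} N ↔ a = N.sum := by
  rw [ofSemiring_le_iff, Multiset.sum_singleton]

theorem valuation_sum_le {S : Type*} [CommRing S] (x : Valuation S (TropN n)) (N : Multiset S) :
    x N.sum ≤ (N.map x).sum := by
  induction N using Multiset.induction_on with
  | empty => simp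
  | cons a N ih =>
    rw [Multiset.sum_cons, Multiset.map_cons, Multiset.sum_cons]
    exact (x.map_add _ _).trans (max_le_max le_rfl ih)

/-- The relations of `R` with a single left hand side are `a ≤ ∑ bⱼ` for `a = ∑ bⱼ`, so that the
functions that satisfy the bend relations are the ones satisfying the ultrametric inequality. -/
theorem range_frAn_eq :
    (Set.range fun (x : FRAn v R) (a : R) => x.1 a) =
      Set.range (bendEval : BendY v R → R → TropN n) := by
  ext g
  constructor
  · rintro ⟨x, rfl⟩
    refine ⟨bendPtOfHom (B := ofSemiring R) (v := valHom v) (i := algStr k R)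
      x.1.toMonoidWithZeroHom x.2 fun a N h => ?_, funext fun b => bendEval_bendPtOfHom _ _ _ b⟩
    rw [ofSemiring_singleton_le_iff.1 h]
    exact valuation_sum_le x.1 N
  · rintro ⟨φ, rfl⟩
    refine ⟨⟨⟨⟨⟨bendEval φ, bendEval_zero φ⟩, bendEval_one φ, bendEval_mul φ⟩, fun a b => ?_⟩,
      bendEval_str φ⟩, rfl⟩
    have h := bendEval_le φ (a := a + b) (N := {a, b}) (ofSemiring_singleton_le_iff.2 (by simp))
    rw [Multiset.insert_eq_cons, Multiset.map_cons, Multiset.map_singleton, Multiset.sum_cons,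
      Multiset.sum_singleton] at h
    exact h

variable {A : Type v} [CommMonoidWithZero A] (π : MonAlg k A →ₐ[k] R)

theorem modelStr_mul_modelMk (c : k) (a : A) : modelStr π c * modelMk π 1 a = modelMk π c a := by
  refine (map_mul (Subaddition.ofHom (freeEval π)).quot (freeMk k c 1)
    (freeMk k 1 a)).symm.trans ?_
  refine congrArg (Subaddition.ofHom (freeEval π)).quot ?_
  exact congrArg (conMk (smashCon k A)) (Prod.ext (mul_one c) (one_mul a))

theorem modelIncl_modelMk (c : k) (a : A) : modelIncl π (modelMk π c a) = c • coord π a :=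
  map_smul π c (monAlgOf k A a)

theorem exists_modelMk (z : modelBP π) : ∃ c a, modelMk π c a = z := by
  obtain ⟨y, rfl⟩ := (Subaddition.ofHom (freeEval π)).quot_surjective z
  induction y using Con.induction_on with
  | H p => exact ⟨p.1, p.2, rfl⟩

/-- A linear relation between the images in `R` of the monomials is a relation of the blueprint of
`Z`. -/
theorem modelBP_le_of_sum_eq {a : A} {c : k} {N : Multiset (k × A)}
    (h : c • coord π a = (N.map fun p => p.1 • coord π p.2).sum) :
    (modelBP π).le {modelMk π c a} (N.map fun p => modelMk π p.1 p.2) := by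
  have h' : (Subaddition.ofHom (freeEval π)).le {freeMk k c a}
      (N.map fun p => freeMk k p.1 p.2) := by
    change (Multiset.map (freeEval π) {freeMk k c a}).sum = _
    rw [Multiset.map_map, Multiset.map_singleton, Multiset.sum_singleton]
    have key : ∀ p : k × A, freeEval π (freeMk k p.1 p.2) = p.1 • coord π p.2 := fun p =>
      map_smul π p.1 (monAlgOf k A p.2)
    rw [key (c, a), h]
    exact congrArg Multiset.sum (Multiset.map_congr rfl fun p _ => (key p).symm)
  have := (Subaddition.ofHom (freeEval π)).quot_le h'
  rw [Multiset.map_map] at this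
  exact this

theorem bendEval_modelMk (φ : BendZ v π) (c : k) (a : A) :
    bendEval φ (modelMk π c a) = v c * bendEval φ (modelMk π 1 a) := by
  rw [← modelStr_mul_modelMk, bendEval_mul, bendEval_str]
  rfl

theorem span_range_coord (hπ : Function.Surjective π) :
    Submodule.span k (Set.range (coord π)) = ⊤ := by
  have h1 : Submodule.span k (Set.range (MonoidAlgebra.of k A)) = ⊤ := by
    refine eq_top_iff.2 fun f _ => ?_
    induction f using MonoidAlgebra.induction_on with
    | of a => exact Submodule.subset_span ⟨a, rfl⟩
    | add f g hf hg => exact add_mem (hf trivial) (hg trivial)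
    | smul c f hf => exact Submodule.smul_mem _ c (hf trivial)
  have h2 := congrArg (Submodule.map
    ((π.comp (Ideal.Quotient.mkₐ k (Ideal.span {MonoidAlgebra.of k A 0}))).toLinearMap)) h1
  rw [Submodule.map_span, ← Set.range_comp, Submodule.map_top, LinearMap.range_eq_top.2] at h2
  · exact h2
  · exact hπ.comp Ideal.Quotient.mk_surjective

/-- Surjectivity of the tropicalization onto the points of the bend of `Z`. -/
theorem exists_frAn_of_bendZ [Monoid.FG A] (hπ : Function.Surjective π) (φ : BendZ v π) :
    ∃ x : FRAn v R, ∀ a, x.1 (coord π a) = bendEval φ (modelMk π 1 a) := by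
  let y : A →*₀ TropN n :=
    { toFun := fun a => bendEval φ (modelMk π 1 a)
      map_zero' := by
        refine Eq.trans (congrArg (bendEval φ) ?_) (bendEval_zero φ)
        refine (congrArg (Subaddition.ofHom (freeEval π)).quot ?_).trans (map_zero _)
        exact (Con.eq _).2 (ConGen.Rel.of _ _ ⟨Or.inr rfl, Or.inr rfl⟩)
      map_one' := bendEval_one φ
      map_mul' := fun a b => by
        rw [← bendEval_mul]
        refine congrArg (bendEval φ) (Eq.trans ?_ (map_mul (Subaddition.ofHom (freeEval π)).quot
          (freeMk k 1 a) (freeMk k 1 b)))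
        refine congrArg (Subaddition.ofHom (freeEval π)).quot ?_
        exact congrArg (conMk (smashCon k A)) (Prod.ext (one_mul (1 : k)).symm rfl) }
  obtain ⟨w, hw, hy⟩ := exists_valuation_of_bend v (fun γ N => TropN.exists_pow_eq γ N)
    (coord π) y (span_range_coord π hπ) fun a c N hc ha h => by
      have h1 := bendEval_le φ (modelBP_le_of_sum_eq π h)
      rw [bendEval_modelMk, Multiset.map_map] at h1
      have hne : v c * y a ≠ 0 := mul_ne_zero ((map_ne_zero v).2 hc) ha
      obtain ⟨b, hb, hle⟩ := TropN.exists_mem_le_of_le_sum hne h1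
      obtain ⟨p, hp, rfl⟩ := Multiset.mem_map.1 hb
      refine ⟨p, hp, hle.trans_eq (bendEval_modelMk π φ _ _)⟩
  exact ⟨⟨w, hw⟩, hy⟩

/-- The function `c · a ↦ v(c) y(a)` on the blueprint of `Z` given by a point `y` of the
tropicalization. It is defined through a valuation that restricts to `y`, which shows that it is
well defined on classes of monomials; by `tropEval_modelMk` the choice does not matter. -/
noncomputable def tropEval (y : FRTrop v π) (z : modelBP π) : TropN n :=
  y.2.choose.1 (modelIncl π z)

variable {π}

theorem tropEval_modelMk (y : FRTrop v π) (c : k) (a : A) :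
    tropEval π y (modelMk π c a) = v c * y.1 a := by
  have h : y.2.choose.1 (coord π a) = y.1 a := DFunLike.congr_fun y.2.choose_spec a
  unfold tropEval
  rw [modelIncl_modelMk, Algebra.smul_def, map_mul, y.2.choose.2, h]

theorem tropEval_toFRTrop (x : FRAn v R) (z : modelBP π) :
    tropEval π (toFRTrop v π x) z = x.1 (modelIncl π z) := by
  obtain ⟨c, a, rfl⟩ := exists_modelMk π z
  rw [tropEval_modelMk, modelIncl_modelMk, Algebra.smul_def, map_mul, x.2]
  rfl

theorem isEmbedding_tropEval :
    Topology.IsEmbedding (tropEval π : FRTrop v π → modelBP π → TropN n) where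
  eq_induced := by
    have h : (inferInstance : TopologicalSpace (FRTrop v π)) =
        TopologicalSpace.induced (fun (y : FRTrop v π) (a : A) => y.1 a) Pi.topologicalSpace := by
      have : (inferInstance : TopologicalSpace (A →*₀ TropN n)) =
        TopologicalSpace.induced (fun (y : A →*₀ TropN n) (a : A) => y a) Pi.topologicalSpace :=
        (induced_to_pi _).symm
      change TopologicalSpace.induced Subtype.val inferInstance = _
      rw [this, induced_compose]
      rfl
    refine h.trans (le_antisymm (induced_pi_le fun z => ?_) (induced_pi_le fun a => ?_))
    · obtain ⟨c, a, rfl⟩ := exists_modelMk π z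
      exact ⟨a, _, continuous_mul_const (v c), fun y => by rw [tropEval_modelMk, mul_comm]⟩
    · exact ⟨modelMk π 1 a, _, continuous_id, fun y => by
        rw [tropEval_modelMk, map_one, one_mul, id]⟩
  injective y y' h := by
    refine Subtype.ext (MonoidWithZeroHom.ext fun a => ?_)
    have := congrFun h (modelMk π 1 a)
    rwa [tropEval_modelMk, tropEval_modelMk, map_one, one_mul, one_mul] at this

theorem continuous_toFRTrop : Continuous (toFRTrop v π) := by
  refine isEmbedding_tropEval.continuous_iff.2 (continuous_pi fun z => ?_)
  have := (continuous_apply (modelIncl π z)).comp (isEmbedding_frAn v (R := R)).continuous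
  convert this using 2 with x
  exact tropEval_toFRTrop x z

theorem range_tropEval_eq [Monoid.FG A] (hπ : Function.Surjective π) :
    Set.range (tropEval π : FRTrop v π → modelBP π → TropN n) =
      Set.range (bendEval : BendZ v π → modelBP π → TropN n) := by
  ext g
  constructor
  · rintro ⟨⟨_, x, rfl⟩, rfl⟩
    obtain ⟨φ, hφ⟩ := range_frAn_eq.le ⟨x, rfl⟩
    refine ⟨bendBeta v π φ, funext fun z => ?_⟩
    refine (bendEval_bendPtMap _ _ φ z).trans ((congrFun hφ _).trans ?_)
    exact (tropEval_toFRTrop x z).symm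
  · rintro ⟨φ, rfl⟩
    obtain ⟨x, hx⟩ := exists_frAn_of_bendZ π hπ φ
    refine ⟨toFRTrop v π x, funext fun z => ?_⟩
    obtain ⟨c, a, rfl⟩ := exists_modelMk π z
    rw [tropEval_modelMk, bendEval_modelMk, ← hx]
    rfl

end Comparison
end BlueScheme

open BlueScheme in
theorem theoremD {k : Type*} [Field k] {n : ℕ} (v : Valuation k (TropN n))
    {R : Type*} [CommRing R] [Algebra k R] :
    ∃ eY : FRAn v R ≃ₜ BendY v R,
      -- the point `eY w` of `Bend_v(Y)` is the one with `b ⊗ 1 ↦ w(b)`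
      (∀ (w : FRAn v R) (b : R),
        (eY w).1.global (toGlobal _ (bendMk (valHom v) (algStr k R) b 1)) =
          toGlobal (tropBP n) (w.1 b)) ∧
      ∀ {A : Type*} [CommMonoidWithZero A] [Monoid.FG A] (π : MonAlg k A →ₐ[k] R),
        Function.Surjective π →
        Continuous (toFRTrop v π) ∧ Continuous (bendBeta v π) ∧
        ∃ eZ : FRTrop v π ≃ₜ BendZ v π,
          -- the point `eZ y` of `Bend_v(Z)` is the one with `(c · a) ⊗ 1 ↦ v(c) y(a)`
          (∀ (y : FRTrop v π) (c : k) (a : A),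
            (eZ y).1.global (toGlobal _ (bendMk (valHom v) (modelStr π) (modelMk π c a) 1)) =
              toGlobal (tropBP n) (v c * y.1 a)) ∧
          ∀ w : FRAn v R, eZ (toFRTrop v π w) = bendBeta v π (eY w) := by
  obtain ⟨eY, hY⟩ := exists_homeomorph_of_range_eq (isEmbedding_frAn v (R := R))
    isEmbedding_bendEval range_frAn_eq
  refine ⟨eY, fun w b => ?_, fun {A} _ _ π hπ =>
    ⟨continuous_toFRTrop, continuous_bendPtMap _ _, ?_⟩⟩
  · rw [toGlobal_bendEval, hY]
  obtain ⟨eZ, hZ⟩ := exists_homeomorph_of_range_eq isEmbedding_tropEval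
    isEmbedding_bendEval (range_tropEval_eq (v := v) hπ)
  refine ⟨eZ, fun y c a => ?_, fun w => isEmbedding_bendEval.injective (funext fun z => ?_)⟩
  · rw [toGlobal_bendEval, hZ, tropEval_modelMk]
  · rw [hZ, tropEval_toFRTrop]
    exact ((bendEval_bendPtMap _ _ (eY w) z).trans (congrFun (hY w) _)).symm
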